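/- \textbf{Setting.} Let $m_1,m_2,m_3>0$, $m=m_1+m_2+m_3$, and fix $\mu,h\in\mathbb R$ (angular momentum and energy). Vectors of $\mathbb C^3$ are indexed $(12,31,23)$; covectors are also written as vectors of $\mathbb C^3$, with $\langle P,Q\rangle=\sum \bar P_{jk}Q_{jk}$, whose real part is the real pairing. The planar three-body problem has Hamiltonian $H(q,p)=\sum_i\frac{|p_i|^2}{2m_i}-\sum_{i<j}\frac{m_im_j}{|q_i-q_j|}$ and symplectic form $dq\wedge dp$ on $\{(q,p)\in\mathbb C^3\times\mathbb C^3: q_i\ne q_j\}$; its angular momentum is $\sum_i\operatorname{Im}(\bar q_ip_i)$. Let $M_\mu$ be the set of its states with $\sum p_i=0$ and angular momentum $\mu$, and $P_\mu$ the quotient of $M_\mu$ by $(q,p)\mapsto(uq+a(1,1,1),up)$, $|u|=1$, $a\in\mathbb C$. On $T^*\mathbb R^+\times T^*(\mathbb C^3\setminus 0)$, with coordinates $(r,p_r,z,\eta)$, put $\rho_{jk}=|z_{jk}|^2$, $\|z\|^2=\rho_{12}+\rho_{31}+\rho_{23}$, $X_{jk}=z_{jk}^2$, $|X|^2=\frac1m(m_1m_2\rho_{12}^2+m_3m_1\rho_{31}^2+m_2m_3\rho_{23}^2)$,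 $\tau=\rho_{12}\rho_{31}\rho_{23}/\|z\|^6$, $W=\frac{|X|}{\|z\|^6}(m_1m_2\rho_{31}\rho_{23}+m_1m_3\rho_{12}\rho_{23}+m_2m_3\rho_{12}\rho_{31})$, $\pi_1=\eta_{12}\bar z_{31}-\eta_{31}\bar z_{12}$, $\pi_2=\eta_{23}\bar z_{12}-\eta_{12}\bar z_{23}$, $\pi_3=\eta_{31}\bar z_{23}-\eta_{23}\bar z_{31}$, and $$\tilde H_\mu=\frac{\tau p_r^2}{2}+\frac{\tau\mu^2}{2r^2}+\frac{|X|^2}{r^2\|z\|^6}\Big(\frac{|\pi_1|^2\rho_{23}}{8m_1}+\frac{|\pi_2|^2\rho_{31}}{8m_2}+\frac{|\pi_3|^2\rho_{12}}{8m_3}\Big)-\frac1rW-h\tau .$$ The flow of $\tilde H_\mu$ is that of $$\dot r=\partial_{p_r}\tilde H_\mu,\quad \dot p_r=-\partial_r\tilde H_\mu,\quad \dot z=\partial_\eta\tilde H_\mu,\quad \dot\eta=-\partial_z\tilde H_\mu-\frac{2\mu\tau}{r^2}\,i\eta ,$$ where $\partial_z,\partial_\eta$ are real derivatives written as complex vectors.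 Let $$\Omega_\mu=dr\wedge dp_r+dz\wedge d\eta-2\mu\lambda\,\Omega_{FS},\qquad \lambda=\frac{4m_1m_2m_3\,\rho_{12}\rho_{31}\rho_{23}\|z\|^2}{m|X|^4},$$ with $\Omega_{FS}(V,V')=\operatorname{Im}\frac{\langle V,V'\rangle\|z\|^2-\langle V,z\rangle\langle z,V'\rangle}{\|z\|^4}$ and $(dz\wedge d\eta)(u,v)=\operatorname{Re}\langle\eta_v,z_u\rangle-\operatorname{Re}\langle\eta_u,z_v\rangle$. Let $$S=\{r>0,\ z\ne0,\ \langle\eta,z\rangle=0,\ z_{12}^2+z_{31}^2+z_{23}^2=0\},$$ let $S'\subset S$ be the part where no $z_{jk}$ vanishes, and let $G$ be the group generated by the complex scalings $(z,\eta)\mapsto(kz,\eta/\bar k)$, $k\in\mathbb C\setminus0$, and the translations $\eta\mapsto\eta+2c\bar z$, $c\in\mathbb C$. \textbf{Theorem.} \begin{enumerate} \item $\tilde H_\mu$, the vector field above and $\Omega_\mu$ are smooth on all of $T^*\mathbb R^+\times T^*(\mathbb C^3\setminus0)$, and the flow leaves $S$ invariant; $\tilde H_\mu$ is constant along solutions in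 $S$. \item At points of $S$ the vector field $v$ is tangent to $S$ and $\Omega_\mu(v,\cdot)=d\tilde H_\mu$ on $TS$. After adding a suitable complex multiple of $\bar z$ to the $\eta$-component of $v$, this holds on the full tangent space. \item $\Omega_\mu|_{S}$ is closed, and its kernel at each point is the tangent space of the $G$-orbit. $G$ preserves $S$, $\tilde H_\mu|_S$ and $\Omega_\mu|_S$. \item The flow on $S$ exists locally and takes $G$-orbits to $G$-orbits, so it induces a flow on $S/G$. \item The map $\Psi:S'\to M_\mu$ given by $Z_{jk}=\eta_{jk}/(2\bar z_{jk})$, $X^*=\frac1m(m_1m_2X_{12},m_3m_1X_{31},m_2m_3X_{23})$, $Y=Z+\mu iX^*/|X|^2$, $Q=rX/|X|$, $P=p_rX^*/|X|+|X|Y/r$, $$q=\tfrac1m(m_2Q_{12}-m_3Q_{31},\,m_3Q_{23}-m_1Q_{12},\,m_1Q_{31}-m_2Q_{23}),\quad p=(P_{12}-P_{31},\,P_{23}-P_{12},\,P_{31}-P_{23})$$ is smooth, pulls $dq\wedge dp$ back to $\Omega_\mu|_{S'}$, satisfies $\tilde H_\mu=\tau\,(H\circ\Psi-h)$, and induces a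 map $S'/G\to P_\mu$ that is onto, a local homeomorphism and exactly $4$-to-$1$. \item Each solution $x(s)$ in $S$ with $\tilde H_\mu=0$ on an open interval is, after the time change $dt=\tau\,ds$ (which makes $t$ strictly increasing in $s$), a three-body motion modulo rotations and translations: there are states $w(t)$ with continuous positions, in which $q_j=q_k$ exactly when $z_{jk}=0$, such that at the times with all $z_{jk}\neq0$ the state $w(t)$ is in $M_\mu$, solves the three-body problem with energy $h$, and has the same class in $P_\mu$ as $\Psi(x(s))$. At a point of $S$ with $\tilde H_\mu=0$ and $z_{jk}=0$ one has $\dot z_{jk}\neq0$. \item Conversely, let $w$ be a collision-free three-body motion in $M_\mu$ with energy $h$ on an open interval $I$, let $t_0\in I$, and let $x_0\in S'$ be such that $\Psi(x_0)$ has the class of $w(t_0)$. Then there is a solution $x$ in $S'$ with $\tilde H_\mu=0$ starting at $x_0$, on an open interval that $dt=\tau\,ds$ maps bijectively onto $I$, such that $\Psi(x(s))$ and $w(t(s))$ have the same class in $P_\mu$. \item If such a motion $w$ is defined on $(a,T)$ and, as $t\to T^-$, its positions converge to a configuration in which exactly two bodies coincide, then there is a solution $x$ in $S$ with $\tilde H_\mu=0$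 on an open interval $J\ni0$, with $dt=\tau\,ds$ and $t(0)=T$, such that some $z_{jk}(0)=0$ and, for all $s<0$ in $J$, $x(s)\in S'$, $t(s)\in(a,T)$ and $\Psi(x(s))$ and $w(t(s))$ have the same class in $P_\mu$. \end{enumerate} -/

import Mathlib

open Set Filter Topology
open scoped ComplexConjugate ContDiff

noncomputable section

namespace PlanarThreeBody

/-! Conventions. Bodies are numbered `0, 1, 2`. Triples indexed by pairs of bodies are listed in
the order `12, 31, 23`, so index `0` is the pair of bodies `0, 1`, index `1` is the pair `2, 0`
and index `2` is the pair `1, 2`.  A real covector `(a, b)` is written as `a + b i`. -/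

/-- The Hermitian pairing `⟨P, Q⟩ = ∑ conj P_j * Q_j`: evaluation of covectors on vectors, and also
the standard Hermitian metric. -/
def pairing (P Q : Fin 3 → ℂ) : ℂ := ∑ j, conj (P j) * Q j

/-- Real differential of a real function on `ℂ³`, as the complex covector `g` with
`dF(V) = Re ⟨g, V⟩`. -/
def complexGrad (F : (Fin 3 → ℂ) → ℝ) (w : Fin 3 → ℂ) : Fin 3 → ℂ := fun j =>
  ((fderiv ℝ F w (Pi.single j 1) : ℝ) : ℂ)
    + Complex.I * ((fderiv ℝ F w (Pi.single j Complex.I) : ℝ) : ℂ)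

/-! ### The planar three-body problem -/

/-- Points `(q, p)`: positions and momenta. -/
abbrev Body := (Fin 3 → ℂ) × (Fin 3 → ℂ)

/-- Products of masses `m₁m₂, m₃m₁, m₂m₃`. -/
def pairMass (m : Fin 3 → ℝ) : Fin 3 → ℝ := ![m 0 * m 1, m 2 * m 0, m 1 * m 2]

/-- Difference vectors `q₁ - q₂, q₃ - q₁, q₂ - q₃`. -/
def relPos (q : Fin 3 → ℂ) : Fin 3 → ℂ := ![q 0 - q 1, q 2 - q 0, q 1 - q 2]

/-- The Newtonian Hamiltonian. -/
def bodyH (m : Fin 3 → ℝ) (y : Body) : ℝ :=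
  ∑ i, ‖y.2 i‖ ^ 2 / (2 * m i) - ∑ j, pairMass m j / ‖relPos y.1 j‖

/-- Hamilton's equations of the three-body problem. -/
def bodyField (m : Fin 3 → ℝ) (y : Body) : Body :=
  (complexGrad (fun p => bodyH m (y.1, p)) y.2,
   fun i => -complexGrad (fun q => bodyH m (q, y.2)) y.1 i)

/-- The standard symplectic form `dq ∧ dp`. -/
def bodyForm (u v : Body) : ℝ := (pairing v.2 u.1).re - (pairing u.2 v.1).re

/-- Collision-free states with zero total momentum and angular momentum `μ`. -/
def BodyLevel (μ : ℝ) : Set Body :=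
  {y | Function.Injective y.1 ∧ ∑ i, y.2 i = 0 ∧ ∑ i, (conj (y.1 i) * y.2 i).im = μ}

/-- Two states that differ by a rotation and a translation of the plane. -/
def bodySetoid : Setoid Body where
  r y y' := ∃ u a : ℂ, ‖u‖ = 1 ∧ y' = (fun i => u * y.1 i + a, fun i => u * y.2 i)
  iseqv := by
    refine ⟨fun y => ⟨1, 0, by simp, by simp⟩, ?_, ?_⟩
    · rintro y _ ⟨u, a, hu, rfl⟩
      have h0 : u ≠ 0 := by rintro rfl; simp at hu
      refine ⟨u⁻¹, -u⁻¹ * a, by simp [hu], ?_⟩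
      ext i
      · simp only; field_simp; ring
      · simp only; field_simp
    · rintro y _ _ ⟨u, a, hu, rfl⟩ ⟨u', a', hu', rfl⟩
      refine ⟨u' * u, u' * a + a', by simp [hu, hu'], ?_⟩
      ext i
      · simp only; ring
      · simp only; ring

/-- The reduced phase space of the three-body problem, with its quotient topology. -/
abbrev BodyQuotient (μ : ℝ) := Quotient (bodySetoid.comap ((↑) : BodyLevel μ → Body))

/-! ### The regularized phase space -/

/-- Points `(r, p_r, z, η)`. -/
abbrev Reg := ℝ × ℝ × (Fin 3 → ℂ) × (Fin 3 → ℂ)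

/-- `T*ℝ⁺ × T*(ℂ³ ∖ 0)`. -/
def RegDomain : Set Reg := {x | 0 < x.1 ∧ x.2.2.1 ≠ 0}

/-- The set `⟨η, z⟩ = 0`, `z₁₂² + z₃₁² + z₂₃² = 0`. -/
def RegLevel : Set Reg :=
  {x | x ∈ RegDomain ∧ pairing x.2.2.2 x.2.2.1 = 0 ∧ ∑ j, x.2.2.1 j ^ 2 = 0}

/-- The part of `RegLevel` without binary collisions. -/
def RegFree : Set Reg := {x | x ∈ RegLevel ∧ ∀ j, x.2.2.1 j ≠ 0}

/-- The tangent space to `RegLevel` at `x`. -/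
def RegTangent (x : Reg) : Set Reg :=
  {u | pairing u.2.2.2 x.2.2.1 + pairing x.2.2.2 u.2.2.1 = 0 ∧ ∑ j, x.2.2.1 j * u.2.2.1 j = 0}

/-- The square of the mass norm of `X ∈ ℂ³`. -/
def massNormSq (m : Fin 3 → ℝ) (X : Fin 3 → ℂ) : ℝ := (∑ j, pairMass m j * ‖X j‖ ^ 2) / ∑ i, m i

/-- The square of the standard norm of `z ∈ ℂ³`. -/
def normTwoSq (z : Fin 3 → ℂ) : ℝ := ∑ j, ‖z j‖ ^ 2

/-- The regularizing map `X_ij = z_ij²`. -/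
def levi (z : Fin 3 → ℂ) : Fin 3 → ℂ := fun j => z j ^ 2

/-- `ρ_ij = |z_ij|²`. -/
def rho (z : Fin 3 → ℂ) (j : Fin 3) : ℝ := ‖z j‖ ^ 2

/-- The time-scaling factor. -/
def tau (z : Fin 3 → ℂ) : ℝ := rho z 0 * rho z 1 * rho z 2 / normTwoSq z ^ 3

/-- The regularized shape potential. -/
def shapeW (m : Fin 3 → ℝ) (z : Fin 3 → ℂ) : ℝ :=
  √(massNormSq m (levi z)) / normTwoSq z ^ 3 *
    (m 0 * m 1 * rho z 1 * rho z 2 + m 0 * m 2 * rho z 0 * rho z 2 + m 1 * m 2 * rho z 0 * rho z 1)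

def pi1 (z η : Fin 3 → ℂ) : ℂ := η 0 * conj (z 1) - η 1 * conj (z 0)

def pi2 (z η : Fin 3 → ℂ) : ℂ := η 2 * conj (z 0) - η 0 * conj (z 2)

def pi3 (z η : Fin 3 → ℂ) : ℂ := η 1 * conj (z 2) - η 2 * conj (z 1)

/-- The regularized reduced Hamiltonian for angular momentum `μ` and energy `h`. -/
def regH (m : Fin 3 → ℝ) (μ h : ℝ) (x : Reg) : ℝ :=
  let r := x.1
  let p := x.2.1
  let z := x.2.2.1
  let η := x.2.2.2
  tau z * p ^ 2 / 2 + tau z * μ ^ 2 / (2 * r ^ 2)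
    + massNormSq m (levi z) / (r ^ 2 * normTwoSq z ^ 3) *
      (‖pi1 z η‖ ^ 2 * rho z 2 / (8 * m 0) + ‖pi2 z η‖ ^ 2 * rho z 1 / (8 * m 1)
        + ‖pi3 z η‖ ^ 2 * rho z 0 / (8 * m 2))
    - shapeW m z / r - h * tau z

/-- Hamilton's equations of `regH`, with the curvature term `-(2μτ/r²) i η` added to the equation
for `η`. -/
def regField (m : Fin 3 → ℝ) (μ h : ℝ) (x : Reg) : Reg :=
  let r := x.1
  let p := x.2.1
  let z := x.2.2.1
  let η := x.2.2.2
  (deriv (fun p' => regH m μ h (r, p', z, η)) p,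
   -deriv (fun r' => regH m μ h (r', p, z, η)) r,
   complexGrad (fun η' => regH m μ h (r, p, z, η')) η,
   fun j => -complexGrad (fun z' => regH m μ h (r, p, z', η)) z j
      - ((2 * μ * tau z / r ^ 2 : ℝ) : ℂ) * Complex.I * η j)

/-- The conformal factor `λ`. -/
def lam (m : Fin 3 → ℝ) (z : Fin 3 → ℂ) : ℝ :=
  4 * (m 0 * m 1 * m 2) * (rho z 0 * rho z 1 * rho z 2) * normTwoSq z /
    ((∑ i, m i) * massNormSq m (levi z) ^ 2)

/-- The Fubini-Study two-form at `z` of the standard Hermitian metric. -/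
def fubiniStudy (z V V' : Fin 3 → ℂ) : ℝ :=
  ((pairing V V' * pairing z z - pairing V z * pairing z V') / pairing z z ^ 2).im

/-- The form `dr ∧ dp_r + dz ∧ dη - 2 μ λ Ω_FS`. -/
def regForm (m : Fin 3 → ℝ) (μ : ℝ) (x u v : Reg) : ℝ :=
  u.1 * v.2.1 - u.2.1 * v.1
    + (pairing v.2.2.2 u.2.2.1).re - (pairing u.2.2.2 v.2.2.1).re
    - 2 * μ * lam m x.2.2.1 * fubiniStudy x.2.2.1 u.2.2.1 v.2.2.1

/-- The exterior derivative of a two-form, evaluated on three (constant) vectors. -/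
def extDerivTwo (β : Reg → Reg → Reg → ℝ) (x u v w : Reg) : ℝ :=
  fderiv ℝ (fun y => β y v w) x u + fderiv ℝ (fun y => β y w u) x v
    + fderiv ℝ (fun y => β y u v) x w

/-- The action of `(k, c)`: the complex scaling `(z, η) ↦ (k z, η / conj k)` followed by the
translation `η ↦ η + 2 c conj z`.  For fixed `(k, c)` it is real linear, hence it is also its own
differential. -/
def regAct (k c : ℂ) (x : Reg) : Reg :=
  (x.1, x.2.1, fun j => k * x.2.2.1 j,
    fun j => x.2.2.2 j / conj k + 2 * c * conj (k * x.2.2.1 j))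

/-- Points in the same orbit of scalings and translations. -/
def regSetoid : Setoid Reg where
  r x x' := ∃ k c : ℂ, k ≠ 0 ∧ x' = regAct k c x
  iseqv := by
    refine ⟨fun x => ⟨1, 0, by simp, by simp [regAct]⟩, ?_, ?_⟩
    · rintro x _ ⟨k, c, hk, rfl⟩
      have hk' : conj k ≠ 0 := by simpa using hk
      refine ⟨k⁻¹, -c * conj k ^ 2, by simpa using hk, ?_⟩
      refine Prod.ext rfl (Prod.ext rfl (Prod.ext ?_ ?_))
      · ext j; simp only [regAct]; field_simp
      · ext j; simp only [regAct, map_mul, map_inv₀]; field_simp; ring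
    · rintro x _ _ ⟨k, c, hk, rfl⟩ ⟨k', c', hk', rfl⟩
      have h1 : conj k ≠ 0 := by simpa using hk
      have h2 : conj k' ≠ 0 := by simpa using hk'
      refine ⟨k' * k, c' + c / conj k' ^ 2, mul_ne_zero hk' hk, ?_⟩
      refine Prod.ext rfl (Prod.ext rfl (Prod.ext ?_ ?_))
      · ext j; simp only [regAct]; ring
      · ext j; simp only [regAct, map_mul]; field_simp; ring

/-- The quotient of the collision-free part, with its quotient topology. -/
abbrev RegFreeQuotient := Quotient (regSetoid.comap ((↑) : RegFree → Reg))

/-! ### The map to the three-body problem -/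

/-- The dual covector `X*` with respect to the mass metric. -/
def massDual (m : Fin 3 → ℝ) (X : Fin 3 → ℂ) : Fin 3 → ℂ := fun j =>
  ((pairMass m j / ∑ i, m i : ℝ) : ℂ) * X j

/-- Relative positions `Q = r X / |X|` with `X_ij = z_ij²`. -/
def physQ (m : Fin 3 → ℝ) (x : Reg) : Fin 3 → ℂ := fun j =>
  ((x.1 / √(massNormSq m (levi x.2.2.1)) : ℝ) : ℂ) * levi x.2.2.1 j

/-- Relative momenta: `Z_ij = η_ij / (2 conj z_ij)`, then the momentum shift
`Y = Z + μ i X* / |X|²`, then `P = p_r X* / |X| + |X| Y / r`. -/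
def physP (m : Fin 3 → ℝ) (μ : ℝ) (x : Reg) : Fin 3 → ℂ := fun j =>
  let X := levi x.2.2.1
  let n := √(massNormSq m X)
  let Y : ℂ := x.2.2.2 j / (2 * conj (x.2.2.1 j))
    + ((μ / n ^ 2 : ℝ) : ℂ) * Complex.I * massDual m X j
  ((x.2.1 / n : ℝ) : ℂ) * massDual m X j + ((n / x.1 : ℝ) : ℂ) * Y

/-- The state of the three bodies represented by `(r, p_r, z, η)`, with the center of mass at the
origin: `p₁ = P₁₂ - P₃₁`, etc. -/
def physMap (m : Fin 3 → ℝ) (μ : ℝ) (x : Reg) : Body :=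
  let Q := physQ m x
  let P := physP m μ x
  let M : ℂ := ((∑ i, m i : ℝ) : ℂ)
  (![(m 1 * Q 0 - m 2 * Q 1) / M, (m 2 * Q 2 - m 0 * Q 0) / M, (m 0 * Q 1 - m 1 * Q 2) / M],
   ![P 0 - P 1, P 2 - P 0, P 1 - P 2])

/-- `x` solves the regularized equations on the open interval `J`, inside `T*ℝ⁺ × T*(ℂ³ ∖ 0)`. -/
def IsRegSolution (m : Fin 3 → ℝ) (μ h : ℝ) (x : ℝ → Reg) (J : Set ℝ) : Prop :=
  IsOpen J ∧ J.OrdConnected ∧ IsIntegralCurveOn x (fun _ => regField m μ h) J ∧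
    ∀ s ∈ J, x s ∈ RegDomain

/-- `w` solves the planar three-body problem on the open interval `I`, with zero total momentum,
angular momentum `μ` and energy `h`, without collisions. -/
def IsBodySolution (m : Fin 3 → ℝ) (μ h : ℝ) (w : ℝ → Body) (I : Set ℝ) : Prop :=
  IsOpen I ∧ I.OrdConnected ∧ IsIntegralCurveOn w (fun _ => bodyField m) I ∧
    ∀ t ∈ I, w t ∈ BodyLevel μ ∧ bodyH m (w t) = h

end PlanarThreeBody

end

open PlanarThreeBody

/-! Reduction. Relative positions `Q` with `∑ Q = 0` remove translations. Writing `Q = r X / |X|`,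
with `X` defined up to complex scaling, removes rotations. Shifting the covector `Z` by `μ i X* /
|X|²` fixes the angular momentum at `μ`. The shift adds a magnetic term to the canonical form: `-2μ`
times the Fubini-Study form of the mass metric on the projective line of shapes. The map `X = z²`
turns the plane `∑ X = 0` into the quadric `∑ z² = 0`. Its cotangent lift `Z = η / (2 conj z)`
preserves the canonical form, and the mass Fubini-Study form becomes `λ Ω_FS`, where `λ` vanishes at
collisions. Multiplying the Newtonian Hamiltonian minus `h` by `τ` cancels its poles, so the
regularized Hamiltonian is smooth wherever `r > 0` and `z ≠ 0`.

Computations on the quadric use one frame. The vectors `z` and `n = conj z × z` are orthogonal and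
span the solutions `V` of `∑ z V = 0`, while `conj z` and `n` span the covectors that annihilate `z`
(`eq_span_of_sum_mul`, `eq_span_of_pairing`). For `η = a conj z + b n` the Hamiltonian depends on
`η` only through `K |b|²` (`regH_span`). The equations are canonical ones with an extra term
proportional to `i η`. Invariance of the Hamiltonian under `G` and under `η ↦ u η` gives invariance
of `S` and conservation of energy by Noether's argument. On `S` the extra term is, modulo `conj z`,
the contraction of `2μ λ Ω_FS` with the velocity; this amounts to `λ · 2K / ‖z‖⁶ = τ / r²`
(`regForm_regField`). Closedness holds because the curvature form is basic for complex scalings and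
only the complex line through `n` remains transversally (`curvDeriv_eq_zero`).

Comparison with the three-body problem. The map `Ψ` is symplectic (`massForm_eq_curvForm`,
`bodyForm_physMap`) and satisfies `H̃ = τ (H ∘ Ψ - h)` (`regH_eq_tau_mul`). At zero energy,
therefore, a tangent vector lying over the Newtonian field differs from `τ⁻¹ v` by an element of the
kernel of the form, that is, by an infinitesimal symmetry (`regForm_kernel`,
`eq_regField_of_fderiv_physMap`). Hence `Ψ` carries the flow to the time-scaled Newtonian flow plus
an infinitesimal rotation (`fderiv_physMap_regField`). Undoing this rotation and changing time gives
three-body motions (`exists_bodyMotion`). Conversely, a motion is lifted by choosing square roots,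
and scalar linear equations for the symmetry parameters turn the lift into a solution
(`exists_lift_motion`). The square roots have eight sign choices, and the common sign belongs to
`G`, so the quotient map has four sheets.

Binary collisions. By the Lagrange-Jacobi identity the time integral of the potential is controlled
by `Re ⟨p, q⟩`, which stays bounded; so the regularized time left before the collision is finite
(`exists_time_bound`). With the translation freedom of `η` normalized, the lifts stay in a compact
set (`exists_compact_lifts`), where solutions exist for a uniform time. A solution started late
enough therefore runs through the collision (`exists_collision_lift_of_pair`). -/

noncomputable section
namespace PlanarThreeBody

/-! ### Ordinary differential equations on open intervals -/

section ODE

variable {E : Type*} [NormedAddCommGroup E] [NormedSpace ℝ E]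

/-- Two integral curves of a `C¹` vector field on an interval agree if they agree at one time. -/
theorem eqOn_of_integralCurves {v : E → E} {U : Set E} (hv : ∀ x ∈ U, ContDiffAt ℝ 1 v x)
    {J : Set ℝ} (hJ : IsOpen J) (hJ' : J.OrdConnected) {f g : ℝ → E}
    (hf : ∀ s ∈ J, HasDerivAt f (v (f s)) s ∧ f s ∈ U)
    (hg : ∀ s ∈ J, HasDerivAt g (v (g s)) s ∧ g s ∈ U)
    {s₀ : ℝ} (hs₀ : s₀ ∈ J) (h0 : f s₀ = g s₀) : EqOn f g J := by
  have hcf : ContinuousOn f J := fun s hs => (hf s hs).1.continuousAt.continuousWithinAt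
  have hcg : ContinuousOn g J := fun s hs => (hg s hs).1.continuousAt.continuousWithinAt
  -- A `C¹` field is Lipschitz near the common value, and both curves stay in that neighbourhood for
  -- a short time.
  have hloc : ∀ s ∈ J, f s = g s → f =ᶠ[𝓝 s] g := by
    intro s hs he
    obtain ⟨K, W, hW, hK⟩ := (hv _ (hf s hs).2).exists_lipschitzOnWith
    have h1 : ∀ᶠ t in 𝓝 s, f t ∈ W := (hf s hs).1.continuousAt hW
    have h2 : ∀ᶠ t in 𝓝 s, g t ∈ W := (hg s hs).1.continuousAt (he ▸ hW)
    have hJs := hJ.mem_nhds hs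
    refine ODE_solution_unique_of_eventually (v := fun _ => v) (s := fun _ => W) (K := K)
      (Eventually.of_forall fun _ => hK) ?_ ?_ he
    · filter_upwards [h1, hJs] with t ht ht'
      exact ⟨(hf t ht').1, ht⟩
    · filter_upwards [h2, hJs] with t ht ht'
      exact ⟨(hg t ht').1, ht⟩
  have hpre : IsPreconnected J := hJ'.isPreconnected
  -- Connectedness: the set of times near which the curves coincide is open, and it is relatively
  -- closed in `J` by continuity.
  have hsub : J ⊆ {s | f =ᶠ[𝓝 s] g} := by
    refine hpre.subset_of_closure_inter_subset ?_ ⟨s₀, hs₀, hloc s₀ hs₀ h0⟩ ?_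
    · exact isOpen_setOfPred_eventually_nhds
    · rintro s ⟨hs, hsJ⟩
      refine hloc s hsJ ?_
      have hfs := (hf s hsJ).1.continuousAt
      have hgs := (hg s hsJ).1.continuousAt
      by_contra hne
      have hev : ∀ᶠ t in 𝓝 s, f t ≠ g t := by
        have := (hfs.prodMk hgs).eventually
          ((isOpen_ne_fun continuous_fst continuous_snd).mem_nhds hne)
        exact this
      obtain ⟨t, ht1, ht2⟩ := mem_closure_iff_nhds.1 hs _ hev
      exact ht1 ht2.self_of_nhds
  exact fun s hs => (hsub hs).self_of_nhds

theorem exists_primitive [CompleteSpace E] {J : Set ℝ} (hJ : IsOpen J) (hJ' : J.OrdConnected)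
    {φ : ℝ → E} (hφ : ContinuousOn φ J) {s₀ : ℝ} (hs₀ : s₀ ∈ J) (a : E) :
    ∃ F : ℝ → E, F s₀ = a ∧ ∀ s ∈ J, HasDerivAt F (φ s) s := by
  refine ⟨fun s => a + ∫ u in s₀..s, φ u, by simp, fun s hs => ?_⟩
  have h1 : uIcc s₀ s ⊆ J := hJ'.uIcc_subset hs₀ hs
  have := intervalIntegral.integral_hasDerivAt_right
    ((hφ.mono h1).intervalIntegrable)
    (hφ.stronglyMeasurableAtFilter hJ s hs) (hφ.continuousAt (hJ.mem_nhds hs))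
  simpa using this.const_add a

/-- Scalar linear homogeneous equations have global nonvanishing solutions. -/
theorem exists_linear_hom {J : Set ℝ} (hJ : IsOpen J) (hJ' : J.OrdConnected)
    {a : ℝ → ℂ} (ha : ContinuousOn a J) {s₀ : ℝ} (hs₀ : s₀ ∈ J) (k₀ : ℂ) :
    ∃ k : ℝ → ℂ, k s₀ = k₀ ∧ (∀ s ∈ J, HasDerivAt k (a s * k s) s) ∧ (k₀ ≠ 0 → ∀ s, k s ≠ 0) := by
  obtain ⟨A, hA0, hA⟩ := exists_primitive hJ hJ' ha hs₀ 0
  refine ⟨fun s => k₀ * Complex.exp (A s), by simp [hA0], fun s hs => ?_, fun h s =>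
    mul_ne_zero h (Complex.exp_ne_zero _)⟩
  convert! ((hA s hs).cexp.const_mul k₀) using 1
  ring

/-- Variation of constants: multiply the homogeneous solution `k` by a primitive of `b / k`. -/
theorem exists_linear {J : Set ℝ} (hJ : IsOpen J) (hJ' : J.OrdConnected)
    {a b : ℝ → ℂ} (ha : ContinuousOn a J) (hb : ContinuousOn b J) {s₀ : ℝ} (hs₀ : s₀ ∈ J)
    (c₀ : ℂ) : ∃ c : ℝ → ℂ, c s₀ = c₀ ∧ ∀ s ∈ J, HasDerivAt c (a s * c s + b s) s := by
  obtain ⟨k, hk0, hk, hkn⟩ := exists_linear_hom hJ hJ' ha hs₀ 1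
  have hkn := hkn one_ne_zero
  have hkc : ContinuousOn k J := fun s hs => (hk s hs).continuousAt.continuousWithinAt
  obtain ⟨B, hB0, hB⟩ := exists_primitive hJ hJ' (hb.div hkc fun s _ => hkn s) hs₀ c₀
  refine ⟨fun s => k s * B s, by simp [hk0, hB0], fun s hs => ?_⟩
  convert! (hk s hs).mul (hB s hs) using 1
  have := hkn s
  simp only [Pi.div_apply]
  field_simp

/-- Solutions of a scalar linear homogeneous equation that vanish once vanish identically. -/
theorem eq_zero_of_linear_hom {J : Set ℝ} (hJ : IsOpen J) (hJ' : J.OrdConnected)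
    {a f : ℝ → ℂ} (ha : ContinuousOn a J) (hf : ∀ s ∈ J, HasDerivAt f (a s * f s) s)
    {s₀ : ℝ} (hs₀ : s₀ ∈ J) (h0 : f s₀ = 0) : ∀ s ∈ J, f s = 0 := by
  obtain ⟨k, hk0, hk, hkn⟩ := exists_linear_hom hJ hJ' ha hs₀ 1
  have hkn := hkn one_ne_zero
  have hd : ∀ s ∈ J, HasDerivAt (fun s => f s / k s) 0 s := by
    intro s hs
    convert! (hf s hs).div (hk s hs) (hkn s) using 1
    have := hkn s
    field_simp
    ring
  intro s hs
  have hc : f s / k s = f s₀ / k s₀ :=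
    hJ.is_const_of_deriv_eq_zero hJ'.isPreconnected
      (fun s hs => (hd s hs).differentiableAt.differentiableWithinAt)
      (fun s hs => (hd s hs).deriv) hs hs₀
  rw [h0, zero_div, div_eq_zero_iff] at hc
  exact hc.resolve_right (hkn s)

theorem const_of_hasDerivAt_zero {J : Set ℝ} (hJ : IsOpen J) (hJ' : J.OrdConnected)
    {f : ℝ → E} (hf : ∀ s ∈ J, HasDerivAt f 0 s) {s s' : ℝ} (hs : s ∈ J) (hs' : s' ∈ J) :
    f s = f s' :=
  hJ.is_const_of_deriv_eq_zero hJ'.isPreconnected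
      (fun s hs => (hf s hs).differentiableAt.differentiableWithinAt)
      (fun s hs => (hf s hs).deriv) hs hs'

/-- A continuous strictly increasing function on an open interval has a continuous inverse. -/
theorem exists_inverse_of_strictMonoOn {J : Set ℝ} (hJ : IsOpen J) (hJ' : J.OrdConnected)
    {f : ℝ → ℝ} (hf : ContinuousOn f J) (hm : StrictMonoOn f J) :
    ∃ g : ℝ → ℝ, (∀ s ∈ J, g (f s) = s) ∧ IsOpen (f '' J) ∧ (f '' J).OrdConnected ∧
      (∀ s ∈ J, ContinuousAt g (f s)) ∧
      ∀ s ∈ J, ∀ c, c ≠ 0 → HasDerivAt f c s → HasDerivAt g c⁻¹ (f s) := by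
  have hinj := hm.injOn
  have hg : ∀ s ∈ J, Function.invFunOn f J (f s) = s := fun s hs =>
    hinj.leftInvOn_invFunOn hs
  have hopen : IsOpen (f '' J) := by
    rw [isOpen_iff_mem_nhds]
    rintro _ ⟨s, hs, rfl⟩
    obtain ⟨ε, hε, hball⟩ := Metric.isOpen_iff.1 hJ s hs
    have ha : s - ε / 2 ∈ J := hball (by rw [Real.ball_eq_Ioo]; constructor <;> linarith)
    have hb : s + ε / 2 ∈ J := hball (by rw [Real.ball_eq_Ioo]; constructor <;> linarith)
    have hsub : Icc (s - ε / 2) (s + ε / 2) ⊆ J := hJ'.out ha hb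
    have h1 := intermediate_value_Icc (by linarith) (hf.mono hsub)
    exact mem_of_superset (Icc_mem_nhds (hm ha hs (by linarith)) (hm hs hb (by linarith)))
      (h1.trans (image_mono hsub))
  have hcont : ∀ s ∈ J, ContinuousAt (Function.invFunOn f J) (f s) := by
    intro s hs
    refine continuousAt_of_monotoneOn_of_image_mem_nhds (s := f '' J) ?_
      (hopen.mem_nhds (mem_image_of_mem f hs)) ?_
    · rintro _ ⟨a, ha, rfl⟩ _ ⟨b, hb, rfl⟩ hab
      rw [hg a ha, hg b hb]
      exact (hm.le_iff_le ha hb).1 hab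
    · rw [hg s hs, image_image]
      refine mem_of_superset (hJ.mem_nhds hs) fun a ha => ⟨a, ha, hg a ha⟩
  refine ⟨Function.invFunOn f J, hg, hopen, ?_, hcont, ?_⟩
  · exact (hJ'.isPreconnected.image f hf).ordConnected
  -- Differentiability of the inverse is claimed only where the derivative is nonzero. The time
  -- change has derivative `τ = 0` at collisions, where its inverse is known only to be continuous.
  · intro s hs c hc hd
    refine HasDerivAt.of_local_left_inverse (hcont s hs) (by rwa [hg s hs]) hc ?_
    filter_upwards [hopen.mem_nhds (mem_image_of_mem f hs)] with y hy
    obtain ⟨a, ha, rfl⟩ := hy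
    rw [hg a ha]

/-- Solutions of a `C¹` vector field that start in a compact subset of its open domain exist for a
uniform time. -/
theorem exists_uniform_time [CompleteSpace E] {v : E → E} {U K : Set E} (hU : IsOpen U)
    (hv : ∀ x ∈ U, ContDiffAt ℝ 1 v x) (hK : IsCompact K) (hKU : K ⊆ U) :
    ∃ ε > 0, ∀ x₀ ∈ K, ∃ x : ℝ → E, x 0 = x₀ ∧
      ∀ s ∈ Ioo (-ε) ε, HasDerivAt x (v (x s)) s ∧ x s ∈ U := by
  -- A uniform time passes to subsets and to finite unions (take the minimum), so a uniform time
  -- near each point suffices.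
  refine hK.induction_on (p := fun K => ∃ ε > (0 : ℝ), ∀ x₀ ∈ K, ∃ x : ℝ → E, x 0 = x₀ ∧
      ∀ s ∈ Ioo (-ε) ε, HasDerivAt x (v (x s)) s ∧ x s ∈ U) ⟨1, one_pos, by simp⟩ ?_ ?_ ?_
  · rintro s t hst ⟨ε, hε, h⟩
    exact ⟨ε, hε, fun x hx => h x (hst hx)⟩
  · rintro s t ⟨ε, hε, h⟩ ⟨ε', hε', h'⟩
    refine ⟨min ε ε', lt_min hε hε', ?_⟩
    rintro x (hx | hx)
    · obtain ⟨y, hy0, hy⟩ := h x hx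
      exact ⟨y, hy0, fun s hs => hy s ⟨by linarith [hs.1, min_le_left ε ε'],
        by linarith [hs.2, min_le_left ε ε']⟩⟩
    · obtain ⟨y, hy0, hy⟩ := h' x hx
      exact ⟨y, hy0, fun s hs => hy s ⟨by linarith [hs.1, min_le_right ε ε'],
        by linarith [hs.2, min_le_right ε ε']⟩⟩
  · intro x₁ hx₁
    have hx₁U := hKU hx₁
    obtain ⟨ε, hε, a, r, _, _, hr, hpl⟩ := IsPicardLindelof.of_contDiffAt_one (hv x₁ hx₁U)
    obtain ⟨α, hα, hαc⟩ :=
      (hpl 0).exists_forall_mem_closedBall_eq_hasDerivWithinAt_continuousOn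
    have h0 : (0 : ℝ) ∈ Icc (0 - ε) (0 + ε) := by constructor <;> linarith
    have hα0 : α (x₁, 0) = x₁ := (hα x₁ (Metric.mem_closedBall_self hr.le)).1
    have hnhds : Metric.closedBall x₁ r ×ˢ Icc (0 - ε) (0 + ε) ∈ 𝓝 (x₁, (0 : ℝ)) :=
      prod_mem_nhds (Metric.closedBall_mem_nhds _ hr) (Icc_mem_nhds (by linarith) (by linarith))
    -- The local flow is jointly continuous in the initial point and the time, so nearby orbits
    -- remain in `U` for a common time.
    have hca : ContinuousAt α (x₁, 0) := hαc.continuousAt hnhds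
    have hUn : U ∈ 𝓝 (α (x₁, 0)) := by rw [hα0]; exact hU.mem_nhds hx₁U
    have hev := (hca.eventually_mem hUn).and hnhds
    rw [nhds_prod_eq] at hev
    obtain ⟨V, hV, W, hW, hVW⟩ := Filter.mem_prod_iff.1 hev
    obtain ⟨δ, hδ, hball⟩ := Metric.mem_nhds_iff.1 hW
    refine ⟨V, mem_nhdsWithin_of_mem_nhds hV, min δ ε, lt_min hδ hε, fun x hx => ?_⟩
    have hxr : x ∈ Metric.closedBall x₁ r :=
      (hVW (⟨hx, mem_of_mem_nhds hW⟩ : (x, (0 : ℝ)) ∈ V ×ˢ W)).2.1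
    refine ⟨fun s => α (x, s), (hα x hxr).1, fun s hs => ⟨?_, ?_⟩⟩
    · have h1 : 0 - ε < s := by linarith [hs.1, min_le_right δ ε]
      have h2 : s < 0 + ε := by linarith [hs.2, min_le_right δ ε]
      exact ((hα x hxr).2 s ⟨h1.le, h2.le⟩).hasDerivAt (Icc_mem_nhds h1 h2)
    · refine (hVW (⟨hx, hball ?_⟩ : (x, s) ∈ V ×ˢ W)).1
      rw [Real.ball_eq_Ioo]
      constructor <;> linarith [hs.1, hs.2, min_le_left δ ε]

end ODE
end PlanarThreeBody
end

noncomputable section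
namespace PlanarThreeBody

/-! ### Algebra of the pairing -/

theorem pairing_add_left (P P' Q : Fin 3 → ℂ) :
    pairing (P + P') Q = pairing P Q + pairing P' Q := by
  simp [pairing, add_mul, Finset.sum_add_distrib]

theorem pairing_add_right (P Q Q' : Fin 3 → ℂ) :
    pairing P (Q + Q') = pairing P Q + pairing P Q' := by
  simp [pairing, mul_add, Finset.sum_add_distrib]

theorem pairing_sub_left (P P' Q : Fin 3 → ℂ) :
    pairing (P - P') Q = pairing P Q - pairing P' Q := by
  simp [pairing, sub_mul, Finset.sum_sub_distrib]

theorem pairing_sub_right (P Q Q' : Fin 3 → ℂ) :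
    pairing P (Q - Q') = pairing P Q - pairing P Q' := by
  simp [pairing, mul_sub, Finset.sum_sub_distrib]

theorem pairing_smul_left (c : ℂ) (P Q : Fin 3 → ℂ) :
    pairing (c • P) Q = conj c * pairing P Q := by
  simp [pairing, Finset.mul_sum, mul_assoc]

theorem pairing_smul_right (c : ℂ) (P Q : Fin 3 → ℂ) :
    pairing P (c • Q) = c * pairing P Q := by
  simp only [pairing, Finset.mul_sum, Pi.smul_apply, smul_eq_mul]
  exact Finset.sum_congr rfl fun j _ => by ring

theorem pairing_real_smul_left (c : ℝ) (P Q : Fin 3 → ℂ) :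
    pairing (c • P) Q = c * pairing P Q := by
  simp [pairing, Finset.mul_sum, mul_assoc]

theorem pairing_real_smul_right (c : ℝ) (P Q : Fin 3 → ℂ) :
    pairing P (c • Q) = c * pairing P Q := by
  simp only [pairing, Finset.mul_sum, Pi.smul_apply, Complex.real_smul]
  exact Finset.sum_congr rfl fun j _ => by ring

theorem pairing_neg_left (P Q : Fin 3 → ℂ) : pairing (-P) Q = -pairing P Q := by
  simp [pairing]

@[simp] theorem pairing_zero_left (Q : Fin 3 → ℂ) : pairing 0 Q = 0 := by simp [pairing]

@[simp] theorem pairing_zero_right (P : Fin 3 → ℂ) : pairing P 0 = 0 := by simp [pairing]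

theorem conj_pairing (P Q : Fin 3 → ℂ) : conj (pairing P Q) = pairing Q P := by
  simp [pairing, mul_comm]

theorem pairing_re_comm (P Q : Fin 3 → ℂ) : (pairing P Q).re = (pairing Q P).re := by
  rw [← conj_pairing, Complex.conj_re]

theorem pairing_im_comm (P Q : Fin 3 → ℂ) : (pairing P Q).im = -(pairing Q P).im := by
  rw [← conj_pairing, Complex.conj_im]

theorem pairing_self (P : Fin 3 → ℂ) : pairing P P = (normTwoSq P : ℂ) := by
  simp [pairing, normTwoSq, Complex.conj_mul']

theorem pairing_single_left (j : Fin 3) (a : ℂ) (Q : Fin 3 → ℂ) :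
    pairing (Pi.single j a) Q = conj a * Q j := by
  fin_cases j <;> simp [pairing, Fin.sum_univ_three]

theorem eq_of_re_pairing_left {A B : Fin 3 → ℂ}
    (hAB : ∀ V, (pairing V A).re = (pairing V B).re) : A = B := by
  funext j
  have h1 := hAB (Pi.single j 1)
  have h2 := hAB (Pi.single j Complex.I)
  simp only [pairing_single_left] at h1 h2
  apply Complex.ext
  · simpa using h1
  · simpa using h2

theorem eq_of_re_pairing_right {A B : Fin 3 → ℂ}
    (hAB : ∀ V, (pairing A V).re = (pairing B V).re) : A = B :=
  eq_of_re_pairing_left fun V => by rw [pairing_re_comm, hAB, pairing_re_comm]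

/-- Turns the real conservation laws of a complex one-parameter family of symmetries into a single
complex identity. -/
theorem eq_zero_of_re_mul {a : ℂ} (ha : ∀ c : ℂ, (c * a).re = 0) : a = 0 := by
  have h1 := ha 1
  have h2 := ha Complex.I
  apply Complex.ext
  · simpa using h1
  · simpa using h2

theorem normTwoSq_nonneg (z : Fin 3 → ℂ) : 0 ≤ normTwoSq z :=
  Finset.sum_nonneg fun _ _ => by positivity

theorem normTwoSq_pos {z : Fin 3 → ℂ} (hz : z ≠ 0) : 0 < normTwoSq z := by
  obtain ⟨j, hj⟩ := Function.ne_iff.1 hz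
  exact Finset.sum_pos' (fun _ _ => by positivity) ⟨j, Finset.mem_univ _, by
    have : 0 < ‖z j‖ := norm_pos_iff.2 hj
    positivity⟩

theorem pairMass_pos {m : Fin 3 → ℝ} (hm : ∀ i, 0 < m i) (j : Fin 3) : 0 < pairMass m j := by
  have h0 := hm 0
  have h1 := hm 1
  have h2 := hm 2
  fin_cases j <;> simp [pairMass] <;> positivity

theorem sum_mass_pos {m : Fin 3 → ℝ} (hm : ∀ i, 0 < m i) : 0 < ∑ i, m i :=
  Finset.sum_pos (fun i _ => hm i) Finset.univ_nonempty

theorem massNormSq_nonneg {m : Fin 3 → ℝ} (hm : ∀ i, 0 < m i) (X : Fin 3 → ℂ) :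
    0 ≤ massNormSq m X :=
  div_nonneg (Finset.sum_nonneg fun j _ => mul_nonneg (pairMass_pos hm j).le (by positivity))
    (sum_mass_pos hm).le

theorem massNormSq_pos {m : Fin 3 → ℝ} (hm : ∀ i, 0 < m i) {X : Fin 3 → ℂ} (hX : X ≠ 0) :
    0 < massNormSq m X := by
  obtain ⟨j, hj⟩ := Function.ne_iff.1 hX
  refine div_pos (Finset.sum_pos' (fun j _ => mul_nonneg (pairMass_pos hm j).le (by positivity))
    ⟨j, Finset.mem_univ _, ?_⟩) (sum_mass_pos hm)
  have : 0 < ‖X j‖ := norm_pos_iff.2 hj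
  have := pairMass_pos hm j
  positivity

theorem levi_ne_zero {z : Fin 3 → ℂ} (hz : z ≠ 0) : levi z ≠ 0 := by
  obtain ⟨j, hj⟩ := Function.ne_iff.1 hz
  exact Function.ne_iff.2 ⟨j, pow_ne_zero 2 hj⟩

theorem massNormSq_levi_pos {m : Fin 3 → ℝ} (hm : ∀ i, 0 < m i) {z : Fin 3 → ℂ} (hz : z ≠ 0) :
    0 < massNormSq m (levi z) :=
  massNormSq_pos hm (levi_ne_zero hz)

/-! ### Smoothness of the regularized Hamiltonian -/

theorem isOpen_regDomain : IsOpen RegDomain :=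
  (isOpen_lt continuous_const continuous_fst).inter
    (isOpen_ne_fun continuous_snd.snd.fst continuous_const)

theorem contDiff_normSq_apply (j : Fin 3) : ContDiff ℝ ∞ fun z : Fin 3 → ℂ => ‖z j‖ ^ 2 :=
  (contDiff_apply ℝ ℂ j).norm_sq ℝ

theorem contDiff_rho (j : Fin 3) : ContDiff ℝ ∞ fun z : Fin 3 → ℂ => rho z j :=
  contDiff_normSq_apply j

theorem contDiff_normTwoSq : ContDiff ℝ ∞ normTwoSq :=
  ContDiff.sum fun j _ => contDiff_normSq_apply j

theorem contDiff_levi : ContDiff ℝ ∞ levi :=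
  contDiff_pi.2 fun j => (contDiff_apply ℝ ℂ j).pow 2

theorem contDiff_massNormSq (m : Fin 3 → ℝ) : ContDiff ℝ ∞ (massNormSq m) :=
  (ContDiff.sum fun j _ => contDiff_const.mul (contDiff_normSq_apply j)).div_const _

theorem contDiffAt_tau {z : Fin 3 → ℂ} (hz : z ≠ 0) : ContDiffAt ℝ ∞ tau z :=
  (((contDiff_rho 0).mul (contDiff_rho 1)).mul (contDiff_rho 2)).contDiffAt.div
    (contDiff_normTwoSq.pow 3).contDiffAt (pow_ne_zero 3 (normTwoSq_pos hz).ne')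

theorem contDiff_massNormSq_levi (m : Fin 3 → ℝ) : ContDiff ℝ ∞ fun z => massNormSq m (levi z) :=
  (contDiff_massNormSq m).comp contDiff_levi

theorem contDiffAt_sqrt_massNormSq {m : Fin 3 → ℝ} (hm : ∀ i, 0 < m i) {z : Fin 3 → ℂ}
    (hz : z ≠ 0) : ContDiffAt ℝ ∞ (fun z => √(massNormSq m (levi z))) z :=
  (contDiff_massNormSq_levi m).contDiffAt.sqrt (massNormSq_levi_pos hm hz).ne'

theorem contDiffAt_shapeW {m : Fin 3 → ℝ} (hm : ∀ i, 0 < m i) {z : Fin 3 → ℂ}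
    (hz : z ≠ 0) : ContDiffAt ℝ ∞ (shapeW m) z :=
  ((contDiffAt_sqrt_massNormSq hm hz).div (contDiff_normTwoSq.pow 3).contDiffAt
    (pow_ne_zero 3 (normTwoSq_pos hz).ne')).mul
    ((((contDiff_const.mul (contDiff_rho 1)).mul (contDiff_rho 2)).add
    ((contDiff_const.mul (contDiff_rho 0)).mul (contDiff_rho 2))).add
    ((contDiff_const.mul (contDiff_rho 0)).mul (contDiff_rho 1))).contDiffAt

theorem contDiffAt_lam {m : Fin 3 → ℝ} (hm : ∀ i, 0 < m i) {z : Fin 3 → ℂ}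
    (hz : z ≠ 0) : ContDiffAt ℝ ∞ (lam m) z := by
  refine ContDiffAt.div ?_ ?_ ?_
  · exact ((contDiff_const.mul (((contDiff_rho 0).mul (contDiff_rho 1)).mul (contDiff_rho 2))).mul
      contDiff_normTwoSq).contDiffAt
  · exact (contDiff_const.mul ((contDiff_massNormSq_levi m).pow 2)).contDiffAt
  · exact mul_ne_zero (sum_mass_pos hm).ne' (pow_ne_zero 2 (massNormSq_levi_pos hm hz).ne')

theorem contDiff_z_apply (j : Fin 3) : ContDiff ℝ ∞ fun x : Reg => x.2.2.1 j :=
  (contDiff_apply ℝ ℂ j).comp contDiff_snd.snd.fst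

theorem contDiff_eta_apply (j : Fin 3) : ContDiff ℝ ∞ fun x : Reg => x.2.2.2 j :=
  (contDiff_apply ℝ ℂ j).comp contDiff_snd.snd.snd

theorem contDiff_conj_comp {E : Type*} [NormedAddCommGroup E] [NormedSpace ℝ E] {f : E → ℂ}
    (hf : ContDiff ℝ ∞ f) : ContDiff ℝ ∞ fun x => conj (f x) :=
  Complex.conjCLE.contDiff.comp hf

/-- The only denominators are powers of `r` and `‖z‖`, and the only square root is taken of `|X|² >
0`. Nothing degenerates when a single `z j` vanishes. -/
theorem contDiffAt_regH {m : Fin 3 → ℝ} (hm : ∀ i, 0 < m i) (μ h : ℝ) {x : Reg}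
    (hx : x ∈ RegDomain) : ContDiffAt ℝ ∞ (regH m μ h) x := by
  have hr : x.1 ≠ 0 := hx.1.ne'
  have hz : x.2.2.1 ≠ 0 := hx.2
  have cz : ContDiffAt ℝ ∞ (fun x : Reg => x.2.2.1) x := contDiff_snd.snd.fst.contDiffAt
  have cr : ContDiffAt ℝ ∞ (fun x : Reg => x.1) x := contDiff_fst.contDiffAt
  have cp : ContDiffAt ℝ ∞ (fun x : Reg => x.2.1) x := contDiff_snd.fst.contDiffAt
  have ct : ContDiffAt ℝ ∞ (fun x : Reg => tau x.2.2.1) x := ContDiffAt.comp (g := tau) x (contDiffAt_tau hz) cz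
  have cW : ContDiffAt ℝ ∞ (fun x : Reg => shapeW m x.2.2.1) x :=
    ContDiffAt.comp (g := shapeW m) x (contDiffAt_shapeW hm hz) cz
  have cn : ContDiffAt ℝ ∞ (fun x : Reg => massNormSq m (levi x.2.2.1)) x :=
    (contDiff_massNormSq_levi m).contDiffAt.comp x cz
  have c2 : ContDiffAt ℝ ∞ (fun x : Reg => normTwoSq x.2.2.1) x :=
    contDiff_normTwoSq.contDiffAt.comp x cz
  have cρ : ∀ j, ContDiffAt ℝ ∞ (fun x : Reg => rho x.2.2.1 j) x := fun j =>
    (contDiff_rho j).contDiffAt.comp x cz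
  have cπ : ∀ i j, ContDiffAt ℝ ∞ (fun x : Reg => ‖x.2.2.2 i * conj (x.2.2.1 j)
      - x.2.2.2 j * conj (x.2.2.1 i)‖ ^ 2) x := fun i j =>
    (((contDiff_eta_apply i).mul (contDiff_conj_comp (contDiff_z_apply j))).sub
      ((contDiff_eta_apply j).mul (contDiff_conj_comp (contDiff_z_apply i)))).contDiffAt.norm_sq ℝ
  exact (((((ct.mul (cp.pow 2)).div_const _).add ((ct.mul contDiffAt_const).div
    (contDiffAt_const.mul (cr.pow 2)) (mul_ne_zero two_ne_zero (pow_ne_zero 2 hr)))).add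
    ((cn.div ((cr.pow 2).mul (c2.pow 3))
      (mul_ne_zero (pow_ne_zero 2 hr) (pow_ne_zero 3 (normTwoSq_pos hz).ne'))).mul
    (((((cπ 0 1).mul (cρ 2)).div_const _).add (((cπ 2 0).mul (cρ 1)).div_const _)).add
      (((cπ 1 2).mul (cρ 0)).div_const _)))).sub (cW.div cr hr)).sub (contDiffAt_const.mul ct)

theorem differentiableAt_regH {m : Fin 3 → ℝ} (hm : ∀ i, 0 < m i) (μ h : ℝ) {x : Reg}
    (hx : x ∈ RegDomain) : DifferentiableAt ℝ (regH m μ h) x :=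
  (contDiffAt_regH hm μ h hx).differentiableAt (by simp)

/-! ### The equations as Hamilton's equations -/

theorem re_pairing_complexGrad (F : (Fin 3 → ℂ) → ℝ) (w V : Fin 3 → ℂ) :
    (pairing (complexGrad F w) V).re = fderiv ℝ F w V := by
  have hV : V = ∑ j, ((V j).re • (Pi.single j 1 : Fin 3 → ℂ) +
      (V j).im • (Pi.single j Complex.I : Fin 3 → ℂ)) := by
    funext i
    fin_cases i <;> simp [Fin.sum_univ_three, Complex.re_add_im]
  conv_rhs => rw [hV]
  simp only [map_sum, map_add, map_smul, smul_eq_mul]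
  simp only [pairing, Complex.re_sum, complexGrad]
  refine Finset.sum_congr rfl fun j _ => ?_
  simp
  ring

/-- The canonical symplectic form `dr ∧ dp_r + dz ∧ dη`. -/
def canonForm (u v : Reg) : ℝ :=
  u.1 * v.2.1 - u.2.1 * v.1 + (pairing v.2.2.2 u.2.2.1).re - (pairing u.2.2.2 v.2.2.1).re

theorem canonForm_nondegenerate {a b : Reg} (hab : ∀ v, canonForm a v = canonForm b v) :
    a = b := by
  obtain ⟨a1, a2, a3, a4⟩ := a
  obtain ⟨b1, b2, b3, b4⟩ := b
  have h1 := hab (0, 1, 0, 0)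
  have h2 := hab (1, 0, 0, 0)
  have h3 := fun V => hab (0, 0, 0, V)
  have h4 := fun V => hab (0, 0, V, 0)
  simp only [canonForm, pairing_zero_left, pairing_zero_right] at h1 h2 h3 h4
  have e1 : a1 = b1 := by simpa using h1
  have e2 : a2 = b2 := by simpa using h2
  have e3 : a3 = b3 := eq_of_re_pairing_left fun V => by simpa using h3 V
  have e4 : a4 = b4 := eq_of_re_pairing_right fun V => by simpa using h4 V
  rw [e1, e2, e3, e4]

/-- The coefficient of the curvature term in the equations. -/
def magCoeff (μ : ℝ) (x : Reg) : ℝ := 2 * μ * tau x.2.2.1 / x.1 ^ 2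

theorem hasFDerivAt_reg_eta {r p : ℝ} {z η : Fin 3 → ℂ} :
    HasFDerivAt (fun η' : Fin 3 → ℂ => ((r, p, z, η') : Reg))
      ((0 : (Fin 3 → ℂ) →L[ℝ] ℝ).prod ((0 : (Fin 3 → ℂ) →L[ℝ] ℝ).prod
        ((0 : (Fin 3 → ℂ) →L[ℝ] (Fin 3 → ℂ)).prod (.id ℝ _)))) η :=
  (hasFDerivAt_const r η).prodMk ((hasFDerivAt_const p η).prodMk
    ((hasFDerivAt_const z η).prodMk (hasFDerivAt_id η)))

theorem hasFDerivAt_reg_z {r p : ℝ} {z η : Fin 3 → ℂ} :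
    HasFDerivAt (fun z' : Fin 3 → ℂ => ((r, p, z', η) : Reg))
      ((0 : (Fin 3 → ℂ) →L[ℝ] ℝ).prod ((0 : (Fin 3 → ℂ) →L[ℝ] ℝ).prod
        ((.id ℝ _ : (Fin 3 → ℂ) →L[ℝ] (Fin 3 → ℂ)).prod 0))) z :=
  (hasFDerivAt_const r z).prodMk ((hasFDerivAt_const p z).prodMk
    ((hasFDerivAt_id z).prodMk (hasFDerivAt_const η z)))

theorem fderiv_regH_eta {m : Fin 3 → ℝ} (hm : ∀ i, 0 < m i) {μ h r p : ℝ} {z η : Fin 3 → ℂ}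
    (hx : (r, p, z, η) ∈ RegDomain) (V : Fin 3 → ℂ) :
    fderiv ℝ (fun η' => regH m μ h (r, p, z, η')) η V
      = fderiv ℝ (regH m μ h) (r, p, z, η) (0, 0, 0, V) := by
  have e : HasFDerivAt (fun η' => regH m μ h (r, p, z, η')) _ η :=
    HasFDerivAt.comp (g := regH m μ h) η (differentiableAt_regH hm μ h hx).hasFDerivAt
      hasFDerivAt_reg_eta
  rw [e.fderiv]
  simp

theorem fderiv_regH_z {m : Fin 3 → ℝ} (hm : ∀ i, 0 < m i) {μ h r p : ℝ} {z η : Fin 3 → ℂ}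
    (hx : (r, p, z, η) ∈ RegDomain) (V : Fin 3 → ℂ) :
    fderiv ℝ (fun z' => regH m μ h (r, p, z', η)) z V
      = fderiv ℝ (regH m μ h) (r, p, z, η) (0, 0, V, 0) := by
  have e : HasFDerivAt (fun z' => regH m μ h (r, p, z', η)) _ z :=
    HasFDerivAt.comp (g := regH m μ h) z (differentiableAt_regH hm μ h hx).hasFDerivAt
      hasFDerivAt_reg_z
  rw [e.fderiv]
  simp

/-- All partial derivatives become values of one Fréchet derivative on fixed vectors, so that
smoothness of the field follows from smoothness of the Hamiltonian. -/
theorem regField_eq {m : Fin 3 → ℝ} (hm : ∀ i, 0 < m i) (μ h : ℝ) {x : Reg}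
    (hx : x ∈ RegDomain) :
    regField m μ h x = (fderiv ℝ (regH m μ h) x (0, 1, 0, 0), -fderiv ℝ (regH m μ h) x (1, 0, 0, 0),
      (fun j => ((fderiv ℝ (regH m μ h) x (0, 0, 0, Pi.single j 1) : ℝ) : ℂ)
        + Complex.I * (fderiv ℝ (regH m μ h) x (0, 0, 0, Pi.single j Complex.I) : ℝ)),
      fun j => -(((fderiv ℝ (regH m μ h) x (0, 0, Pi.single j 1, 0) : ℝ) : ℂ)
        + Complex.I * (fderiv ℝ (regH m μ h) x (0, 0, Pi.single j Complex.I, 0) : ℝ))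
        - (magCoeff μ x : ℂ) * Complex.I * x.2.2.2 j) := by
  obtain ⟨r, p, z, η⟩ := x
  have hd := (differentiableAt_regH hm μ h hx).hasFDerivAt
  have h1 : deriv (fun p' => regH m μ h (r, p', z, η)) p
      = fderiv ℝ (regH m μ h) (r, p, z, η) (0, 1, 0, 0) := by
    have hc : HasDerivAt (fun p' : ℝ => ((r, p', z, η) : Reg)) (0, 1, 0, 0) p :=
      (hasDerivAt_const _ _).prodMk ((hasDerivAt_id p).prodMk
        ((hasDerivAt_const _ _).prodMk (hasDerivAt_const _ _)))
    exact (hd.comp_hasDerivAt p hc).deriv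
  have h2 : deriv (fun r' => regH m μ h (r', p, z, η)) r
      = fderiv ℝ (regH m μ h) (r, p, z, η) (1, 0, 0, 0) := by
    have hc : HasDerivAt (fun r' : ℝ => ((r', p, z, η) : Reg)) (1, 0, 0, 0) r :=
      (hasDerivAt_id r).prodMk ((hasDerivAt_const _ _).prodMk
        ((hasDerivAt_const _ _).prodMk (hasDerivAt_const _ _)))
    exact (hd.comp_hasDerivAt r hc).deriv
  have h3' : complexGrad (fun η' => regH m μ h (r, p, z, η')) η = fun j =>
      ((fderiv ℝ (regH m μ h) (r, p, z, η) (0, 0, 0, Pi.single j 1) : ℝ) : ℂ) + Complex.I *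
        (fderiv ℝ (regH m μ h) (r, p, z, η) (0, 0, 0, Pi.single j Complex.I) : ℝ) := by
    funext j
    simp only [complexGrad, fderiv_regH_eta hm hx]
  have h4' : complexGrad (fun z' => regH m μ h (r, p, z', η)) z = fun j =>
      ((fderiv ℝ (regH m μ h) (r, p, z, η) (0, 0, Pi.single j 1, 0) : ℝ) : ℂ) + Complex.I *
        (fderiv ℝ (regH m μ h) (r, p, z, η) (0, 0, Pi.single j Complex.I, 0) : ℝ) := by
    funext j
    simp only [complexGrad, fderiv_regH_z hm hx]
  simp only [regField, h1, h2, h3', h4', magCoeff]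

theorem contDiffAt_regField {m : Fin 3 → ℝ} (hm : ∀ i, 0 < m i) (μ h : ℝ) {x : Reg}
    (hx : x ∈ RegDomain) : ContDiffAt ℝ ∞ (regField m μ h) x := by
  have hd : ∀ v, ContDiffAt ℝ ∞ (fun x => fderiv ℝ (regH m μ h) x v) x := fun v =>
    ((contDiffAt_regH hm μ h hx).fderiv_right (m := ∞) (by simp)).clm_apply contDiffAt_const
  have hdc : ∀ v, ContDiffAt ℝ ∞ (fun x => ((fderiv ℝ (regH m μ h) x v : ℝ) : ℂ)) x := fun v =>
    Complex.ofRealCLM.contDiff.contDiffAt.comp x (hd v)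
  have hmag : ContDiffAt ℝ ∞ (fun x => (magCoeff μ x : ℂ)) x := by
    refine Complex.ofRealCLM.contDiff.contDiffAt.comp x ?_
    exact (contDiffAt_const.mul ((contDiffAt_tau hx.2).comp x contDiff_snd.snd.fst.contDiffAt)).div
      (contDiff_fst.pow 2).contDiffAt (pow_ne_zero 2 hx.1.ne')
  refine ContDiffAt.congr_of_eventuallyEq ?_ (f := fun x =>
    (fderiv ℝ (regH m μ h) x (0, 1, 0, 0), -fderiv ℝ (regH m μ h) x (1, 0, 0, 0),
      (fun j => ((fderiv ℝ (regH m μ h) x (0, 0, 0, Pi.single j 1) : ℝ) : ℂ)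
        + Complex.I * (fderiv ℝ (regH m μ h) x (0, 0, 0, Pi.single j Complex.I) : ℝ)),
      fun j => -(((fderiv ℝ (regH m μ h) x (0, 0, Pi.single j 1, 0) : ℝ) : ℂ)
        + Complex.I * (fderiv ℝ (regH m μ h) x (0, 0, Pi.single j Complex.I, 0) : ℝ))
        - (magCoeff μ x : ℂ) * Complex.I * x.2.2.2 j)) ?_
  · refine (hd _).prodMk ((hd _).neg.prodMk (ContDiffAt.prodMk ?_ ?_))
    · exact contDiffAt_pi.2 fun j => (hdc _).add (contDiffAt_const.mul (hdc _))
    · exact contDiffAt_pi.2 fun j => ((hdc _).add (contDiffAt_const.mul (hdc _))).neg.sub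
        ((hmag.mul contDiffAt_const).mul (contDiff_eta_apply j).contDiffAt)
  · filter_upwards [isOpen_regDomain.mem_nhds hx] with y hy using regField_eq hm μ h hy

theorem contDiffAt_fubiniStudy (V V' : Fin 3 → ℂ) {z : Fin 3 → ℂ} (hz : z ≠ 0) :
    ContDiffAt ℝ ∞ (fun z => fubiniStudy z V V') z := by
  have c1 : ∀ j, ContDiff ℝ ∞ fun z : Fin 3 → ℂ => z j := fun j => contDiff_apply ℝ ℂ j
  have c2 : ∀ j, ContDiff ℝ ∞ fun z : Fin 3 → ℂ => conj (z j) := fun j => contDiff_conj_comp (c1 j)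
  have c3 : ContDiff ℝ ∞ fun z : Fin 3 → ℂ => pairing z z :=
    ContDiff.sum fun j _ => (c2 j).mul (c1 j)
  have c4 : ContDiff ℝ ∞ fun z : Fin 3 → ℂ => pairing V z :=
    ContDiff.sum fun j _ => contDiff_const.mul (c1 j)
  have c5 : ContDiff ℝ ∞ fun z : Fin 3 → ℂ => pairing z V' :=
    ContDiff.sum fun j _ => (c2 j).mul contDiff_const
  have c6 : ContDiffAt ℝ ∞ (fun z => (pairing V V' * pairing z z - pairing V z * pairing z V')
      / pairing z z ^ 2) z := by
    have h0 : pairing z z ≠ 0 := by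
      rw [pairing_self]
      exact_mod_cast (normTwoSq_pos hz).ne'
    simp only [div_eq_mul_inv]
    exact ((contDiff_const.mul c3).sub (c4.mul c5)).contDiffAt.mul
      ((c3.pow 2).contDiffAt.inv (pow_ne_zero 2 h0))
  exact Complex.imCLM.contDiff.contDiffAt.comp z c6

theorem contDiffAt_regForm {m : Fin 3 → ℝ} (hm : ∀ i, 0 < m i) (μ : ℝ) (u v : Reg) {x : Reg}
    (hx : x ∈ RegDomain) : ContDiffAt ℝ ∞ (fun x => regForm m μ x u v) x := by
  have cz : ContDiffAt ℝ ∞ (fun x : Reg => x.2.2.1) x := contDiff_snd.snd.fst.contDiffAt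
  exact contDiffAt_const.sub ((contDiffAt_const.mul ((contDiffAt_lam hm hx.2).comp x cz)).mul
    ((contDiffAt_fubiniStudy u.2.2.1 v.2.2.1 hx.2).comp x cz))

/-- The vector field is Hamiltonian for the canonical form, up to the curvature term. -/
theorem canonForm_regField {m : Fin 3 → ℝ} (hm : ∀ i, 0 < m i) (μ h : ℝ) {x : Reg}
    (hx : x ∈ RegDomain) (v : Reg) :
    canonForm (regField m μ h x) v = fderiv ℝ (regH m μ h) x v
      + magCoeff μ x * (pairing (Complex.I • x.2.2.2) v.2.2.1).re := by
  have hd := (differentiableAt_regH hm μ h hx).hasFDerivAt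
  obtain ⟨r, p, z, η⟩ := x
  obtain ⟨v1, v2, v3, v4⟩ := v
  set D := fderiv ℝ (regH m μ h) (r, p, z, η) with hD
  have hsplit : D (v1, v2, v3, v4) = v1 * D (1, 0, 0, 0) + v2 * D (0, 1, 0, 0)
      + D (0, 0, v3, 0) + D (0, 0, 0, v4) := by
    have : ((v1, v2, v3, v4) : Reg) = v1 • ((1, 0, 0, 0) : Reg) + v2 • ((0, 1, 0, 0) : Reg)
      + (0, 0, v3, 0) + (0, 0, 0, v4) := by simp
    rw [this, map_add, map_add, map_add, map_smul, map_smul]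
    rfl
  have h3 : (pairing v4 (regField m μ h (r, p, z, η)).2.2.1).re = D (0, 0, 0, v4) := by
    rw [pairing_re_comm]
    have e := re_pairing_complexGrad (fun η' => regH m μ h (r, p, z, η')) η v4
    rw [fderiv_regH_eta hm hx] at e
    simpa only [regField] using e
  have h4 : (pairing (regField m μ h (r, p, z, η)).2.2.2 v3).re = -D (0, 0, v3, 0)
      - magCoeff μ (r, p, z, η) * (pairing (Complex.I • η) v3).re := by
    have e := re_pairing_complexGrad (fun z' => regH m μ h (r, p, z', η)) z v3
    rw [fderiv_regH_z hm hx] at e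
    have e2 : (regField m μ h (r, p, z, η)).2.2.2
        = -complexGrad (fun z' => regH m μ h (r, p, z', η)) z
          - magCoeff μ (r, p, z, η) • Complex.I • η := by
      funext j
      simp [regField, magCoeff, mul_assoc]
    rw [e2, pairing_sub_left, pairing_neg_left, pairing_real_smul_left, Complex.sub_re,
      Complex.neg_re, e, Complex.re_ofReal_mul]
  have h1 := regField_eq hm μ h hx
  simp only [canonForm]
  rw [hsplit, h3, h4, h1]
  ring

end PlanarThreeBody
end

noncomputable section
namespace PlanarThreeBody

/-! ### Symmetries of the regularized Hamiltonian -/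

theorem normTwoSq_smul (k : ℂ) (z : Fin 3 → ℂ) :
    normTwoSq (fun j => k * z j) = ‖k‖ ^ 2 * normTwoSq z := by
  simp [normTwoSq, Finset.mul_sum, mul_pow]

theorem rho_smul (k : ℂ) (z : Fin 3 → ℂ) (j : Fin 3) :
    rho (fun j => k * z j) j = ‖k‖ ^ 2 * rho z j := by
  simp [rho, mul_pow]

theorem levi_smul (k : ℂ) (z : Fin 3 → ℂ) :
    levi (fun j => k * z j) = fun j => k ^ 2 * levi z j := by
  funext j
  simp [levi, mul_pow]

theorem massNormSq_smul (m : Fin 3 → ℝ) (k : ℂ) (X : Fin 3 → ℂ) :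
    massNormSq m (fun j => k * X j) = ‖k‖ ^ 2 * massNormSq m X := by
  simp only [massNormSq, norm_mul, mul_pow, Fin.sum_univ_three]
  ring

theorem massNormSq_levi_smul (m : Fin 3 → ℝ) (k : ℂ) (z : Fin 3 → ℂ) :
    massNormSq m (levi fun j => k * z j) = ‖k‖ ^ 4 * massNormSq m (levi z) := by
  rw [levi_smul, massNormSq_smul, norm_pow]
  ring

theorem sqrt_massNormSq_levi_smul (m : Fin 3 → ℝ) (k : ℂ) (z : Fin 3 → ℂ) :
    √(massNormSq m (levi fun j => k * z j)) = ‖k‖ ^ 2 * √(massNormSq m (levi z)) := by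
  rw [massNormSq_levi_smul, Real.sqrt_mul (by positivity)]
  congr 1
  rw [show ‖k‖ ^ 4 = (‖k‖ ^ 2) ^ 2 by ring, Real.sqrt_sq (by positivity)]

theorem tau_smul {k : ℂ} (hk : k ≠ 0) (z : Fin 3 → ℂ) :
    tau (fun j => k * z j) = tau z := by
  have : ‖k‖ ≠ 0 := norm_ne_zero_iff.2 hk
  simp only [tau, rho_smul, normTwoSq_smul]
  field_simp

theorem shapeW_smul (m : Fin 3 → ℝ) {k : ℂ} (hk : k ≠ 0) (z : Fin 3 → ℂ) :
    shapeW m (fun j => k * z j) = shapeW m z := by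
  have : ‖k‖ ≠ 0 := norm_ne_zero_iff.2 hk
  simp only [shapeW, rho_smul, normTwoSq_smul, sqrt_massNormSq_levi_smul]
  field_simp

theorem lam_smul (m : Fin 3 → ℝ) {k : ℂ} (hk : k ≠ 0) (z : Fin 3 → ℂ) :
    lam m (fun j => k * z j) = lam m z := by
  have : ‖k‖ ≠ 0 := norm_ne_zero_iff.2 hk
  simp only [lam, rho_smul, normTwoSq_smul, massNormSq_levi_smul]
  field_simp

/-- In each `π` the translation adds the same multiple of `conj z_i * conj z_j` to both products,
and the factors `1 / conj k` and `conj k` cancel. The remaining coefficients are homogeneous of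
degree zero in `z`. -/
theorem regH_regAct (m : Fin 3 → ℝ) (μ h : ℝ) {k : ℂ} (hk : k ≠ 0) (c : ℂ) (x : Reg) :
    regH m μ h (regAct k c x) = regH m μ h x := by
  have hk' : conj k ≠ 0 := by simpa using hk
  have hn : ‖k‖ ≠ 0 := norm_ne_zero_iff.2 hk
  obtain ⟨r, p, z, η⟩ := x
  have e1 : pi1 (fun j => k * z j) (fun j => η j / conj k + 2 * c * conj (k * z j)) = pi1 z η := by
    simp only [pi1, map_mul]; field_simp; ring
  have e2 : pi2 (fun j => k * z j) (fun j => η j / conj k + 2 * c * conj (k * z j)) = pi2 z η := by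
    simp only [pi2, map_mul]; field_simp; ring
  have e3 : pi3 (fun j => k * z j) (fun j => η j / conj k + 2 * c * conj (k * z j)) = pi3 z η := by
    simp only [pi3, map_mul]; field_simp; ring
  simp only [regH, regAct, e1, e2, e3, tau_smul hk, shapeW_smul m hk, massNormSq_levi_smul,
    normTwoSq_smul, rho_smul]
  congr 3
  field_simp

/-- Only the norms of the `π`, which are linear in `η`, enter the Hamiltonian. As a consequence the
curvature term, proportional to `i η`, does no work. -/
theorem regH_rotate_eta (m : Fin 3 → ℝ) (μ h : ℝ) {u : ℂ} (hu : ‖u‖ = 1) (r p : ℝ)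
    (z η : Fin 3 → ℂ) : regH m μ h (r, p, z, fun j => u * η j) = regH m μ h (r, p, z, η) := by
  have e1 : ‖pi1 z (fun j => u * η j)‖ = ‖pi1 z η‖ := by
    rw [← one_mul ‖pi1 z η‖, ← hu, ← norm_mul]; congr 1; simp only [pi1]; ring
  have e2 : ‖pi2 z (fun j => u * η j)‖ = ‖pi2 z η‖ := by
    rw [← one_mul ‖pi2 z η‖, ← hu, ← norm_mul]; congr 1; simp only [pi2]; ring
  have e3 : ‖pi3 z (fun j => u * η j)‖ = ‖pi3 z η‖ := by
    rw [← one_mul ‖pi3 z η‖, ← hu, ← norm_mul]; congr 1; simp only [pi3]; ring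
  simp only [regH, e1, e2, e3]

theorem fderiv_eq_zero_of_curve {E : Type*} [NormedAddCommGroup E] [NormedSpace ℝ E] {F : E → ℝ}
    {γ : ℝ → E} {x v : E} (hF : DifferentiableAt ℝ F x) (h0 : γ 0 = x) (hγ : HasDerivAt γ v 0)
    (hc : ∀ᶠ t in 𝓝 0, F (γ t) = F x) : fderiv ℝ F x v = 0 := by
  subst h0
  have h1 : HasDerivAt (fun t => F (γ t)) (fderiv ℝ F (γ 0) v) 0 :=
    hF.hasFDerivAt.comp_hasDerivAt 0 hγ
  exact h1.unique ((hasDerivAt_const (0 : ℝ) (F (γ 0))).congr_of_eventuallyEq hc)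

theorem hasDerivAt_cexp_smul (κ : ℂ) : HasDerivAt (fun t : ℝ => Complex.exp (t * κ)) κ 0 := by
  have h1 : HasDerivAt (fun t : ℝ => (t : ℂ) * κ) κ 0 := by
    simpa using (Complex.ofRealCLM.hasDerivAt (x := (0 : ℝ))).mul_const κ
  simpa using h1.cexp

/-- The velocity of the orbit of `x` under the one-parameter family `(e^{κ t}, c t / 2)`. -/
theorem hasDerivAt_regAct_orbit (κ c : ℂ) (x : Reg) :
    HasDerivAt (fun t : ℝ => regAct (Complex.exp (t * κ)) (t * (c / 2)) x)
      (0, 0, fun j => κ * x.2.2.1 j, fun j => -conj κ * x.2.2.2 j + c * conj (x.2.2.1 j)) 0 := by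
  have hk := hasDerivAt_cexp_smul κ
  have hk' : HasDerivAt (fun t : ℝ => conj (Complex.exp (t * κ))) (conj κ) 0 :=
    Complex.conjCLE.hasFDerivAt.comp_hasDerivAt (0 : ℝ) hk
  have ht : HasDerivAt (fun t : ℝ => (t : ℂ) * (c / 2)) (c / 2) 0 := by
    simpa using (Complex.ofRealCLM.hasDerivAt (x := (0 : ℝ))).mul_const (c / 2)
  refine (hasDerivAt_const _ _).prodMk ((hasDerivAt_const _ _).prodMk (HasDerivAt.prodMk ?_ ?_))
  · exact hasDerivAt_pi.2 fun j => hk.mul_const _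
  · refine hasDerivAt_pi.2 fun j => ?_
    have h1 := ((hasDerivAt_const (0 : ℝ) (x.2.2.2 j)).div hk' (by simp)).add
      ((ht.const_mul 2).mul (hk'.mul_const (conj (x.2.2.1 j))))
    simp only [map_mul]
    convert! h1 using 1
    simp
    ring

/-! ### Infinitesimal symmetries and their Noether identities -/

section derivatives

variable {m : Fin 3 → ℝ} (hm : ∀ i, 0 < m i) (μ h : ℝ) {x : Reg} (hx : x ∈ RegDomain)
include hm hx

theorem fderiv_regH_orbit (κ c : ℂ) :
    fderiv ℝ (regH m μ h) x (0, 0, fun j => κ * x.2.2.1 j,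
      fun j => -conj κ * x.2.2.2 j + c * conj (x.2.2.1 j)) = 0 :=
  fderiv_eq_zero_of_curve (differentiableAt_regH hm μ h hx) (by simp [regAct])
    (hasDerivAt_regAct_orbit κ c x)
    (Eventually.of_forall fun _ => regH_regAct m μ h (Complex.exp_ne_zero _) _ x)

theorem fderiv_regH_rotate_eta :
    fderiv ℝ (regH m μ h) x (0, 0, 0, Complex.I • x.2.2.2) = 0 := by
  refine fderiv_eq_zero_of_curve (differentiableAt_regH hm μ h hx)
    (γ := fun t => (x.1, x.2.1, x.2.2.1, fun j => Complex.exp (t * Complex.I) * x.2.2.2 j))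
    (by simp) ?_ (Eventually.of_forall fun t =>
      regH_rotate_eta m μ h (Complex.norm_exp_ofReal_mul_I t) _ _ _ _)
  exact (hasDerivAt_const _ _).prodMk ((hasDerivAt_const _ _).prodMk
    ((hasDerivAt_const _ _).prodMk
      (hasDerivAt_pi.2 fun j => (hasDerivAt_cexp_smul Complex.I).mul_const _)))

/-- Noether identity for the translations `η ↦ η + c conj z`. The curvature term does not enter,
since this direction has no `z`-component. -/
theorem sum_z_mul_regField : ∑ j, x.2.2.1 j * (regField m μ h x).2.2.1 j = 0 := by
  refine eq_zero_of_re_mul fun c => ?_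
  have h1 := canonForm_regField hm μ h hx
    (0, 0, fun j => 0 * x.2.2.1 j, fun j => -conj 0 * x.2.2.2 j + conj c * conj (x.2.2.1 j))
  rw [fderiv_regH_orbit hm μ h hx] at h1
  simp only [canonForm, pairing, Fin.sum_univ_three] at h1
  simp only [Fin.sum_univ_three, ← mul_assoc] at h1 ⊢
  simp at h1
  simp only [mul_add, Complex.add_re, ← mul_assoc]
  simp [← h1]

/-- Noether identity for the complex scalings. The curvature term spoils conservation of `⟨η, z⟩`,
but only by a multiple of `⟨η, z⟩` itself, so the zero level is still invariant. -/
theorem pairing_eta_regField : pairing (regField m μ h x).2.2.2 x.2.2.1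
    + pairing x.2.2.2 (regField m μ h x).2.2.1
      = magCoeff μ x * Complex.I * pairing x.2.2.2 x.2.2.1 := by
  rw [← sub_eq_zero]
  refine eq_zero_of_re_mul fun κ => ?_
  have h1 := canonForm_regField hm μ h hx
    (0, 0, fun j => κ * x.2.2.1 j, fun j => -conj κ * x.2.2.2 j + 0 * conj (x.2.2.1 j))
  rw [fderiv_regH_orbit hm μ h hx] at h1
  have e1 : (fun j => κ * x.2.2.1 j) = κ • x.2.2.1 := rfl
  have e2 : (fun j => -conj κ * x.2.2.2 j + 0 * conj (x.2.2.1 j)) = (-conj κ) • x.2.2.2 := by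
    funext j; simp
  rw [e1, e2] at h1
  simp only [canonForm, pairing_smul_right, pairing_smul_left, map_neg, Complex.conj_conj,
    Complex.conj_I] at h1
  generalize pairing (regField m μ h x).2.2.2 x.2.2.1 = a at *
  generalize pairing x.2.2.2 (regField m μ h x).2.2.1 = b at *
  generalize pairing x.2.2.2 x.2.2.1 = d at *
  simp at h1 ⊢
  linarith

theorem re_pairing_I_eta_regField :
    (pairing (Complex.I • x.2.2.2) (regField m μ h x).2.2.1).re = 0 := by
  have h1 := canonForm_regField hm μ h hx (0, 0, 0, Complex.I • x.2.2.2)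
  rw [fderiv_regH_rotate_eta hm μ h hx] at h1
  simpa [canonForm] using h1

/-- The canonical form is alternating, and the curvature term pairs to zero with the velocity of `z`
by invariance under rotations of `η`. -/
theorem fderiv_regH_regField : fderiv ℝ (regH m μ h) x (regField m μ h x) = 0 := by
  have h1 := canonForm_regField hm μ h hx (regField m μ h x)
  rw [re_pairing_I_eta_regField hm μ h hx, mul_zero, add_zero] at h1
  rw [← h1]
  simp only [canonForm]
  ring

end derivatives

/-! ### Invariance of the level set and conservation of the Hamiltonian -/

theorem IsRegSolution.hasDerivAt {m : Fin 3 → ℝ} {μ h : ℝ} {x : ℝ → Reg} {J : Set ℝ}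
    (hx : IsRegSolution m μ h x J) {s : ℝ} (hs : s ∈ J) :
    HasDerivAt x (regField m μ h (x s)) s :=
  (hx.2.2.1 s hs).hasDerivAt (hx.1.mem_nhds hs)

theorem isRegSolution_of_hasDerivAt {m : Fin 3 → ℝ} {μ h : ℝ} {x : ℝ → Reg} {J : Set ℝ}
    (hJ : IsOpen J) (hJ' : J.OrdConnected)
    (hx : ∀ s ∈ J, HasDerivAt x (regField m μ h (x s)) s ∧ x s ∈ RegDomain) :
    IsRegSolution m μ h x J :=
  ⟨hJ, hJ', fun s hs => (hx s hs).1.hasDerivWithinAt, fun s hs => (hx s hs).2⟩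

theorem IsRegSolution.continuousOn {m : Fin 3 → ℝ} {μ h : ℝ} {x : ℝ → Reg} {J : Set ℝ}
    (hx : IsRegSolution m μ h x J) : ContinuousOn x J :=
  fun _ hs => (hx.hasDerivAt hs).continuousAt.continuousWithinAt

theorem IsRegSolution.eqOn {m : Fin 3 → ℝ} (hm : ∀ i, 0 < m i) {μ h : ℝ} {x y : ℝ → Reg}
    {J : Set ℝ} (hx : IsRegSolution m μ h x J) (hy : IsRegSolution m μ h y J) {s₀ : ℝ}
    (hs₀ : s₀ ∈ J) (h0 : x s₀ = y s₀) : EqOn x y J :=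
  eqOn_of_integralCurves (v := regField m μ h)
    (fun _ hx => (contDiffAt_regField hm μ h hx).of_le (by exact_mod_cast le_top)) hx.1 hx.2.1
    (fun s hs => ⟨hx.hasDerivAt hs, hx.2.2.2 s hs⟩)
    (fun s hs => ⟨hy.hasDerivAt hs, hy.2.2.2 s hs⟩) hs₀ h0

theorem continuousOn_magCoeff (μ : ℝ) : ContinuousOn (magCoeff μ) RegDomain := fun x hx =>
  (((contDiffAt_const.mul (ContDiffAt.comp (g := tau) x (contDiffAt_tau hx.2)
    contDiff_snd.snd.fst.contDiffAt)).div (contDiff_fst.pow 2).contDiffAt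
    (pow_ne_zero 2 hx.1.ne')).continuousAt (n := ∞)).continuousWithinAt

theorem IsRegSolution.continuousOn_magCoeff {m : Fin 3 → ℝ} {μ h : ℝ} {x : ℝ → Reg} {J : Set ℝ}
    (hx : IsRegSolution m μ h x J) (a : ℂ) :
    ContinuousOn (fun s => (magCoeff μ (x s) : ℂ) * a) J :=
  (Complex.continuous_ofReal.comp_continuousOn
    ((PlanarThreeBody.continuousOn_magCoeff μ).comp hx.continuousOn hx.2.2.2)).mul
      continuousOn_const

theorem hasDerivAt_pairing {A B : ℝ → Fin 3 → ℂ} {A' B' : Fin 3 → ℂ} {s : ℝ}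
    (hA : HasDerivAt A A' s) (hB : HasDerivAt B B' s) :
    HasDerivAt (fun s => pairing (A s) (B s)) (pairing A' (B s) + pairing (A s) B') s := by
  have hA' : ∀ j, HasDerivAt (fun s => conj (A s j)) (conj (A' j)) s := fun j =>
    Complex.conjCLE.hasFDerivAt.comp_hasDerivAt s (hasDerivAt_pi.1 hA j)
  have h1 := HasDerivAt.fun_sum (u := Finset.univ) fun j _ => (hA' j).mul (hasDerivAt_pi.1 hB j)
  convert! h1 using 1
  simp [pairing, Finset.sum_add_distrib]

theorem hasDerivAt_sum_sq {A : ℝ → Fin 3 → ℂ} {A' : Fin 3 → ℂ} {s : ℝ}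
    (hA : HasDerivAt A A' s) :
    HasDerivAt (fun s => ∑ j, A s j ^ 2) (2 * ∑ j, A s j * A' j) s := by
  have h1 := HasDerivAt.fun_sum (u := Finset.univ) fun j _ => (hasDerivAt_pi.1 hA j).pow 2
  convert! h1 using 1
  simp [Finset.mul_sum, mul_assoc]

theorem hasDerivAt_reg {x : ℝ → Reg} {v : Reg} {s : ℝ} (hx : HasDerivAt x v s) :
    HasDerivAt (fun s => (x s).1) v.1 s ∧ HasDerivAt (fun s => (x s).2.1) v.2.1 s ∧
    HasDerivAt (fun s => (x s).2.2.1) v.2.2.1 s ∧ HasDerivAt (fun s => (x s).2.2.2) v.2.2.2 s :=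
  ⟨hx.fst, hx.snd.fst, hx.snd.snd.fst, hx.snd.snd.snd⟩

theorem IsRegSolution.level {m : Fin 3 → ℝ} (hm : ∀ i, 0 < m i) {μ h : ℝ} {x : ℝ → Reg}
    {J : Set ℝ} (hx : IsRegSolution m μ h x J) {s₀ : ℝ} (hs₀ : s₀ ∈ J) (h0 : x s₀ ∈ RegLevel)
    {s : ℝ} (hs : s ∈ J) : x s ∈ RegLevel ∧ regH m μ h (x s) = regH m μ h (x s₀) := by
  refine ⟨⟨hx.2.2.2 s hs, ?_, ?_⟩, ?_⟩
  -- Along the solution `⟨η, z⟩` solves a homogeneous linear equation, so it vanishes identically if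
  -- it vanishes once.
  · refine eq_zero_of_linear_hom hx.1 hx.2.1 (hx.continuousOn_magCoeff Complex.I)
      (f := fun s => pairing (x s).2.2.2 (x s).2.2.1) (fun s hs => ?_) hs₀ h0.2.1 s hs
    have hd := hasDerivAt_reg (hx.hasDerivAt hs)
    rw [← pairing_eta_regField hm μ h (hx.2.2.2 s hs)]
    exact hasDerivAt_pairing hd.2.2.2 hd.2.2.1
  · rw [← h0.2.2]
    refine const_of_hasDerivAt_zero hx.1 hx.2.1 (f := fun s => ∑ j, (x s).2.2.1 j ^ 2)
      (fun s hs => ?_) hs hs₀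
    have := hasDerivAt_sum_sq (hasDerivAt_reg (hx.hasDerivAt hs)).2.2.1
    rwa [sum_z_mul_regField hm μ h (hx.2.2.2 s hs), mul_zero] at this
  · refine const_of_hasDerivAt_zero hx.1 hx.2.1 (f := fun s => regH m μ h (x s))
      (fun s hs => ?_) hs hs₀
    rw [← fderiv_regH_regField hm μ h (hx.2.2.2 s hs)]
    exact (differentiableAt_regH hm μ h (hx.2.2.2 s hs)).hasFDerivAt.comp_hasDerivAt s
      (hx.hasDerivAt hs)

theorem regField_mem_regTangent {m : Fin 3 → ℝ} (hm : ∀ i, 0 < m i) (μ h : ℝ) {x : Reg}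
    (hx : x ∈ RegLevel) : regField m μ h x ∈ RegTangent x :=
  ⟨by rw [pairing_eta_regField hm μ h hx.1, hx.2.1, mul_zero], sum_z_mul_regField hm μ h hx.1⟩

theorem exists_regSolution {m : Fin 3 → ℝ} (hm : ∀ i, 0 < m i) (μ h : ℝ) {K : Set Reg}
    (hK : IsCompact K) (hKU : K ⊆ RegDomain) :
    ∃ ε > 0, ∀ x₀ ∈ K, ∃ x, IsRegSolution m μ h x (Ioo (-ε) ε) ∧ x 0 = x₀ := by
  obtain ⟨ε, hε, hsol⟩ := exists_uniform_time (v := regField m μ h) isOpen_regDomain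
    (fun _ hx => (contDiffAt_regField hm μ h hx).of_le (by exact_mod_cast le_top)) hK hKU
  refine ⟨ε, hε, fun x₀ hx₀ => ?_⟩
  obtain ⟨x, h0, hx⟩ := hsol x₀ hx₀
  exact ⟨x, isRegSolution_of_hasDerivAt isOpen_Ioo ordConnected_Ioo hx, h0⟩

/-! ### The group action -/

theorem regAct_mem_regDomain {k : ℂ} (hk : k ≠ 0) (c : ℂ) {x : Reg} (hx : x ∈ RegDomain) :
    regAct k c x ∈ RegDomain := by
  refine ⟨hx.1, fun h0 => hx.2 ?_⟩
  funext j
  have := congrFun h0 j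
  simpa [regAct, hk] using this

/-- The translation contributes a term symmetric in `u` and `v`. It therefore drops out of the
canonical two-form, and it vanishes for `u = v` on the quadric. -/
theorem pairing_regAct {k : ℂ} (hk : k ≠ 0) (c : ℂ) (u v : Reg) :
    pairing (regAct k c v).2.2.2 (regAct k c u).2.2.1 = pairing v.2.2.2 u.2.2.1
      + 2 * conj c * k ^ 2 * ∑ j, v.2.2.1 j * u.2.2.1 j := by
  have hk' : conj k ≠ 0 := by simpa using hk
  simp only [pairing, regAct, Fin.sum_univ_three, map_add, map_mul, map_div₀, Complex.conj_conj,
    Complex.conj_ofNat]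
  field_simp
  ring

theorem regAct_mem_regLevel {k : ℂ} (hk : k ≠ 0) (c : ℂ) {x : Reg} (hx : x ∈ RegLevel) :
    regAct k c x ∈ RegLevel := by
  refine ⟨regAct_mem_regDomain hk c hx.1, ?_, ?_⟩
  · rw [pairing_regAct hk, hx.2.1]
    have := hx.2.2
    simp only [sq] at this
    rw [this]
    simp
  · have : ∑ j, (k * x.2.2.1 j) ^ 2 = k ^ 2 * ∑ j, x.2.2.1 j ^ 2 := by
      simp [Finset.mul_sum, mul_pow]
    simp only [regAct]
    rw [this, hx.2.2, mul_zero]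

theorem canonForm_regAct {k : ℂ} (hk : k ≠ 0) (c : ℂ) (u v : Reg) :
    canonForm (regAct k c u) (regAct k c v) = canonForm u v := by
  have h1 : ∑ j, u.2.2.1 j * v.2.2.1 j = ∑ j, v.2.2.1 j * u.2.2.1 j :=
    Finset.sum_congr rfl fun j _ => mul_comm _ _
  simp only [canonForm, pairing_regAct hk, h1, Complex.add_re]
  simp only [regAct]
  ring

theorem pairing_smul_smul (k : ℂ) (P Q : Fin 3 → ℂ) :
    pairing (fun j => k * P j) (fun j => k * Q j) = (‖k‖ ^ 2 : ℝ) * pairing P Q := by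
  have e : ∀ P : Fin 3 → ℂ, (fun j => k * P j) = k • P := fun _ => rfl
  rw [e, e, pairing_smul_left, pairing_smul_right, ← mul_assoc, Complex.conj_mul']
  push_cast
  rfl

theorem fubiniStudy_smul {k : ℂ} (hk : k ≠ 0) (z V V' : Fin 3 → ℂ) :
    fubiniStudy (fun j => k * z j) (fun j => k * V j) (fun j => k * V' j)
      = fubiniStudy z V V' := by
  have hn : ((‖k‖ ^ 2 : ℝ) : ℂ) ≠ 0 := by
    exact_mod_cast pow_ne_zero 2 (norm_ne_zero_iff.2 hk)
  simp only [fubiniStudy, pairing_smul_smul]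
  congr 1
  generalize ((‖k‖ ^ 2 : ℝ) : ℂ) = a at *
  by_cases h0 : pairing z z = 0
  · simp [h0]
  · field_simp

theorem regForm_eq (m : Fin 3 → ℝ) (μ : ℝ) (x u v : Reg) : regForm m μ x u v
    = canonForm u v - 2 * μ * lam m x.2.2.1 * fubiniStudy x.2.2.1 u.2.2.1 v.2.2.1 := rfl

theorem regForm_regAct (m : Fin 3 → ℝ) (μ : ℝ) {k : ℂ} (hk : k ≠ 0) (c : ℂ) (x u v : Reg) :
    regForm m μ (regAct k c x) (regAct k c u) (regAct k c v) = regForm m μ x u v := by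
  rw [regForm_eq, regForm_eq, canonForm_regAct hk]
  congr 1
  show 2 * μ * lam m (fun j => k * x.2.2.1 j) * fubiniStudy (fun j => k * x.2.2.1 j)
    (fun j => k * u.2.2.1 j) (fun j => k * v.2.2.1 j) = _
  rw [lam_smul m hk, fubiniStudy_smul hk]

theorem regAct_add (k c : ℂ) (u v : Reg) : regAct k c (u + v) = regAct k c u + regAct k c v := by
  refine Prod.ext rfl (Prod.ext rfl (Prod.ext ?_ ?_)) <;> funext j <;> simp [regAct] <;> ring

theorem regAct_smul (k c : ℂ) (a : ℝ) (u : Reg) : regAct k c (a • u) = a • regAct k c u := by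
  refine Prod.ext rfl (Prod.ext rfl (Prod.ext ?_ ?_)) <;> funext j <;> simp [regAct] <;> ring

/-- The action of `(k, c)` as a continuous linear map. -/
def regActL (k c : ℂ) : Reg →L[ℝ] Reg :=
  LinearMap.toContinuousLinearMap
    { toFun := regAct k c
      map_add' := regAct_add k c
      map_smul' := regAct_smul k c }

@[simp] theorem regActL_apply (k c : ℂ) (x : Reg) : regActL k c x = regAct k c x := rfl

theorem regAct_surjective {k : ℂ} (hk : k ≠ 0) (c : ℂ) (v : Reg) :
    ∃ u, regAct k c u = v := by
  have hk' : conj k ≠ 0 := by simpa using hk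
  refine ⟨(v.1, v.2.1, fun j => v.2.2.1 j / k,
    fun j => conj k * (v.2.2.2 j - 2 * c * conj (v.2.2.1 j))), ?_⟩
  refine Prod.ext rfl (Prod.ext rfl (Prod.ext ?_ ?_)) <;> funext j <;> simp [regAct] <;>
    field_simp
  ring

/-- Equivariance of the equations, up to a translation of `η`. -/
theorem regField_regAct {m : Fin 3 → ℝ} (hm : ∀ i, 0 < m i) (μ h : ℝ) {k : ℂ} (hk : k ≠ 0) (c : ℂ)
    {x : Reg} (hx : x ∈ RegDomain) :
    regField m μ h (regAct k c x) = regAct k c (regField m μ h x)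
      + (0, 0, 0, fun j => -(2 * magCoeff μ x * Complex.I * c) * conj (k * x.2.2.1 j)) := by
  have hk' : conj k ≠ 0 := by simpa using hk
  have hgx := regAct_mem_regDomain hk c hx
  -- The two fields are compared by contracting the canonical form with transported vectors `regAct
  -- k c w`, which exhaust all vectors.
  refine canonForm_nondegenerate fun v => ?_
  obtain ⟨w, rfl⟩ := regAct_surjective hk c v
  have hadd : ∀ a b v, canonForm (a + b) v = canonForm a v + canonForm b v := by
    intro a b v
    simp only [canonForm, Prod.fst_add, Prod.snd_add, pairing_add_left, pairing_add_right,
      Complex.add_re]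
    ring
  have hfd : fderiv ℝ (regH m μ h) (regAct k c x) (regAct k c w) = fderiv ℝ (regH m μ h) x w := by
    have h1 : HasFDerivAt (fun y => regH m μ h (regActL k c y)) _ x :=
      HasFDerivAt.comp (g := regH m μ h) x (differentiableAt_regH hm μ h hgx).hasFDerivAt
        (regActL k c).hasFDerivAt
    have h2 : (fun y => regH m μ h (regActL k c y)) = regH m μ h := by
      funext y
      exact regH_regAct m μ h hk c y
    rw [h2] at h1
    rw [h1.fderiv]
    rfl
  have hmag : magCoeff μ (regAct k c x) = magCoeff μ x := by
    simp only [magCoeff, regAct, tau_smul hk]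
  rw [hadd, canonForm_regField hm μ h hgx, canonForm_regAct hk, canonForm_regField hm μ h hx, hfd,
    hmag]
  -- The curvature term at the transformed point also multiplies the translation `2 c conj (k z)` by
  -- `i`; this is the defect from exact equivariance.
  have e1 : (fun j => -(2 * magCoeff μ x * Complex.I * c) * conj (k * x.2.2.1 j))
      = (-magCoeff μ x) • (Complex.I • fun j => 2 * c * conj (k * x.2.2.1 j)) := by
    funext j
    simp
    ring
  have e2 : (regAct k c x).2.2.2
      = (fun j => x.2.2.2 j / conj k) + fun j => 2 * c * conj (k * x.2.2.1 j) := rfl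
  have e3 : pairing (fun j => x.2.2.2 j / conj k) (regAct k c w).2.2.1
      = pairing x.2.2.2 w.2.2.1 := by
    simp only [pairing, regAct, map_div₀, Complex.conj_conj]
    exact Finset.sum_congr rfl fun j _ => by field_simp
  rw [e1, e2]
  simp only [canonForm, pairing_real_smul_left, pairing_smul_left, pairing_add_left, e3]
  simp
  ring

end PlanarThreeBody
end

noncomputable section
namespace PlanarThreeBody

/-! ### The flow on the quotient -/

theorem hasDerivAt_conj {f : ℝ → ℂ} {f' : ℂ} {s : ℝ} (hf : HasDerivAt f f' s) :
    HasDerivAt (fun s => conj (f s)) (conj f') s :=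
  Complex.conjCLE.hasFDerivAt.comp_hasDerivAt s hf

theorem hasDerivAt_regAct {k c : ℝ → ℂ} {k' c' : ℂ} {x : ℝ → Reg} {x' : Reg} {s : ℝ}
    (hk : HasDerivAt k k' s) (hk0 : k s ≠ 0) (hc : HasDerivAt c c' s) (hx : HasDerivAt x x' s) :
    HasDerivAt (fun s => regAct (k s) (c s) (x s)) (regAct (k s) (c s) x' +
      (0, 0, fun j => k' * (x s).2.2.1 j, fun j => -(conj k' / conj (k s) ^ 2) * (x s).2.2.2 j
        + 2 * c' * conj (k s * (x s).2.2.1 j) + 2 * c s * conj (k' * (x s).2.2.1 j))) s := by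
  have hk0' : conj (k s) ≠ 0 := by simpa using hk0
  obtain ⟨h1, h2, h3, h4⟩ := hasDerivAt_reg hx
  have h3 := hasDerivAt_pi.1 h3
  have h4 := hasDerivAt_pi.1 h4
  convert! h1.prodMk (h2.prodMk (HasDerivAt.prodMk
    (hasDerivAt_pi.2 fun j => hk.mul (h3 j))
    (hasDerivAt_pi.2 fun j => ((h4 j).div (hasDerivAt_conj hk) hk0').add
      ((hc.const_mul 2).mul (hasDerivAt_conj (hk.mul (h3 j))))))) using 1
  refine Prod.ext (by simp [regAct]) (Prod.ext (by simp [regAct]) (Prod.ext ?_ ?_)) <;> funext j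
  · simp [regAct]
    ring
  · simp [regAct]
    field_simp
    ring

/-- The field is equivariant only up to a translation of `η`, so a fixed group element need not
carry solutions to solutions. A constant `k` together with a suitably evolving `c` does, and
uniqueness identifies the result with `y`. -/
theorem IsRegSolution.regSetoid {m : Fin 3 → ℝ} (hm : ∀ i, 0 < m i) {μ h : ℝ} {x y : ℝ → Reg}
    {J : Set ℝ} (hx : IsRegSolution m μ h x J) (hy : IsRegSolution m μ h y J) {s₀ : ℝ}
    (hs₀ : s₀ ∈ J) (h0 : regSetoid (x s₀) (y s₀)) {s : ℝ} (hs : s ∈ J) :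
    regSetoid (x s) (y s) := by
  obtain ⟨k, c₀, hk, h0⟩ := h0
  -- The equation `c' = -i (2μτ/r²) c` compensates the equivariance defect of `regField_regAct`.
  obtain ⟨c, hc0, hc, -⟩ := exists_linear_hom hx.1 hx.2.1
    (hx.continuousOn_magCoeff (-Complex.I)) hs₀ c₀
  have hsol : IsRegSolution m μ h (fun s => regAct k (c s) (x s)) J := by
    refine isRegSolution_of_hasDerivAt hx.1 hx.2.1 fun s hs =>
      ⟨?_, regAct_mem_regDomain hk _ (hx.2.2.2 s hs)⟩
    rw [regField_regAct hm μ h hk _ (hx.2.2.2 s hs)]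
    convert! hasDerivAt_regAct (hasDerivAt_const s k) hk (hc s hs) (hx.hasDerivAt hs) using 2
    refine Prod.ext rfl (Prod.ext rfl (Prod.ext ?_ ?_)) <;> funext j
    · simp
    · simp
      left
      ring
  have := IsRegSolution.eqOn hm hsol hy hs₀ (by simp only [hc0]; exact h0.symm) hs
  exact ⟨k, c s, hk, this.symm⟩

/-! ### A frame adapted to the quadric `z₁₂² + z₃₁² + z₂₃² = 0` -/

/-- The complex conjugate of a vector. -/
def conjVec (z : Fin 3 → ℂ) : Fin 3 → ℂ := fun j => conj (z j)

/-- The cross product `conj z × z`. -/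
def crossVec (z : Fin 3 → ℂ) : Fin 3 → ℂ :=
  ![conj (z 1) * z 2 - conj (z 2) * z 1, conj (z 2) * z 0 - conj (z 0) * z 2,
    conj (z 0) * z 1 - conj (z 1) * z 0]

theorem pairing_conjVec_left (z V : Fin 3 → ℂ) : pairing (conjVec z) V = ∑ j, z j * V j := by
  simp [pairing, conjVec]

theorem pairing_conjVec_self (z : Fin 3 → ℂ) : pairing (conjVec z) z = ∑ j, z j ^ 2 := by
  simp [pairing_conjVec_left, sq]

theorem pairing_crossVec_self (z : Fin 3 → ℂ) : pairing (crossVec z) z = 0 := by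
  simp [pairing, crossVec, Fin.sum_univ_three]
  ring

theorem pairing_self_crossVec (z : Fin 3 → ℂ) : pairing z (crossVec z) = 0 := by
  simp [pairing, crossVec, Fin.sum_univ_three]
  ring

theorem sum_conj_sq {z : Fin 3 → ℂ} (hz : ∑ j, z j ^ 2 = 0) :
    ∑ j, conj (z j) ^ 2 = 0 := by
  simpa using congrArg conj hz

/-- Lagrange's identity `‖conj z × z‖² = ‖z‖⁴ - |∑ z²|²`. -/
theorem pairing_crossVec_crossVec {z : Fin 3 → ℂ} (hz : ∑ j, z j ^ 2 = 0) :
    pairing (crossVec z) (crossVec z) = (normTwoSq z : ℂ) ^ 2 := by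
  have hz' := sum_conj_sq hz
  rw [← pairing_self]
  simp only [pairing, crossVec, Fin.sum_univ_three] at *
  simp
  linear_combination (-(z 0 ^ 2 + z 1 ^ 2 + z 2 ^ 2)) * hz'

/-- The condition on `V` is orthogonality to `conj z`. On the quadric `z` is orthogonal to `conj z`
as well, and `crossVec z` is orthogonal to both, so these two vectors form an orthogonal basis of
the solution plane. -/
theorem eq_span_of_sum_mul {z V : Fin 3 → ℂ} (hz0 : z ≠ 0) (hz : ∑ j, z j ^ 2 = 0)
    (hV : ∑ j, z j * V j = 0) :
    V = (pairing z V / normTwoSq z) • z + (pairing (crossVec z) V / normTwoSq z ^ 2) • crossVec z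
    := by
  have hN : (normTwoSq z : ℂ) ≠ 0 := by exact_mod_cast (normTwoSq_pos hz0).ne'
  have key : ∀ j, (normTwoSq z : ℂ) ^ 2 * V j = normTwoSq z * pairing z V * z j
      + pairing (crossVec z) V * crossVec z j := by
    intro j
    rw [← pairing_self]
    simp only [pairing, crossVec, Fin.sum_univ_three] at *
    fin_cases j <;> simp
    · linear_combination ((conj (z 0) ^ 2 + conj (z 1) ^ 2 + conj (z 2) ^ 2) * V 0
        - (V 0 * conj (z 0) + V 1 * conj (z 1) + V 2 * conj (z 2)) * conj (z 0)) * hz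
        + ((conj (z 0) * z 0 + conj (z 1) * z 1 + conj (z 2) * z 2) * conj (z 0)
        - (conj (z 0) ^ 2 + conj (z 1) ^ 2 + conj (z 2) ^ 2) * z 0) * hV
    · linear_combination ((conj (z 0) ^ 2 + conj (z 1) ^ 2 + conj (z 2) ^ 2) * V 1
        - (V 0 * conj (z 0) + V 1 * conj (z 1) + V 2 * conj (z 2)) * conj (z 1)) * hz
        + ((conj (z 0) * z 0 + conj (z 1) * z 1 + conj (z 2) * z 2) * conj (z 1)
        - (conj (z 0) ^ 2 + conj (z 1) ^ 2 + conj (z 2) ^ 2) * z 1) * hV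
    · linear_combination ((conj (z 0) ^ 2 + conj (z 1) ^ 2 + conj (z 2) ^ 2) * V 2
        - (V 0 * conj (z 0) + V 1 * conj (z 1) + V 2 * conj (z 2)) * conj (z 2)) * hz
        + ((conj (z 0) * z 0 + conj (z 1) * z 1 + conj (z 2) * z 2) * conj (z 2)
        - (conj (z 0) ^ 2 + conj (z 1) ^ 2 + conj (z 2) ^ 2) * z 2) * hV
  funext j
  simp only [Pi.add_apply, Pi.smul_apply, smul_eq_mul]
  field_simp
  linear_combination key j

theorem conjVec_ne_zero {z : Fin 3 → ℂ} (hz : z ≠ 0) : conjVec z ≠ 0 := fun h =>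
  hz (funext fun j => by simpa [conjVec] using congrFun h j)

theorem normTwoSq_conjVec (z : Fin 3 → ℂ) : normTwoSq (conjVec z) = normTwoSq z := by
  simp [normTwoSq, conjVec]

theorem crossVec_conjVec (z : Fin 3 → ℂ) : crossVec (conjVec z) = -crossVec z := by
  funext j
  fin_cases j <;> simp [crossVec, conjVec] <;> ring

/-- The conjugate of the preceding decomposition: `conj z` also lies on the quadric, and its cross
vector is the negative of that of `z`. -/
theorem eq_span_of_pairing {z η : Fin 3 → ℂ} (hz0 : z ≠ 0) (hz : ∑ j, z j ^ 2 = 0)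
    (hη : pairing η z = 0) :
    η = (pairing (conjVec z) η / normTwoSq z) • conjVec z
      + (pairing (crossVec z) η / normTwoSq z ^ 2) • crossVec z := by
  have h1 : ∑ j, conjVec z j * η j = 0 := by
    have : pairing z η = 0 := by rw [← conj_pairing, hη, map_zero]
    simpa [pairing, conjVec] using this
  have h2 := eq_span_of_sum_mul (conjVec_ne_zero hz0) (by simpa [conjVec] using sum_conj_sq hz) h1
  rw [normTwoSq_conjVec, crossVec_conjVec, pairing_neg_left] at h2
  convert h2 using 2
  simp [neg_div]

/-! ### The Hamiltonian and its `η`-derivative on the level set -/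

/-- The coefficient of the kinetic energy of the shape on the level set. -/
def shapeCoeff (m : Fin 3 → ℝ) (x : Reg) : ℝ :=
  (∑ i, m i) * massNormSq m (levi x.2.2.1) ^ 2
    / (8 * (m 0 * m 1 * m 2) * x.1 ^ 2 * normTwoSq x.2.2.1)

theorem shapeCoeff_pos {m : Fin 3 → ℝ} (hm : ∀ i, 0 < m i) {x : Reg} (hx : x ∈ RegDomain) :
    0 < shapeCoeff m x := by
  have h1 := massNormSq_levi_pos hm hx.2
  have h2 := normTwoSq_pos hx.2
  have h3 := hx.1
  have := sum_mass_pos hm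
  have := hm 0
  have := hm 1
  have := hm 2
  unfold shapeCoeff
  positivity

/-- The `π` are the components of `η × conj z`. The part along `conj z` drops out, and the double
cross product `(conj z × z) × conj z` equals `-‖z‖² conj z` when `∑ z² = 0`. -/
theorem pi_span {z : Fin 3 → ℂ} (hz : ∑ j, z j ^ 2 = 0) (a b : ℂ) :
    pi1 z (a • conjVec z + b • crossVec z) = -(b * normTwoSq z) * conj (z 2) ∧
    pi2 z (a • conjVec z + b • crossVec z) = -(b * normTwoSq z) * conj (z 1) ∧
    pi3 z (a • conjVec z + b • crossVec z) = -(b * normTwoSq z) * conj (z 0) := by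
  have hz' := sum_conj_sq hz
  rw [← pairing_self]
  simp only [pairing, Fin.sum_univ_three] at *
  refine ⟨?_, ?_, ?_⟩ <;>
    simp [pi1, pi2, pi3, conjVec, crossVec]
  · linear_combination (b * z 2) * hz'
  · linear_combination (b * z 1) * hz'
  · linear_combination (b * z 0) * hz'

/-- Each `|π|²` is `|b|² ‖z‖⁴` times the same `ρ` that multiplies it in the Hamiltonian. The
weighted sum of the `ρ²` is then a multiple of `|X|²`, which collapses the shape kinetic energy to
one square. -/
theorem regH_span {m : Fin 3 → ℝ} (hm : ∀ i, 0 < m i) (μ h r p : ℝ) {z : Fin 3 → ℂ}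
    (hz0 : z ≠ 0) (hz : ∑ j, z j ^ 2 = 0) (a b : ℂ) :
    regH m μ h (r, p, z, a • conjVec z + b • crossVec z)
      = tau z * p ^ 2 / 2 + tau z * μ ^ 2 / (2 * r ^ 2) + shapeCoeff m (r, p, z, 0) * ‖b‖ ^ 2
        - shapeW m z / r - h * tau z := by
  obtain ⟨h1, h2, h3⟩ := pi_span hz a b
  have hN := (normTwoSq_pos hz0).ne'
  have hm0 := (hm 0).ne'
  have hm1 := (hm 1).ne'
  have hm2 := (hm 2).ne'
  have hM := (sum_mass_pos hm).ne'
  simp only [regH, h1, h2, h3, shapeCoeff]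
  congr 3
  have e : massNormSq m (levi z) = (m 0 * m 1 * rho z 0 ^ 2 + m 2 * m 0 * rho z 1 ^ 2
      + m 1 * m 2 * rho z 2 ^ 2) / ∑ i, m i := by
    simp [massNormSq, levi, rho, Fin.sum_univ_three, pairMass]
  have e2 : ∀ j, ‖-(b * normTwoSq z) * conj (z j)‖ ^ 2 = ‖b‖ ^ 2 * normTwoSq z ^ 2 * rho z j := by
    intro j
    simp [rho, mul_pow, abs_of_nonneg (normTwoSq_nonneg z)]
  rw [e2, e2, e2, e]
  by_cases hr : r = 0
  · simp [hr]
  · field_simp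
    ring

/-- The velocity of `z` is the `η`-derivative of the Hamiltonian, and along `crossVec z` only `K
|b|²` varies. Its component along `z` is never needed, being an orbit direction. -/
theorem pairing_crossVec_regField {m : Fin 3 → ℝ} (hm : ∀ i, 0 < m i) (μ h : ℝ) {x : Reg}
    (hx : x ∈ RegLevel) : pairing (crossVec x.2.2.1) (regField m μ h x).2.2.1
      = (2 * shapeCoeff m x : ℝ) * (pairing (crossVec x.2.2.1) x.2.2.2 / normTwoSq x.2.2.1 ^ 2) := by
  have hη := eq_span_of_pairing hx.1.2 hx.2.2 hx.2.1
  obtain ⟨r, p, z, η⟩ := x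
  set a := pairing (conjVec z) η / normTwoSq z with ha
  set b := pairing (crossVec z) η / normTwoSq z ^ 2 with hb
  simp only at hη
  rw [← sub_eq_zero]
  refine eq_zero_of_re_mul fun c => ?_
  have h1 := canonForm_regField hm μ h hx.1 (0, 0, 0, conj c • crossVec z)
  -- A vertical curve along which `a` is fixed and `b` moves with velocity `conj c`.
  have hcurve : HasDerivAt (fun t : ℝ => ((r, p, z, a • conjVec z + (b + t * conj c) • crossVec z) : Reg))
      (0, 0, 0, conj c • crossVec z) 0 := by
    refine (hasDerivAt_const _ _).prodMk ((hasDerivAt_const _ _).prodMk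
      ((hasDerivAt_const _ _).prodMk (hasDerivAt_pi.2 fun j => ?_)))
    have := (((Complex.ofRealCLM.hasDerivAt (x := (0 : ℝ))).mul_const (conj c)).const_add b).mul_const
      (crossVec z j)
    simpa using this.const_add (a * conjVec z j)
  have hD : HasFDerivAt (regH m μ h) (fderiv ℝ (regH m μ h) (r, p, z, η))
      ((fun t : ℝ => ((r, p, z, a • conjVec z + (b + t * conj c) • crossVec z) : Reg)) 0) := by
    simp only [Complex.ofReal_zero, zero_mul, add_zero]
    rw [← hη]
    exact (differentiableAt_regH hm μ h hx.1).hasFDerivAt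
  have h2 := hD.comp_hasDerivAt (0 : ℝ) hcurve
  have h3 : HasDerivAt (fun t : ℝ => ‖b + t * conj c‖ ^ 2) (2 * (b * c).re) 0 := by
    have := (((Complex.ofRealCLM.hasDerivAt (x := (0 : ℝ))).mul_const (conj c)).const_add b).norm_sq
    convert! this using 1
    simp [Complex.inner]
    ring
  have h4 : HasDerivAt (fun t : ℝ => regH m μ h (r, p, z, a • conjVec z +
      (b + t * conj c) • crossVec z)) (shapeCoeff m (r, p, z, 0) * (2 * (b * c).re)) 0 := by
    simp only [regH_span hm μ h r p hx.1.2 hx.2.2]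
    exact (((h3.const_mul _).const_add _).sub_const _).sub_const _
  have h5 := h2.unique h4
  rw [h5] at h1
  simp only [canonForm, pairing_zero_right, pairing_smul_left, Complex.conj_conj] at h1
  simp only [mul_sub, Complex.sub_re]
  have e : shapeCoeff m (r, p, z, η) = shapeCoeff m (r, p, z, 0) := rfl
  rw [e, mul_left_comm, Complex.re_ofReal_mul, mul_comm c b]
  simp at h1
  simp only [Complex.mul_re]
  linarith

/-- On the level set the equations are Hamiltonian for the regularized form. -/
theorem regForm_regField {m : Fin 3 → ℝ} (hm : ∀ i, 0 < m i) (μ h : ℝ) {x : Reg}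
    (hx : x ∈ RegLevel) : ∃ c : ℂ, ∀ v, regForm m μ x (regField m μ h x) v
      - (pairing (c • conjVec x.2.2.1) v.2.2.1).re = fderiv ℝ (regH m μ h) x v := by
  have hη := eq_span_of_pairing hx.1.2 hx.2.2 hx.2.1
  have hF := eq_span_of_sum_mul hx.1.2 hx.2.2 (sum_z_mul_regField hm μ h hx.1)
  rw [pairing_crossVec_regField hm μ h hx] at hF
  have hcf := canonForm_regField hm μ h hx.1
  have hNpos := normTwoSq_pos hx.1.2
  have hN : (normTwoSq x.2.2.1 : ℂ) ≠ 0 := by exact_mod_cast hNpos.ne'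
  have hr := hx.1.1.ne'
  have hn := (massNormSq_levi_pos hm hx.1.2).ne'
  set a := pairing (conjVec x.2.2.1) x.2.2.2 / normTwoSq x.2.2.1 with ha
  set b := pairing (crossVec x.2.2.1) x.2.2.2 / normTwoSq x.2.2.1 ^ 2 with hb
  set a' := pairing x.2.2.1 (regField m μ h x).2.2.1 / normTwoSq x.2.2.1 with ha'
  set K := shapeCoeff m x with hK
  set N := normTwoSq x.2.2.1 with hNdef
  -- The part of the curvature term along `conj z`. It annihilates tangent vectors of the quadric
  -- and cannot come from the Fubini-Study form.
  refine ⟨(magCoeff μ x * Complex.I) * a, fun v => ?_⟩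
  rw [regForm_eq, hcf]
  have hFS : fubiniStudy x.2.2.1 (regField m μ h x).2.2.1 v.2.2.1
      = 2 * K / N ^ 3 * (conj b * pairing (crossVec x.2.2.1) v.2.2.1).im := by
    rw [hF]
    simp only [fubiniStudy, pairing_add_left, pairing_smul_left, pairing_crossVec_self,
      pairing_self, ← hNdef]
    rw [← Complex.im_ofReal_mul]
    congr 1
    simp
    field_simp
    rw [map_ofNat]
    ring
  -- The identity that matches the conformal factor with the coefficient `2μτ/r²`: the masses and
  -- `|X|⁴` cancel between `λ` and `K`.
  have hlam : lam m x.2.2.1 * (2 * K / N ^ 3) = tau x.2.2.1 / x.1 ^ 2 := by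
    have hm0 := (hm 0).ne'
    have hm1 := (hm 1).ne'
    have hm2 := (hm 2).ne'
    have hM := (sum_mass_pos hm).ne'
    rw [hK]
    simp only [lam, tau, shapeCoeff, ← hNdef]
    field_simp
    ring
  rw [hFS, show ∀ y, 2 * μ * lam m x.2.2.1 * (2 * K / N ^ 3 * y) = 2 * μ * y * (lam m x.2.2.1 *
    (2 * K / N ^ 3)) from fun y => by ring, hlam]
  conv_lhs => enter [1, 1, 2, 2, 1]; rw [hη]
  simp only [pairing_add_left, pairing_smul_left, smul_add, map_mul, Complex.conj_ofReal,
    Complex.conj_I, magCoeff, mul_assoc, Complex.re_ofReal_mul, Complex.add_re]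
  simp only [← mul_assoc]
  simp
  ring

theorem regForm_translation (m : Fin 3 → ℝ) (μ : ℝ) (x u v : Reg) (η : Fin 3 → ℂ) :
    regForm m μ x (u + (0, 0, 0, η)) v = regForm m μ x u v - (pairing η v.2.2.1).re := by
  simp only [regForm, Prod.fst_add, Prod.snd_add, add_zero, pairing_add_left, Complex.add_re]
  ring

theorem regForm_regField_tangent {m : Fin 3 → ℝ} (hm : ∀ i, 0 < m i) (μ h : ℝ) {x : Reg}
    (hx : x ∈ RegLevel) {v : Reg} (hv : v ∈ RegTangent x) :
    regForm m μ x (regField m μ h x) v = fderiv ℝ (regH m μ h) x v := by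
  obtain ⟨c, hc⟩ := regForm_regField hm μ h hx
  rw [← hc v, pairing_smul_left, pairing_conjVec_left, hv.2]
  simp

/-! ### The kernel of the form -/

/-- Vertical test vectors force the `z`-part of `u` to be `κ z`, on which the Fubini-Study form
vanishes. The remaining tests say that `conj κ η + u_η` annihilates all `V` with `∑ z V = 0`, hence
is a multiple of `conj z`. -/
theorem regForm_kernel (m : Fin 3 → ℝ) (μ : ℝ) {x : Reg} (hx : x ∈ RegLevel) (u : Reg) :
    (u ∈ RegTangent x ∧ ∀ v ∈ RegTangent x, regForm m μ x u v = 0) ↔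
      ∃ κ c : ℂ, u = (0, 0, fun j => κ * x.2.2.1 j,
        fun j => -conj κ * x.2.2.2 j + c * conj (x.2.2.1 j)) := by
  have hN : (normTwoSq x.2.2.1 : ℂ) ≠ 0 := by exact_mod_cast (normTwoSq_pos hx.1.2).ne'
  have hFS : ∀ (κ : ℂ) V, fubiniStudy x.2.2.1 (κ • x.2.2.1) V = 0 := by
    intro κ V
    simp only [fubiniStudy, pairing_smul_left]
    rw [show conj κ * pairing x.2.2.1 V * pairing x.2.2.1 x.2.2.1
      - conj κ * pairing x.2.2.1 x.2.2.1 * pairing x.2.2.1 V = 0 by ring]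
    simp
  have horb : ∀ κ c : ℂ, ((0, 0, fun j => κ * x.2.2.1 j,
        fun j => -conj κ * x.2.2.2 j + c * conj (x.2.2.1 j)) : Reg)
      = (0, 0, κ • x.2.2.1, -(conj κ • x.2.2.2) + c • conjVec x.2.2.1) := by
    intro κ c
    refine Prod.ext rfl (Prod.ext rfl (Prod.ext rfl ?_))
    funext j
    simp [conjVec]
  simp only [horb]
  constructor
  · rintro ⟨hu, huv⟩
    obtain ⟨u1, u2, uz, uη⟩ := u
    obtain ⟨r, p, z, η⟩ := x
    simp only at hN hFS hu huv ⊢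
    have e1 : u1 = 0 := by
      have := huv (0, 1, 0, 0) ⟨by simp, by simp⟩
      simpa [regForm, fubiniStudy] using this
    have e2 : u2 = 0 := by
      have := huv (1, 0, 0, 0) ⟨by simp, by simp⟩
      simpa [regForm, fubiniStudy] using this
    subst e1 e2
    -- testing with vertical vectors, `uz` is a multiple of `z`
    set κ := pairing z uz / normTwoSq z with hκ
    have hperp : pairing (uz - κ • z) z = 0 := by
      rw [← conj_pairing, pairing_sub_right, pairing_smul_right, pairing_self, hκ]
      field_simp
      simp
    have e3 : uz = κ • z := by
      have := huv (0, 0, 0, uz - κ • z) ⟨by simpa using hperp, by simp⟩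
      have h0 : pairing (uz - κ • z) uz = pairing (uz - κ • z) (uz - κ • z) := by
        rw [pairing_sub_right (uz - κ • z) uz, pairing_smul_right, hperp, mul_zero, sub_zero]
      simp only [regForm, h0, pairing_self, pairing_zero_right, fubiniStudy] at this
      by_contra hne
      have hpos := normTwoSq_pos (sub_ne_zero.2 hne)
      simp at this
      exact hpos.ne' this
    rw [e3] at huv hu ⊢
    -- testing with all tangent vectors
    set ζ := conj κ • η + uη with hζ
    have hζz : ∀ V : Fin 3 → ℂ, ∑ j, z j * V j = 0 → (pairing ζ V).re = 0 := by
      intro V hV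
      -- Chosen so that `V`, completed by the covector `b z`, preserves `⟨η, z⟩ = 0` to first order.
      set b : ℂ := -conj (pairing η V) / normTwoSq z with hb
      have hbz : pairing (b • z) z = -pairing η V := by
        rw [pairing_smul_left, pairing_self, hb]
        simp
        field_simp
      have := huv (0, 0, V, b • z) ⟨by simp only [hbz]; ring, hV⟩
      simp only [regForm, hFS, mul_zero, sub_zero, pairing_smul_right, hbz] at this
      rw [hζ, pairing_add_left, pairing_smul_left, Complex.conj_conj]
      simp at this ⊢
      linarith
    have hc : ζ = (pairing (conjVec z) ζ / normTwoSq z) • conjVec z := by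
      set c := pairing (conjVec z) ζ / normTwoSq z with hc
      -- The component of `ζ` orthogonal to `conj z` is itself an admissible test vector, so its
      -- norm vanishes.
      set D := ζ - c • conjVec z with hD
      have h1 : pairing (conjVec z) D = 0 := by
        rw [hD, pairing_sub_right, pairing_smul_right, pairing_self, normTwoSq_conjVec, hc]
        field_simp
        simp
      have h2 := hζz D (by rw [← pairing_conjVec_left, h1])
      have h3 : pairing ζ D = pairing D D := by
        have : ζ = D + c • conjVec z := by rw [hD]; abel
        conv_lhs => rw [this]
        rw [pairing_add_left, pairing_smul_left, h1, mul_zero, add_zero]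
      rw [h3, pairing_self, Complex.ofReal_re] at h2
      by_contra hne
      exact (normTwoSq_pos (sub_ne_zero.2 hne)).ne' h2
    refine ⟨κ, pairing (conjVec z) ζ / normTwoSq z, ?_⟩
    rw [← hc, hζ]
    simp
  · rintro ⟨κ, c, rfl⟩
    have hT : ∀ v ∈ RegTangent x, pairing (-(conj κ • x.2.2.2) + c • conjVec x.2.2.1) v.2.2.1
        = -κ * pairing x.2.2.2 v.2.2.1 := by
      intro v hv
      rw [pairing_add_left, pairing_neg_left, pairing_smul_left, pairing_smul_left,
        pairing_conjVec_left, hv.2]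
      simp
    refine ⟨⟨?_, ?_⟩, fun v hv => ?_⟩
    · simp only
      rw [pairing_add_left, pairing_neg_left, pairing_smul_left, pairing_smul_left,
        pairing_conjVec_self, hx.2.2, pairing_smul_right, hx.2.1]
      simp
    · have := hx.2.2
      simp only [Pi.smul_apply, smul_eq_mul, Fin.sum_univ_three] at *
      linear_combination κ * this
    · have h1 := eq_neg_of_add_eq_zero_left hv.1
      simp only [regForm, hFS, hT v hv, pairing_smul_right, h1]
      simp

end PlanarThreeBody
end

noncomputable section
namespace PlanarThreeBody

/-! ### Closedness of the form on the level set -/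

/-- The curvature form `λ Ω_FS`. -/
def curvForm (m : Fin 3 → ℝ) (z u v : Fin 3 → ℂ) : ℝ := lam m z * fubiniStudy z u v

section curvForm

variable (m : Fin 3 → ℝ) (z u u' v w : Fin 3 → ℂ)

theorem fubiniStudy_add_left :
    fubiniStudy z (u + u') v = fubiniStudy z u v + fubiniStudy z u' v := by
  simp only [fubiniStudy, pairing_add_left, ← Complex.add_im]
  congr 1
  ring

theorem fubiniStudy_smul_left (a : ℝ) : fubiniStudy z (a • u) v = a * fubiniStudy z u v := by
  simp only [fubiniStudy, pairing_real_smul_left, ← Complex.im_ofReal_mul]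
  congr 1
  ring

theorem fubiniStudy_antisymm : fubiniStudy z u v = -fubiniStudy z v u := by
  rw [fubiniStudy, fubiniStudy, ← Complex.conj_im]
  simp only [map_div₀, map_sub, map_mul, map_pow, conj_pairing]
  congr 3
  ring

theorem curvForm_add_left : curvForm m z (u + u') v = curvForm m z u v + curvForm m z u' v := by
  simp only [curvForm, fubiniStudy_add_left, mul_add]

theorem curvForm_smul_left (a : ℝ) : curvForm m z (a • u) v = a * curvForm m z u v := by
  simp only [curvForm, fubiniStudy_smul_left]
  ring

theorem curvForm_antisymm : curvForm m z u v = -curvForm m z v u := by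
  rw [curvForm, curvForm, fubiniStudy_antisymm, mul_neg]

theorem curvForm_add_right : curvForm m z v (u + u') = curvForm m z v u + curvForm m z v u' := by
  rw [curvForm_antisymm, curvForm_add_left, curvForm_antisymm, curvForm_antisymm m z u']
  ring

theorem curvForm_smul_right (a : ℝ) : curvForm m z v (a • u) = a * curvForm m z v u := by
  rw [curvForm_antisymm, curvForm_smul_left, curvForm_antisymm]
  ring

theorem curvForm_self_right (κ : ℂ) : curvForm m z w (κ • z) = 0 := by
  simp only [curvForm, fubiniStudy, pairing_smul_right]
  rw [show κ * pairing w z * pairing z z - pairing w z * (κ * pairing z z) = 0 by ring]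
  simp

/-- The form is the imaginary part of a sesquilinear one, and `κ + conj κ` is real. -/
theorem curvForm_smul_add (κ : ℂ) : curvForm m z (κ • v) w + curvForm m z v (κ • w)
    = 2 * κ.re * curvForm m z v w := by
  simp only [curvForm, fubiniStudy, pairing_smul_left, pairing_smul_right]
  rw [← mul_add, ← Complex.add_im]
  have e : ((conj κ * pairing v w * pairing z z - conj κ * pairing v z * pairing z w)
      / pairing z z ^ 2 + (κ * pairing v w * pairing z z - pairing v z * (κ * pairing z w))
      / pairing z z ^ 2).im = 2 * κ.re *
      ((pairing v w * pairing z z - pairing v z * pairing z w) / pairing z z ^ 2).im := by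
    rw [← Complex.im_ofReal_mul, ← Complex.add_conj]
    congr 1
    ring
  rw [e]
  ring

/-- The form is invariant under pull-back by `z ↦ k z`; when the vectors are held fixed, this
invariance leaves the factor `|k|⁻²`. -/
theorem curvForm_scale {k : ℂ} (hk : k ≠ 0) :
    curvForm m (k • z) v w = ‖k‖⁻¹ ^ 2 * curvForm m z v w := by
  have h1 := lam_smul m hk z
  have h2 := fubiniStudy_smul hk z (k⁻¹ • v) (k⁻¹ • w)
  have e : ∀ v : Fin 3 → ℂ, (fun j => k * (k⁻¹ • v) j) = v := fun v => by
    funext j; simp [hk]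
  rw [e, e] at h2
  have e2 : k • z = fun j => k * z j := rfl
  rw [curvForm, e2, h1, h2, curvForm]
  simp only [fubiniStudy, pairing_smul_left, pairing_smul_right]
  have e3 : ((‖k‖⁻¹ ^ 2 : ℝ) : ℂ) = conj k⁻¹ * k⁻¹ := by
    rw [Complex.conj_mul', norm_inv]
    push_cast
    rfl
  rw [mul_left_comm (‖k‖⁻¹ ^ 2), ← Complex.im_ofReal_mul (‖k‖⁻¹ ^ 2), e3]
  congr 2
  ring

variable {m z}

theorem contDiffAt_curvForm (hm : ∀ i, 0 < m i) (hz : z ≠ 0) :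
    ContDiffAt ℝ ∞ (fun z => curvForm m z v w) z :=
  (contDiffAt_lam hm hz).mul (contDiffAt_fubiniStudy v w hz)

theorem differentiableAt_curvForm (hm : ∀ i, 0 < m i) (hz : z ≠ 0) :
    DifferentiableAt ℝ (fun z => curvForm m z v w) z :=
  (contDiffAt_curvForm v w hm hz).differentiableAt (by simp)

theorem fderiv_curvForm_radial (hm : ∀ i, 0 < m i) (hz : z ≠ 0) (κ : ℂ) :
    fderiv ℝ (fun z => curvForm m z v w) z (κ • z) = -(2 * κ.re * curvForm m z v w) := by
  have hc : HasDerivAt (fun t : ℝ => Complex.exp (t * κ) • z) (κ • z) 0 :=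
    (hasDerivAt_cexp_smul κ).smul_const z
  have h0 : (fun t : ℝ => Complex.exp (t * κ) • z) 0 = z := by simp
  have hd : HasFDerivAt (fun z => curvForm m z v w) (fderiv ℝ (fun z => curvForm m z v w) z)
      ((fun t : ℝ => Complex.exp (t * κ) • z) 0) := by
    rw [h0]
    exact (differentiableAt_curvForm v w hm hz).hasFDerivAt
  have h1 := hd.comp_hasDerivAt (0 : ℝ) hc
  have e : (fun z => curvForm m z v w) ∘ (fun t : ℝ => Complex.exp (t * κ) • z)
      = fun t => Real.exp (-(2 * κ.re) * t) * curvForm m z v w := by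
    funext t
    simp only [Function.comp]
    rw [curvForm_scale m z v w (Complex.exp_ne_zero _), Complex.norm_exp, ← Real.exp_neg,
      ← Real.exp_nat_mul]
    congr 2
    simp
    ring
  rw [e] at h1
  have h2 := (((hasDerivAt_id (0 : ℝ)).const_mul (-(2 * κ.re))).exp).mul_const (curvForm m z v w)
  rw [h1.unique h2]
  simp

/-- The value on `κ y` at the point `y` vanishes for every `y`; differentiate this along `y = z + t
u`. -/
theorem fderiv_curvForm_self_right (hm : ∀ i, 0 < m i) (hz : z ≠ 0) (κ : ℂ) :
    fderiv ℝ (fun y => curvForm m y w (κ • z)) z u = -curvForm m z w (κ • u) := by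
  have hc : HasDerivAt (fun t : ℝ => z + t • u) u 0 := by
    simpa using ((hasDerivAt_id (0 : ℝ)).smul_const u).const_add z
  have h0 : z + (0 : ℝ) • u = z := by simp
  have hd : ∀ a, HasDerivAt (fun t : ℝ => curvForm m (z + t • u) w a)
      (fderiv ℝ (fun y => curvForm m y w a) z u) 0 := by
    intro a
    have : HasFDerivAt (fun y => curvForm m y w a) (fderiv ℝ (fun y => curvForm m y w a) z)
        (z + (0 : ℝ) • u) := by
      rw [h0]
      exact (differentiableAt_curvForm w a hm hz).hasFDerivAt
    exact this.comp_hasDerivAt (0 : ℝ) hc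
  have h1 := (hd (κ • z)).add ((hasDerivAt_id (0 : ℝ)).mul (hd (κ • u)))
  have e : (fun t : ℝ => curvForm m (z + t • u) w (κ • z)) + (id * fun t : ℝ =>
      curvForm m (z + t • u) w (κ • u)) = fun _ => 0 := by
    funext t
    have := curvForm_self_right m (z + t • u) w κ
    rw [smul_add, curvForm_add_right, smul_comm κ t u, curvForm_smul_right] at this
    exact this
  rw [e] at h1
  have := h1.unique (hasDerivAt_const (0 : ℝ) (0 : ℝ))
  simp only [h0, id] at this
  linarith

variable (m z) in
/-- The exterior derivative of the curvature form on constant vectors. -/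
def curvDeriv : ℝ :=
  fderiv ℝ (fun y => curvForm m y v w) z u + fderiv ℝ (fun y => curvForm m y w u) z v
    + fderiv ℝ (fun y => curvForm m y u v) z w

theorem curvDeriv_cycl : curvDeriv m z u v w = curvDeriv m z v w u := by
  simp only [curvDeriv]
  ring

theorem curvDeriv_add (hm : ∀ i, 0 < m i) (hz : z ≠ 0) :
    curvDeriv m z (u + u') v w = curvDeriv m z u v w + curvDeriv m z u' v w := by
  have e1 : (fun y => curvForm m y w (u + u'))
      = fun y => curvForm m y w u + curvForm m y w u' := by
    funext y; rw [curvForm_add_right]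
  have e2 : (fun y => curvForm m y (u + u') v)
      = fun y => curvForm m y u v + curvForm m y u' v := by
    funext y; rw [curvForm_add_left]
  simp only [curvDeriv]
  rw [e1, e2, fderiv_fun_add (differentiableAt_curvForm _ _ hm hz)
    (differentiableAt_curvForm _ _ hm hz), fderiv_fun_add (differentiableAt_curvForm _ _ hm hz)
    (differentiableAt_curvForm _ _ hm hz), map_add]
  simp only [add_apply]
  ring

theorem curvDeriv_smul (hm : ∀ i, 0 < m i) (hz : z ≠ 0) (a : ℝ) :
    curvDeriv m z (a • u) v w = a * curvDeriv m z u v w := by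
  have e1 : (fun y => curvForm m y w (a • u)) = fun y => a * curvForm m y w u := by
    funext y; rw [curvForm_smul_right]
  have e2 : (fun y => curvForm m y (a • u) v) = fun y => a * curvForm m y u v := by
    funext y; rw [curvForm_smul_left]
  simp only [curvDeriv]
  rw [e1, e2, fderiv_const_mul (differentiableAt_curvForm _ _ hm hz),
    fderiv_const_mul (differentiableAt_curvForm _ _ hm hz), map_smul]
  simp only [smul_apply, smul_eq_mul]
  ring

theorem curvDeriv_self : curvDeriv m z u u w = 0 := by
  have e1 : (fun y => curvForm m y w u) = fun y => -curvForm m y u w := by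
    funext y; rw [curvForm_antisymm]
  have e2 : (fun y => curvForm m y u u) = fun _ => 0 := by
    funext y; linarith [curvForm_antisymm m y u u]
  simp only [curvDeriv]
  rw [e1, e2, fderiv_fun_neg]
  simp

/-- Cartan's formula for the scaling field: both the Lie derivative and the contraction of the
curvature form vanish, hence so does the contraction of its exterior derivative. -/
theorem curvDeriv_radial (hm : ∀ i, 0 < m i) (hz : z ≠ 0) (κ : ℂ) :
    curvDeriv m z (κ • z) v w = 0 := by
  have e1 : (fun y => curvForm m y (κ • z) v) = fun y => -curvForm m y v (κ • z) := by
    funext y; rw [curvForm_antisymm]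
  have h1 := curvForm_smul_add m z v w κ
  have h2 := curvForm_antisymm m z (κ • v) w
  simp only [curvDeriv]
  rw [e1, fderiv_fun_neg, neg_apply, fderiv_curvForm_radial v w hm hz,
    fderiv_curvForm_self_right v w hm hz, fderiv_curvForm_self_right w v hm hz]
  linarith

/-- Modulo the radial line, tangent vectors of the quadric form one complex line. An alternating
three-form on a real plane is zero. -/
theorem curvDeriv_eq_zero (hm : ∀ i, 0 < m i) (hz0 : z ≠ 0) (hz : ∑ j, z j ^ 2 = 0)
    (hu : ∑ j, z j * u j = 0) (hv : ∑ j, z j * v j = 0) (hw : ∑ j, z j * w j = 0) :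
    curvDeriv m z u v w = 0 := by
  -- The first slot reduces to the real basis `n`, `i n` of that line; cyclic symmetry then treats
  -- the other slots.
  have red : ∀ u v w : Fin 3 → ℂ, ∑ j, z j * u j = 0 → ∃ a b : ℝ, curvDeriv m z u v w
      = a * curvDeriv m z (crossVec z) v w + b * curvDeriv m z (Complex.I • crossVec z) v w := by
    intro u v w hu
    have h1 := eq_span_of_sum_mul hz0 hz hu
    set g := pairing (crossVec z) u / normTwoSq z ^ 2
    refine ⟨g.re, g.im, ?_⟩
    have h2 : g • crossVec z = g.re • crossVec z + g.im • Complex.I • crossVec z := by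
      funext j
      simp only [Pi.add_apply, Pi.smul_apply, smul_eq_mul, Complex.real_smul]
      conv_lhs => rw [← Complex.re_add_im g]
      ring
    rw [h1, curvDeriv_add _ _ _ _ hm hz0, curvDeriv_radial _ _ hm hz0, zero_add, h2,
      curvDeriv_add _ _ _ _ hm hz0, curvDeriv_smul _ _ _ hm hz0, curvDeriv_smul _ _ _ hm hz0]
  have s2 : ∀ a b : Fin 3 → ℂ, curvDeriv m z a b a = 0 := fun a b => by
    rw [curvDeriv_cycl, curvDeriv_cycl, curvDeriv_self]
  have z1 : curvDeriv m z (Complex.I • crossVec z) w (crossVec z) = 0 := by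
    obtain ⟨a, b, h⟩ := red w (crossVec z) (Complex.I • crossVec z) hw
    rw [curvDeriv_cycl, h, curvDeriv_self, s2]
    ring
  have z2 : curvDeriv m z (crossVec z) w (Complex.I • crossVec z) = 0 := by
    obtain ⟨a, b, h⟩ := red w (Complex.I • crossVec z) (crossVec z) hw
    rw [curvDeriv_cycl, h, curvDeriv_self, s2]
    ring
  have z3 : curvDeriv m z (crossVec z) v w = 0 := by
    obtain ⟨a, b, h⟩ := red v w (crossVec z) hv
    rw [curvDeriv_cycl, h, s2, z1]
    ring
  have z4 : curvDeriv m z (Complex.I • crossVec z) v w = 0 := by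
    obtain ⟨a, b, h⟩ := red v w (Complex.I • crossVec z) hv
    rw [curvDeriv_cycl, h, s2, z2]
    ring
  obtain ⟨a, b, h⟩ := red u v w hu
  rw [h, z3, z4]
  ring

end curvForm

/-- The canonical part has constant coefficients, so only the curvature form contributes.
Restriction commutes with the exterior derivative, which is why the ambient derivative on tangent
vectors is the relevant one. -/
theorem extDerivTwo_regForm {m : Fin 3 → ℝ} (hm : ∀ i, 0 < m i) (μ : ℝ) {x : Reg}
    (hx : x ∈ RegLevel) {u v w : Reg} (hu : u ∈ RegTangent x) (hv : v ∈ RegTangent x)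
    (hw : w ∈ RegTangent x) : extDerivTwo (regForm m μ) x u v w = 0 := by
  have h1 : ∀ u v w : Reg, fderiv ℝ (fun y => regForm m μ y v w) x u
      = -(2 * μ) * fderiv ℝ (fun z => curvForm m z v.2.2.1 w.2.2.1) x.2.2.1 u.2.2.1 := by
    intro u v w
    have hz : HasFDerivAt (fun y : Reg => y.2.2.1)
        (((ContinuousLinearMap.fst ℝ (Fin 3 → ℂ) (Fin 3 → ℂ)).comp
          (ContinuousLinearMap.snd ℝ ℝ ((Fin 3 → ℂ) × (Fin 3 → ℂ)))).comp
          (ContinuousLinearMap.snd ℝ ℝ (ℝ × (Fin 3 → ℂ) × (Fin 3 → ℂ)))) x :=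
      ContinuousLinearMap.hasFDerivAt (((ContinuousLinearMap.fst ℝ (Fin 3 → ℂ) (Fin 3 → ℂ)).comp
          (ContinuousLinearMap.snd ℝ ℝ ((Fin 3 → ℂ) × (Fin 3 → ℂ)))).comp
          (ContinuousLinearMap.snd ℝ ℝ (ℝ × (Fin 3 → ℂ) × (Fin 3 → ℂ))))
    have hd := HasFDerivAt.comp (g := fun z => curvForm m z v.2.2.1 w.2.2.1) x
      (differentiableAt_curvForm v.2.2.1 w.2.2.1 hm hx.1.2).hasFDerivAt hz
    have h2 := (hd.const_mul (-(2 * μ))).const_add (canonForm v w)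
    have e : (fun y => regForm m μ y v w) = fun y : Reg => canonForm v w + -(2 * μ) *
        ((fun z => curvForm m z v.2.2.1 w.2.2.1) ∘ fun y : Reg => y.2.2.1) y := by
      funext y
      simp only [regForm_eq, curvForm, Function.comp]
      ring
    rw [e, h2.fderiv]
    simp
  have h3 := curvDeriv_eq_zero u.2.2.1 v.2.2.1 w.2.2.1 hm hx.1.2 hx.2.2 hu.2 hv.2 hw.2
  simp only [extDerivTwo, h1]
  simp only [curvDeriv] at h3
  linear_combination -(2 * μ) * h3

/-! ### Transversality to the collision set -/

/-- With `z j = 0` the other two coordinates satisfy `a² + b² = 0`, so both are nonzero and `a = ± i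
b`. Then `conj a * b` is not real, and the `j`-th component of `conj z × z` is nonzero. -/
theorem collision_frame {z : Fin 3 → ℂ} (hz0 : z ≠ 0) (hz : ∑ j, z j ^ 2 = 0) {j : Fin 3}
    (hj : z j = 0) : (∀ i, i ≠ j → z i ≠ 0) ∧ crossVec z j ≠ 0 := by
  have hN : (normTwoSq z : ℂ) ^ 2 ≠ 0 := by
    exact_mod_cast pow_ne_zero 2 (normTwoSq_pos hz0).ne'
  have hne : ∀ i, i ≠ j → z i ≠ 0 := by
    intro i hij hi
    refine hz0 ?_
    rw [Fin.sum_univ_three] at hz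
    funext k
    fin_cases i <;> fin_cases j <;> fin_cases k <;> simp_all
  refine ⟨hne, fun hn => hN ?_⟩
  rw [← pairing_crossVec_crossVec hz]
  have key : ∀ a b : ℂ, a ^ 2 + b ^ 2 = 0 → conj a * b - conj b * a = 0 → a = 0 := by
    intro a b h1 h2
    have h3 : (‖a‖ ^ 2 : ℂ) * b ^ 2 = (‖b‖ ^ 2 : ℂ) * a ^ 2 := by
      rw [← Complex.conj_mul', ← Complex.conj_mul']
      linear_combination a * b * h2
    have h4 : ‖a‖ ^ 2 = ‖b‖ ^ 2 := by
      have : a ^ 2 = -b ^ 2 := by linear_combination h1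
      have := congrArg norm this
      simpa using this
    by_contra ha
    have hb : (‖b‖ ^ 2 : ℂ) = (‖a‖ ^ 2 : ℂ) := by exact_mod_cast h4.symm
    have hna : (‖a‖ ^ 2 : ℂ) ≠ 0 := by
      exact_mod_cast pow_ne_zero 2 (norm_ne_zero_iff.2 ha)
    rw [hb] at h3
    have h5 := mul_left_cancel₀ hna h3
    rw [h5] at h1
    apply ha
    have : a ^ 2 = 0 := by linear_combination h1 / 2
    simpa using this
  exfalso
  rw [Fin.sum_univ_three] at hz
  fin_cases j
  · simp only [Fin.zero_eta] at hj hn hne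
    exact hne 1 (by decide) (key (z 1) (z 2) (by rw [hj] at hz; linear_combination hz)
      (by simpa [crossVec] using hn))
  · simp only [Fin.mk_one] at hj hn hne
    exact hne 2 (by decide) (key (z 2) (z 0) (by rw [hj] at hz; linear_combination hz)
      (by simpa [crossVec] using hn))
  · simp only [Fin.reduceFinMk] at hj hn hne
    exact hne 0 (by decide) (key (z 0) (z 1) (by rw [hj] at hz; linear_combination hz)
      (by simpa [crossVec] using hn))

theorem tau_eq_zero_iff {z : Fin 3 → ℂ} (hz : z ≠ 0) : tau z = 0 ↔ ∃ j, z j = 0 := by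
  have hN := (normTwoSq_pos hz).ne'
  simp [tau, rho, Fin.exists_fin_succ, hN, or_assoc]

theorem tau_nonneg (z : Fin 3 → ℂ) : 0 ≤ tau z := by
  have := normTwoSq_nonneg z
  unfold tau rho
  positivity

theorem tau_pos {z : Fin 3 → ℂ} (hz : ∀ j, z j ≠ 0) : 0 < tau z := by
  have h0 : z ≠ 0 := fun h => hz 0 (by simp [h])
  refine lt_of_le_of_ne (tau_nonneg z) fun h => ?_
  obtain ⟨j, hj⟩ := (tau_eq_zero_iff h0).1 h.symm
  exact hz j hj

/-- On the quadric at most one coordinate vanishes, so one of the three products of the `ρ`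
survives. -/
theorem shapeW_pos {m : Fin 3 → ℝ} (hm : ∀ i, 0 < m i) {z : Fin 3 → ℂ} (hz0 : z ≠ 0)
    (hz : ∑ j, z j ^ 2 = 0) : 0 < shapeW m z := by
  have hn := Real.sqrt_pos.2 (massNormSq_levi_pos hm hz0)
  have hN := normTwoSq_pos hz0
  have hm0 := hm 0
  have hm1 := hm 1
  have hm2 := hm 2
  have hρ : ∀ j, 0 ≤ rho z j := fun j => by unfold rho; positivity
  have hρ' : ∀ j, z j ≠ 0 → 0 < rho z j := fun j hj => by
    have := norm_pos_iff.2 hj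
    unfold rho; positivity
  have h0 := hρ 0
  have h1 := hρ 1
  have h2 := hρ 2
  refine mul_pos (by positivity) ?_
  by_cases hz0' : z 0 = 0
  · have := (collision_frame hz0 hz hz0').1
    have h1 := hρ' 1 (this 1 (by decide))
    have h2 := hρ' 2 (this 2 (by decide))
    positivity
  · have h0 := hρ' 0 hz0'
    by_cases hz1 : z 1 = 0
    · have := (collision_frame hz0 hz hz1).1
      have h2 := hρ' 2 (this 2 (by decide))
      positivity
    · have h1 := hρ' 1 hz1
      positivity

/-- At a collision `τ = 0`, so zero energy reads `K |b|² = W / r > 0` and `b ≠ 0`. The velocity of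
`z j` is then a nonzero multiple of `b` times the `j`-th component of `crossVec z`. -/
theorem regField_transversal {m : Fin 3 → ℝ} (hm : ∀ i, 0 < m i) (μ h : ℝ) {x : Reg}
    (hx : x ∈ RegLevel) (hH : regH m μ h x = 0) {j : Fin 3} (hj : x.2.2.1 j = 0) :
    (regField m μ h x).2.2.1 j ≠ 0 := by
  have hF := eq_span_of_sum_mul hx.1.2 hx.2.2 (sum_z_mul_regField hm μ h hx.1)
  rw [pairing_crossVec_regField hm μ h hx] at hF
  have hη := eq_span_of_pairing hx.1.2 hx.2.2 hx.2.1
  have hK := shapeCoeff_pos hm hx.1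
  have hN : (normTwoSq x.2.2.1 : ℂ) ≠ 0 := by exact_mod_cast (normTwoSq_pos hx.1.2).ne'
  have hτ := (tau_eq_zero_iff hx.1.2).2 ⟨j, hj⟩
  have hb : pairing (crossVec x.2.2.1) x.2.2.2 / normTwoSq x.2.2.1 ^ 2 ≠ 0 := by
    intro h0
    have h1 := regH_span hm μ h x.1 x.2.1 hx.1.2 hx.2.2
      (pairing (conjVec x.2.2.1) x.2.2.2 / normTwoSq x.2.2.1)
      (pairing (crossVec x.2.2.1) x.2.2.2 / normTwoSq x.2.2.1 ^ 2)
    rw [← hη] at h1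
    have h2 : regH m μ h (x.1, x.2.1, x.2.2.1, x.2.2.2) = 0 := hH
    rw [h2, h0, hτ] at h1
    have h3 := div_pos (shapeW_pos hm hx.1.2 hx.2.2) hx.1.1
    simp only [norm_zero] at h1
    have h4 : shapeW m x.2.2.1 / x.1 = 0 := by linear_combination h1
    exact h3.ne' h4
  rw [hF]
  simp only [Pi.add_apply, Pi.smul_apply, smul_eq_mul, hj, mul_zero, zero_add]
  refine mul_ne_zero (div_ne_zero (mul_ne_zero ?_ hb) (pow_ne_zero 2 hN))
    (collision_frame hx.1.2 hx.2.2 hj).2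
  exact_mod_cast (mul_pos two_pos hK).ne'

/-! ### Curves in the level set -/

/-- Needed to differentiate identities valid only on the level set. A straight line is corrected, to
second order, along `conj z` for the quadric and along `Z` for the constraint on `η`. -/
theorem exists_curve_regLevel {x v : Reg} (hx : x ∈ RegLevel) (hv : v ∈ RegTangent x) :
    ∃ γ : ℝ → Reg, γ 0 = x ∧ HasDerivAt γ v 0 ∧ ∀ᶠ t in 𝓝 0, γ t ∈ RegLevel := by
  obtain ⟨r, p, z, η⟩ := x
  obtain ⟨v1, v2, V, ζ⟩ := v
  obtain ⟨⟨hr, hz0⟩, hη, hz⟩ := hx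
  obtain ⟨hv1, hv2⟩ := hv
  simp only at *
  have hN : pairing z z ≠ 0 := by
    rw [pairing_self]
    exact_mod_cast (normTwoSq_pos hz0).ne'
  have hid : HasDerivAt (fun t : ℝ => (t : ℂ)) 1 0 := Complex.ofRealCLM.hasDerivAt
  -- Since `∑ (conj z)² = 0`, the equation `∑ (z + t V + σ conj z)² = 0` is linear in `σ`, with this
  -- solution.
  set σ : ℝ → ℂ := fun t => -((t : ℂ) ^ 2 * ∑ j, V j ^ 2) / (2 * (pairing z z + t * pairing z V))
    with hσ
  have hσd : HasDerivAt σ 0 0 := by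
    have h1 := ((hid.pow 2).mul_const (∑ j, V j ^ 2)).neg.div
      (((hid.mul_const (pairing z V)).const_add (pairing z z)).const_mul 2) (by simpa using hN)
    convert! h1 using 1
    simp
  set Z : ℝ → Fin 3 → ℂ := fun t => z + (t : ℂ) • V + σ t • conjVec z with hZ
  have hσ0 : σ 0 = 0 := by simp [hσ]
  have hZ0 : Z 0 = z := by simp [hZ, hσ0]
  have hZd : HasDerivAt Z V 0 := by
    convert! ((hid.smul_const V).const_add z).add (hσd.smul_const (conjVec z)) using 1
    simp
  set E : ℝ → Fin 3 → ℂ := fun t => η + (t : ℂ) • ζ with hE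
  have hE0 : E 0 = η := by simp [hE]
  have hEd : HasDerivAt E ζ 0 := by
    convert! (hid.smul_const ζ).const_add η using 1
    simp
  -- Orthogonal projection of `E` off `Z`. Tangency of `v` makes the correction vanish to first
  -- order.
  set a : ℝ → ℂ := fun t => -pairing (Z t) (E t) / pairing (Z t) (Z t) with ha
  have had : HasDerivAt a 0 0 := by
    have h1 := (hasDerivAt_pairing hZd hEd).neg.div (hasDerivAt_pairing hZd hZd)
      (by rw [hZ0]; exact hN)
    have e1 : pairing z η = 0 := by rw [← conj_pairing, hη, map_zero]
    have e2 : pairing V η + pairing z ζ = 0 := by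
      rw [← conj_pairing, ← conj_pairing ζ, ← map_add, add_comm, hv1, map_zero]
    convert! h1 using 1
    simp [hZ0, hE0, e1, e2]
  have ha0 : a 0 = 0 := by
    have e1 : pairing z η = 0 := by rw [← conj_pairing, hη, map_zero]
    simp [ha, hZ0, hE0, e1]
  refine ⟨fun t => (r + t * v1, p + t * v2, Z t, E t + a t • Z t), ?_, ?_, ?_⟩
  · simp [hZ0, hE0, ha0]
  · refine HasDerivAt.prodMk ?_ (HasDerivAt.prodMk ?_ (HasDerivAt.prodMk hZd ?_))
    · simpa using ((hasDerivAt_id (0 : ℝ)).mul_const v1).const_add r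
    · simpa using ((hasDerivAt_id (0 : ℝ)).mul_const v2).const_add p
    · convert! hEd.add (had.smul hZd) using 1
      simp [ha0]
  · have h1 : ∀ᶠ t : ℝ in 𝓝 0, 0 < r + t * v1 := by
      have : ContinuousAt (fun t : ℝ => r + t * v1) 0 := by fun_prop
      exact this.eventually (lt_mem_nhds (by simpa using hr))
    have h2 : ∀ᶠ t : ℝ in 𝓝 0, Z t ≠ 0 :=
      hZd.continuousAt.eventually_ne (by rwa [hZ0])
    have h3 : ∀ᶠ t : ℝ in 𝓝 0, pairing z z + t * pairing z V ≠ 0 := by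
      have : ContinuousAt (fun t : ℝ => pairing z z + t * pairing z V) 0 := by fun_prop
      exact this.eventually_ne (by simpa using hN)
    filter_upwards [h1, h2, h3] with t h1 h2 h3
    refine ⟨⟨h1, h2⟩, ?_, ?_⟩
    · have hn : pairing (Z t) (Z t) ≠ 0 := by
        rw [pairing_self]
        exact_mod_cast (normTwoSq_pos h2).ne'
      simp only [pairing_add_left, pairing_smul_left, ha, map_div₀, map_neg, conj_pairing]
      field_simp
      ring
    · have hz' := sum_conj_sq hz
      have e : σ t * (2 * (pairing z z + t * pairing z V)) = -((t : ℂ) ^ 2 * ∑ j, V j ^ 2) := by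
        simp only [hσ]
        field_simp
      simp only [hZ, Pi.add_apply, Pi.smul_apply, smul_eq_mul, conjVec]
      simp only [pairing, Fin.sum_univ_three] at *
      linear_combination hz + 2 * t * hv2 + σ t ^ 2 * hz' + e

end PlanarThreeBody
end

noncomputable section
namespace PlanarThreeBody

/-! ### Positions and momenta of the bodies in terms of relative ones -/

/-- Positions with the center of mass at the origin and given relative positions. -/
def posOf (m : Fin 3 → ℝ) (Q : Fin 3 → ℂ) : Fin 3 → ℂ :=
  ![(m 1 * Q 0 - m 2 * Q 1) / ((∑ i, m i : ℝ) : ℂ), (m 2 * Q 2 - m 0 * Q 0) / ((∑ i, m i : ℝ) : ℂ),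
    (m 0 * Q 1 - m 1 * Q 2) / ((∑ i, m i : ℝ) : ℂ)]

/-- Momenta of the bodies in terms of a relative covector. -/
def momOf (P : Fin 3 → ℂ) : Fin 3 → ℂ := ![P 0 - P 1, P 2 - P 0, P 1 - P 2]

theorem physMap_eq (m : Fin 3 → ℝ) (μ : ℝ) (x : Reg) :
    physMap m μ x = (posOf m (physQ m x), momOf (physP m μ x)) := rfl

section

variable {m : Fin 3 → ℝ} (hm : ∀ i, 0 < m i)
include hm

theorem sum_mass_ne_zero : ((∑ i, m i : ℝ) : ℂ) ≠ 0 := by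
  exact_mod_cast (sum_mass_pos hm).ne'

theorem relPos_posOf {Q : Fin 3 → ℂ} (hQ : ∑ j, Q j = 0) : relPos (posOf m Q) = Q := by
  have hM : ∑ i, (m i : ℂ) ≠ 0 := by simpa using sum_mass_ne_zero hm
  rw [Fin.sum_univ_three] at hQ
  funext j
  fin_cases j <;> simp only [relPos, posOf] <;> simp <;> rw [← sub_div, div_eq_iff hM] <;>
    simp only [Fin.sum_univ_three]
  · linear_combination (-(m 2 : ℂ)) * hQ
  · linear_combination (-(m 1 : ℂ)) * hQ
  · linear_combination (-(m 0 : ℂ)) * hQ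

theorem posOf_relPos (q : Fin 3 → ℂ) :
    posOf m (relPos q) = fun i => q i - (∑ i, (m i : ℂ) * q i) / ((∑ i, m i : ℝ) : ℂ) := by
  have hM : ∑ i, (m i : ℂ) ≠ 0 := by simpa using sum_mass_ne_zero hm
  simp only [Fin.sum_univ_three] at hM
  funext j
  fin_cases j <;> simp [relPos, posOf, Fin.sum_univ_three] <;> field_simp <;> ring

/-- `momOf` is the adjoint of `relPos`, so the symplectic form and the angular momentum can be
computed in relative coordinates. -/
theorem pairing_momOf_posOf (P : Fin 3 → ℂ) {Q : Fin 3 → ℂ} (hQ : ∑ j, Q j = 0) :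
    pairing (momOf P) (posOf m Q) = pairing P Q := by
  have h : pairing (momOf P) (posOf m Q) = pairing P (relPos (posOf m Q)) := by
    simp [pairing, momOf, relPos, Fin.sum_univ_three]
    ring
  rw [h, relPos_posOf hm hQ]

end

theorem sum_momOf (P : Fin 3 → ℂ) : ∑ i, momOf P i = 0 := by
  simp [momOf, Fin.sum_univ_three]

theorem sum_relPos (q : Fin 3 → ℂ) : ∑ j, relPos q j = 0 := by
  simp [relPos, Fin.sum_univ_three]

theorem pairing_momOf (P q : Fin 3 → ℂ) : pairing (momOf P) q = pairing P (relPos q) := by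
  simp [pairing, momOf, relPos, Fin.sum_univ_three]
  ring

theorem posOf_smul (m : Fin 3 → ℝ) (c : ℂ) (Q : Fin 3 → ℂ) :
    posOf m (c • Q) = c • posOf m Q := by
  funext j
  fin_cases j <;> simp [posOf] <;> ring

theorem momOf_add (Q Q' : Fin 3 → ℂ) : momOf (Q + Q') = momOf Q + momOf Q' := by
  funext j
  fin_cases j <;> simp [momOf] <;> ring

theorem momOf_smul (c : ℂ) (Q : Fin 3 → ℂ) : momOf (c • Q) = c • momOf Q := by
  funext j
  fin_cases j <;> simp [momOf] <;> ring

/-! ### The mass metric -/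

theorem massDual_add (m : Fin 3 → ℝ) (X Y : Fin 3 → ℂ) :
    massDual m (X + Y) = massDual m X + massDual m Y := by
  funext j; simp [massDual]; ring

theorem massDual_smul (m : Fin 3 → ℝ) (c : ℂ) (X : Fin 3 → ℂ) :
    massDual m (c • X) = c • massDual m X := by
  funext j; simp [massDual]; ring

theorem conj_pairing_massDual (m : Fin 3 → ℝ) (X Y : Fin 3 → ℂ) :
    conj (pairing (massDual m X) Y) = pairing (massDual m Y) X := by
  simp only [pairing, massDual, map_sum, map_mul, Complex.conj_conj, Complex.conj_ofReal]
  exact Finset.sum_congr rfl fun j _ => by ring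

theorem pairing_massDual_self (m : Fin 3 → ℝ) (X : Fin 3 → ℂ) :
    pairing (massDual m X) X = massNormSq m X := by
  simp only [pairing, massDual, massNormSq, map_mul, Complex.conj_ofReal, mul_assoc,
    Complex.conj_mul', Finset.sum_div, Complex.ofReal_sum]
  exact Finset.sum_congr rfl fun j _ => by push_cast; ring

theorem momOf_massDual (m : Fin 3 → ℝ) (X : Fin 3 → ℂ) (i : Fin 3) :
    momOf (massDual m X) i = m i * posOf m X i := by
  fin_cases i <;> simp [momOf, massDual, posOf, pairMass] <;> ring

/-- Twice the kinetic energy, as a Hermitian form in the relative covector. -/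
def kinPair (m : Fin 3 → ℝ) (P P' : Fin 3 → ℂ) : ℂ := ∑ i, conj (momOf P i) * momOf P' i / m i

theorem conj_kinPair (m : Fin 3 → ℝ) (P P' : Fin 3 → ℂ) :
    conj (kinPair m P P') = kinPair m P' P := by
  simp only [kinPair, map_sum, map_mul, map_div₀, Complex.conj_conj, Complex.conj_ofReal]
  exact Finset.sum_congr rfl fun j _ => by ring

/-- The kinetic form is dual to the mass metric on the plane `∑ X = 0`: the momenta of `X*` are the
masses times the centred positions of `X`. -/
theorem kinPair_massDual {m : Fin 3 → ℝ} (hm : ∀ i, 0 < m i) (P : Fin 3 → ℂ) {X : Fin 3 → ℂ}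
    (hX : ∑ j, X j = 0) : kinPair m P (massDual m X) = pairing P X := by
  rw [← pairing_momOf_posOf hm P hX]
  simp only [kinPair, pairing, momOf_massDual]
  refine Finset.sum_congr rfl fun i _ => ?_
  have : (m i : ℂ) ≠ 0 := by exact_mod_cast (hm i).ne'
  field_simp

theorem kinPair_add_right (m : Fin 3 → ℝ) (P Q R : Fin 3 → ℂ) :
    kinPair m P (Q + R) = kinPair m P Q + kinPair m P R := by
  simp only [kinPair, momOf_add, Pi.add_apply, mul_add, add_div, Finset.sum_add_distrib]

theorem kinPair_smul_right (m : Fin 3 → ℝ) (c : ℂ) (P Q : Fin 3 → ℂ) :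
    kinPair m P (c • Q) = c * kinPair m P Q := by
  simp only [kinPair, momOf_smul, Pi.smul_apply, smul_eq_mul, Finset.mul_sum]
  exact Finset.sum_congr rfl fun j _ => by ring

theorem kinPair_add_left (m : Fin 3 → ℝ) (P Q R : Fin 3 → ℂ) :
    kinPair m (Q + R) P = kinPair m Q P + kinPair m R P := by
  rw [← conj_kinPair, kinPair_add_right, map_add, conj_kinPair, conj_kinPair]

theorem kinPair_smul_left (m : Fin 3 → ℝ) (c : ℂ) (P Q : Fin 3 → ℂ) :
    kinPair m (c • Q) P = conj c * kinPair m Q P := by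
  rw [← conj_kinPair, kinPair_smul_right, map_mul, conj_kinPair]

theorem kinPair_self (m : Fin 3 → ℝ) (P : Fin 3 → ℂ) :
    kinPair m P P = ((2 * ∑ i, ‖momOf P i‖ ^ 2 / (2 * m i) : ℝ) : ℂ) := by
  rw [Finset.mul_sum, Complex.ofReal_sum, kinPair]
  refine Finset.sum_congr rfl fun i _ => ?_
  rw [Complex.conj_mul']
  push_cast
  ring

/-! ### Relative positions and momenta -/

/-- The covector `Z_ij = η_ij / (2 conj z_ij)`. -/
def zVec (z η : Fin 3 → ℂ) : Fin 3 → ℂ := fun j => η j / (2 * conj (z j))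

theorem physQ_eq (m : Fin 3 → ℝ) (x : Reg) :
    physQ m x = ((x.1 / √(massNormSq m (levi x.2.2.1)) : ℝ) : ℂ) • levi x.2.2.1 := rfl

theorem physP_eq (m : Fin 3 → ℝ) (μ : ℝ) {x : Reg} (hr : x.1 ≠ 0)
    (hn : √(massNormSq m (levi x.2.2.1)) ≠ 0) :
    physP m μ x = ((x.2.1 / √(massNormSq m (levi x.2.2.1)) : ℝ)
        + (μ / (√(massNormSq m (levi x.2.2.1)) * x.1) : ℝ) * Complex.I) • massDual m (levi x.2.2.1)
      + ((√(massNormSq m (levi x.2.2.1)) / x.1 : ℝ) : ℂ) • zVec x.2.2.1 x.2.2.2 := by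
  have hr' : (x.1 : ℂ) ≠ 0 := by exact_mod_cast hr
  have hn' : (√(massNormSq m (levi x.2.2.1)) : ℂ) ≠ 0 := by exact_mod_cast hn
  funext j
  simp only [physP, zVec, Pi.add_apply, Pi.smul_apply, smul_eq_mul]
  push_cast
  generalize (√(massNormSq m (levi x.2.2.1)) : ℂ) = n at *
  field_simp
  ring

theorem pairing_zVec_levi (z η : Fin 3 → ℂ) : pairing (zVec z η) (levi z) = pairing η z / 2 := by
  simp only [pairing, zVec, levi, Finset.sum_div]
  refine Finset.sum_congr rfl fun j _ => ?_
  -- At `z j = 0` both summands vanish, whatever value the quotient by zero has.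
  by_cases hj : z j = 0
  · simp [hj]
  · simp
    field_simp
    rw [map_ofNat]

theorem sum_physQ (m : Fin 3 → ℝ) {x : Reg} (hx : x ∈ RegLevel) : ∑ j, physQ m x j = 0 := by
  have h := hx.2.2
  simp only [physQ, levi, ← Finset.mul_sum, h, mul_zero]

theorem relPos_physMap {m : Fin 3 → ℝ} (hm : ∀ i, 0 < m i) (μ : ℝ) {x : Reg} (hx : x ∈ RegLevel) :
    relPos (physMap m μ x).1 = physQ m x := by
  rw [physMap_eq, relPos_posOf hm (sum_physQ m hx)]

theorem sqrt_massNormSq_pos {m : Fin 3 → ℝ} (hm : ∀ i, 0 < m i) {x : Reg} (hx : x ∈ RegDomain) :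
    0 < √(massNormSq m (levi x.2.2.1)) := Real.sqrt_pos.2 (massNormSq_levi_pos hm hx.2)

/-- The `Z`-part is annihilated because `⟨η, z⟩ = 0`. The radial part then gives `r p_r`, and the
momentum shift is exactly what produces angular momentum `μ`. -/
theorem pairing_physP_physQ {m : Fin 3 → ℝ} (hm : ∀ i, 0 < m i) (μ : ℝ) {x : Reg}
    (hx : x ∈ RegLevel) :
    pairing (physP m μ x) (physQ m x) = (x.1 * x.2.1 : ℝ) - μ * Complex.I := by
  have hn := sqrt_massNormSq_pos hm hx.1
  have hr := hx.1.1.ne'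
  have hsq : (massNormSq m (levi x.2.2.1) : ℂ) = (√(massNormSq m (levi x.2.2.1)) : ℂ) ^ 2 := by
    rw [← Complex.ofReal_pow, Real.sq_sqrt (massNormSq_nonneg hm _)]
  rw [physP_eq m μ hr hn.ne', physQ_eq, pairing_smul_right, pairing_add_left, pairing_smul_left,
    pairing_smul_left, pairing_zVec_levi, hx.2.1, pairing_massDual_self, hsq]
  have hr' : (x.1 : ℂ) ≠ 0 := by exact_mod_cast hr
  have hn' : (√(massNormSq m (levi x.2.2.1)) : ℂ) ≠ 0 := by exact_mod_cast hn.ne'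
  simp only [map_add, map_mul, Complex.conj_ofReal, Complex.conj_I]
  push_cast
  generalize (√(massNormSq m (levi x.2.2.1)) : ℂ) = n at *
  field_simp
  ring

theorem relPos_ne_zero_iff {q : Fin 3 → ℂ} :
    Function.Injective q ↔ ∀ j, relPos q j ≠ 0 := by
  constructor
  · intro hq j hj
    fin_cases j <;> simp [relPos, sub_eq_zero] at hj <;> exact absurd (hq hj) (by decide)
  · intro h i j hij
    have h0 := h 0
    have h1 := h 1
    have h2 := h 2
    simp only [relPos] at h0 h1 h2
    simp [sub_eq_zero] at h0 h1 h2
    fin_cases i <;> fin_cases j <;> simp_all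

theorem angularMomentum_eq (q p : Fin 3 → ℂ) :
    ∑ i, (conj (q i) * p i).im = -(pairing p q).im := by
  rw [← pairing_im_comm]
  simp [pairing, Complex.im_sum]

theorem physMap_mem_bodyLevel {m : Fin 3 → ℝ} (hm : ∀ i, 0 < m i) (μ : ℝ) {x : Reg}
    (hx : x ∈ RegFree) : physMap m μ x ∈ BodyLevel μ := by
  refine ⟨?_, sum_momOf _, ?_⟩
  · rw [relPos_ne_zero_iff, relPos_physMap hm μ hx.1]
    intro j
    refine mul_ne_zero ?_ (pow_ne_zero 2 (hx.2 j))
    exact_mod_cast (div_pos hx.1.1.1 (sqrt_massNormSq_pos hm hx.1.1)).ne'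
  · rw [angularMomentum_eq]
    show -(pairing (momOf (physP m μ x)) (posOf m (physQ m x))).im = μ
    rw [pairing_momOf_posOf hm _ (sum_physQ m hx.1), pairing_physP_physQ hm μ hx.1]
    simp

theorem norm_physQ {m : Fin 3 → ℝ} (hm : ∀ i, 0 < m i) {x : Reg} (hx : x ∈ RegDomain) (j : Fin 3) :
    ‖physQ m x j‖ = x.1 / √(massNormSq m (levi x.2.2.1)) * rho x.2.2.1 j := by
  have := (div_pos hx.1 (sqrt_massNormSq_pos hm hx))
  rw [physQ, norm_mul, Complex.norm_real, Real.norm_of_nonneg this.le]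
  simp [levi, rho]

/-- The regularized Hamiltonian is the time-scaled Newtonian one. -/
theorem regH_eq_tau_mul {m : Fin 3 → ℝ} (hm : ∀ i, 0 < m i) (μ h : ℝ) {x : Reg}
    (hx : x ∈ RegFree) : regH m μ h x = tau x.2.2.1 * (bodyH m (physMap m μ x) - h) := by
  have hn := sqrt_massNormSq_pos hm hx.1.1
  have hr := hx.1.1.1.ne'
  have hX : ∑ j, levi x.2.2.1 j = 0 := hx.1.2.2
  have hsq : massNormSq m (levi x.2.2.1) = √(massNormSq m (levi x.2.2.1)) ^ 2 :=
    (Real.sq_sqrt (massNormSq_nonneg hm _)).symm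
  set n := √(massNormSq m (levi x.2.2.1)) with hndef
  have hpot : ∀ j, ‖relPos (physMap m μ x).1 j‖ = x.1 / n * rho x.2.2.1 j := fun j => by
    rw [relPos_physMap hm μ hx.1, norm_physQ hm hx.1.1]
  -- `X*` and `Z` are orthogonal for the kinetic form since `⟨Z, X⟩ = 0`, so radial, rotational and
  -- shape energies add without cross terms.
  have hkin : ∑ i, ‖(physMap m μ x).2 i‖ ^ 2 / (2 * m i)
      = x.2.1 ^ 2 / 2 + μ ^ 2 / (2 * x.1 ^ 2) + n ^ 2 / x.1 ^ 2 *
        ∑ i, ‖momOf (zVec x.2.2.1 x.2.2.2) i‖ ^ 2 / (2 * m i) := by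
    have h1 := kinPair_self m (physP m μ x)
    have h2 : kinPair m (zVec x.2.2.1 x.2.2.2) (massDual m (levi x.2.2.1)) = 0 := by
      rw [kinPair_massDual hm _ hX, pairing_zVec_levi, hx.1.2.1, zero_div]
    have h3 : kinPair m (massDual m (levi x.2.2.1)) (zVec x.2.2.1 x.2.2.2) = 0 := by
      rw [← conj_kinPair, h2, map_zero]
    rw [physP_eq m μ hr hn.ne', ← hndef] at h1
    simp only [kinPair_add_left, kinPair_add_right, kinPair_smul_left, kinPair_smul_right, h3,
      kinPair_massDual hm _ hX, kinPair_self m (zVec x.2.2.1 x.2.2.2), pairing_add_left,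
      pairing_smul_left, pairing_zVec_levi, hx.1.2.1, pairing_massDual_self, hsq] at h1
    simp only [map_add, map_mul, Complex.conj_ofReal, Complex.conj_I] at h1
    have h4 : ((2 * (x.2.1 ^ 2 / 2 + μ ^ 2 / (2 * x.1 ^ 2) + n ^ 2 / x.1 ^ 2 *
        ∑ i, ‖momOf (zVec x.2.2.1 x.2.2.2) i‖ ^ 2 / (2 * m i)) : ℝ) : ℂ)
        = ((2 * ∑ i, ‖(physMap m μ x).2 i‖ ^ 2 / (2 * m i) : ℝ) : ℂ) := by
      rw [physMap_eq, physP_eq m μ hr hn.ne', ← hndef, ← h1]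
      have hr' : (x.1 : ℂ) ≠ 0 := by exact_mod_cast hr
      have hn' : (n : ℂ) ≠ 0 := by exact_mod_cast hn.ne'
      push_cast
      field_simp
      ring_nf
      simp only [Complex.I_sq]
      ring
    have h5 := Complex.ofReal_injective h4
    linarith
  rw [bodyH, hkin]
  simp only [hpot]
  -- The momenta of the bodies are differences of the `Z`, whose numerators are the `π`.
  have hmom : ∀ i j, x.2.2.2 i / (2 * conj (x.2.2.1 i)) - x.2.2.2 j / (2 * conj (x.2.2.1 j))
      = (x.2.2.2 i * conj (x.2.2.1 j) - x.2.2.2 j * conj (x.2.2.1 i))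
        / (2 * (conj (x.2.2.1 i) * conj (x.2.2.1 j))) := by
    intro i j
    have hi : conj (x.2.2.1 i) ≠ 0 := by simpa using hx.2 i
    have hj : conj (x.2.2.1 j) ≠ 0 := by simpa using hx.2 j
    field_simp
  have hρ : ∀ j, rho x.2.2.1 j ≠ 0 := fun j => pow_ne_zero 2 (norm_ne_zero_iff.2 (hx.2 j))
  have hN := (normTwoSq_pos hx.1.1.2).ne'
  have hm0 := (hm 0).ne'
  have hm1 := (hm 1).ne'
  have hm2 := (hm 2).ne'
  have hn0 := hn.ne'
  have e : ∀ (a : ℂ) i j, ‖a / (2 * (conj (x.2.2.1 i) * conj (x.2.2.1 j)))‖ ^ 2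
      = ‖a‖ ^ 2 / (4 * (rho x.2.2.1 i * rho x.2.2.1 j)) := by
    intro a i j
    simp [rho, div_pow, mul_pow]
    norm_num
  simp only [regH, shapeW, ← hndef, Fin.sum_univ_three, momOf, zVec, pi1, pi2, pi3, pairMass]
  simp only [Matrix.cons_val_zero, Matrix.cons_val_one, Matrix.cons_val]
  rw [hmom 0 1, hmom 2 0, hmom 1 2, e, e, e, hsq]
  simp only [tau]
  generalize rho x.2.2.1 = ρ at *
  generalize normTwoSq x.2.2.1 = N at *
  have h0 := hρ 0
  have h1 := hρ 1
  have h2 := hρ 2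
  field_simp
  ring

/-! ### Invariance of the map -/

/-- Scaling `z` by `k` multiplies `Q` by the unit number `k² / |k|² = k / conj k`. A translation
adds the same constant to all three `P`, which differences do not see. -/
theorem physMap_regAct (m : Fin 3 → ℝ) (μ : ℝ) {k : ℂ} (hk : k ≠ 0) (c : ℂ) {x : Reg}
    (hz : ∀ j, x.2.2.1 j ≠ 0) : physMap m μ (regAct k c x)
      = (k ^ 2 / (‖k‖ ^ 2 : ℝ)) • physMap m μ x := by
  have hk' : conj k ≠ 0 := by simpa using hk
  have hkn : (‖k‖ : ℂ) ≠ 0 := by exact_mod_cast norm_ne_zero_iff.2 hk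
  have hkk : (‖k‖ : ℂ) ^ 2 = conj k * k := (Complex.conj_mul' k).symm
  set u : ℂ := k ^ 2 / (‖k‖ ^ 2 : ℝ) with hu
  have h1 : physQ m (regAct k c x) = u • physQ m x := by
    funext j
    simp only [physQ, regAct, sqrt_massNormSq_levi_smul, levi, Pi.smul_apply, smul_eq_mul, hu]
    push_cast
    field_simp
  have h2 : physP m μ (regAct k c x) = u • physP m μ x
      + fun _ => ((‖k‖ ^ 2 * √(massNormSq m (levi x.2.2.1)) / x.1 : ℝ) : ℂ) * c := by
    funext j
    have hj : conj (x.2.2.1 j) ≠ 0 := by simpa using hz j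
    have hu' : u = k / conj k := by
      rw [hu]
      push_cast
      rw [hkk]
      field_simp
    simp only [physP, regAct, sqrt_massNormSq_levi_smul, Pi.smul_apply, smul_eq_mul, massDual,
      levi, Pi.add_apply, map_mul]
    have e : (x.2.2.2 j / conj k + 2 * c * (conj k * conj (x.2.2.1 j)))
        / (2 * (conj k * conj (x.2.2.1 j)))
        = x.2.2.2 j / (2 * conj (x.2.2.1 j)) / conj k ^ 2 + c := by
      field_simp
    rw [e, hu']
    push_cast
    rw [hkk]
    generalize (√(massNormSq m (levi x.2.2.1)) : ℂ) = n
    by_cases hn : n = 0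
    · simp [hn]
    · by_cases hr : (x.1 : ℂ) = 0
      · simp [hr]
        field_simp
      · field_simp
        ring
  rw [physMap_eq, physMap_eq, h1, h2, posOf_smul, momOf_add, momOf_smul]
  refine Prod.ext rfl ?_
  funext j
  fin_cases j <;> simp [momOf]

theorem norm_unit_of_sq {k : ℂ} (hk : k ≠ 0) : ‖k ^ 2 / ((‖k‖ ^ 2 : ℝ) : ℂ)‖ = 1 := by
  have : ‖k‖ ≠ 0 := norm_ne_zero_iff.2 hk
  simp [this]

theorem bodySetoid_physMap_regAct (m : Fin 3 → ℝ) (μ : ℝ) {k : ℂ} (hk : k ≠ 0) (c : ℂ) {x : Reg}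
    (hz : ∀ j, x.2.2.1 j ≠ 0) : bodySetoid (physMap m μ x) (physMap m μ (regAct k c x)) :=
  ⟨_, 0, norm_unit_of_sq hk, by rw [physMap_regAct m μ hk c hz]; ext i <;> simp⟩

/-! ### Smoothness and derivative of the map -/

theorem contDiffAt_physMap {m : Fin 3 → ℝ} (hm : ∀ i, 0 < m i) (μ : ℝ) {x : Reg}
    (hx : x ∈ RegDomain) (hz : ∀ j, x.2.2.1 j ≠ 0) : ContDiffAt ℝ ∞ (physMap m μ) x := by
  have hr : (x.1 : ℂ) ≠ 0 := by exact_mod_cast hx.1.ne'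
  have hn := (sqrt_massNormSq_pos hm hx).ne'
  have cof : ∀ {f : Reg → ℝ}, ContDiffAt ℝ ∞ f x → ContDiffAt ℝ ∞ (fun x => (f x : ℂ)) x :=
    fun hf => Complex.ofRealCLM.contDiff.contDiffAt.comp x hf
  have cr : ContDiffAt ℝ ∞ (fun x : Reg => x.1) x := contDiff_fst.contDiffAt
  have cp : ContDiffAt ℝ ∞ (fun x : Reg => x.2.1) x := contDiff_snd.fst.contDiffAt
  have cn : ContDiffAt ℝ ∞ (fun x : Reg => √(massNormSq m (levi x.2.2.1))) x :=
    ContDiffAt.comp (g := fun z => √(massNormSq m (levi z))) x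
      (contDiffAt_sqrt_massNormSq hm hx.2) contDiff_snd.snd.fst.contDiffAt
  have cl : ∀ j, ContDiffAt ℝ ∞ (fun x : Reg => levi x.2.2.1 j) x := fun j =>
    ((contDiff_z_apply j).pow 2).contDiffAt
  have cQ : ∀ j, ContDiffAt ℝ ∞ (fun x : Reg => physQ m x j) x := fun j =>
    (cof (cr.div cn hn)).mul (cl j)
  have cP : ∀ j, ContDiffAt ℝ ∞ (fun x : Reg => physP m μ x j) x := by
    intro j
    have cX : ContDiffAt ℝ ∞ (fun x : Reg => massDual m (levi x.2.2.1) j) x :=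
      contDiffAt_const.mul (cl j)
    have hj : (2 * conj (x.2.2.1 j)) ≠ 0 := by simpa using hz j
    have cZ : ContDiffAt ℝ ∞ (fun x : Reg => x.2.2.2 j / (2 * conj (x.2.2.1 j))) x := by
      simp only [div_eq_mul_inv]
      exact (contDiff_eta_apply j).contDiffAt.mul
        ((contDiff_const.mul (contDiff_conj_comp (contDiff_z_apply j))).contDiffAt.inv hj)
    exact ((cof (cp.div cn hn)).mul cX).add ((cof (cn.div cr hx.1.ne')).mul (cZ.add
      (((cof (contDiffAt_const.div (cn.pow 2) (pow_ne_zero 2 hn))).mul contDiffAt_const).mul cX)))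
  refine ContDiffAt.prodMk (contDiffAt_pi.2 fun i => ?_) (contDiffAt_pi.2 fun i => ?_)
  · fin_cases i
    · exact ((contDiffAt_const.mul (cQ 0)).sub (contDiffAt_const.mul (cQ 1))).div_const _
    · exact ((contDiffAt_const.mul (cQ 2)).sub (contDiffAt_const.mul (cQ 0))).div_const _
    · exact ((contDiffAt_const.mul (cQ 1)).sub (contDiffAt_const.mul (cQ 2))).div_const _
  · fin_cases i
    · exact (cP 0).sub (cP 1)
    · exact (cP 2).sub (cP 0)
    · exact (cP 1).sub (cP 2)

end PlanarThreeBody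
end

noncomputable section
namespace PlanarThreeBody

/-! ### The Fubini-Study form of the mass metric -/

/-- Componentwise derivative of the squaring map. -/
def leviDeriv (z u : Fin 3 → ℂ) : Fin 3 → ℂ := fun j => 2 * z j * u j

theorem leviDeriv_add (z u v : Fin 3 → ℂ) :
    leviDeriv z (u + v) = leviDeriv z u + leviDeriv z v := by
  funext j; simp [leviDeriv]; ring

theorem leviDeriv_smul (z : Fin 3 → ℂ) (c : ℂ) (u : Fin 3 → ℂ) :
    leviDeriv z (c • u) = c • leviDeriv z u := by
  funext j; simp [leviDeriv]; ring

theorem leviDeriv_self (z : Fin 3 → ℂ) : leviDeriv z z = (2 : ℂ) • levi z := by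
  funext j; simp [leviDeriv, levi]; ring

theorem conj_mul_sq (a : ℂ) : conj a * a = ((‖a‖ ^ 2 : ℝ) : ℂ) := by
  rw [Complex.conj_mul']; push_cast; rfl

/-- The weighted Lagrange identity writes the Gram determinant as a sum of squared two-by-two
minors, and on the quadric each minor is `± 2 z₀ z₁ z₂ ‖z‖²`. This is the source of the factor `ρ₁₂
ρ₃₁ ρ₂₃` in `λ`. -/
theorem gram_leviDeriv {m : Fin 3 → ℝ} (hm : ∀ i, 0 < m i) {z : Fin 3 → ℂ}
    (hz : ∑ j, z j ^ 2 = 0) :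
    pairing (massDual m (leviDeriv z (crossVec z))) (leviDeriv z (crossVec z))
        * pairing (massDual m (levi z)) (levi z)
      - pairing (massDual m (leviDeriv z (crossVec z))) (levi z)
        * pairing (massDual m (levi z)) (leviDeriv z (crossVec z))
      = ((4 * (m 0 * m 1 * m 2) / (∑ i, m i) * (rho z 0 * rho z 1 * rho z 2) * normTwoSq z ^ 2 : ℝ)
        : ℂ) := by
  have hM : ((∑ i, m i : ℝ) : ℂ) ≠ 0 := sum_mass_ne_zero hm
  have lagrange : ∀ (w : Fin 3 → ℝ) (X N : Fin 3 → ℂ),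
      (∑ j, conj ((w j : ℂ) * N j) * N j) * (∑ j, conj ((w j : ℂ) * X j) * X j)
      - (∑ j, conj ((w j : ℂ) * N j) * X j) * (∑ j, conj ((w j : ℂ) * X j) * N j)
      = ((w 0 * w 1 * ‖X 0 * N 1 - X 1 * N 0‖ ^ 2 + w 1 * w 2 * ‖X 1 * N 2 - X 2 * N 1‖ ^ 2
        + w 0 * w 2 * ‖X 0 * N 2 - X 2 * N 0‖ ^ 2 : ℝ) : ℂ) := by
    intro w X N
    simp only [Complex.ofReal_add, Complex.ofReal_mul, ← conj_mul_sq, Fin.sum_univ_three, map_mul,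
      map_sub, Complex.conj_ofReal]
    ring
  have h := lagrange (fun j => pairMass m j / ∑ i, m i) (levi z) (leviDeriv z (crossVec z))
  have hN : (normTwoSq z : ℂ) = conj (z 0) * z 0 + conj (z 1) * z 1 + conj (z 2) * z 2 := by
    rw [← pairing_self]
    simp [pairing, Fin.sum_univ_three]
  rw [Fin.sum_univ_three] at hz
  have d0 : levi z 0 * leviDeriv z (crossVec z) 1 - levi z 1 * leviDeriv z (crossVec z) 0
      = -(2 * (z 0 * z 1 * z 2) * normTwoSq z) := by
    rw [hN]
    simp [levi, leviDeriv, crossVec]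
    linear_combination (2 * z 0 * z 1 * conj (z 2)) * hz
  have d1 : levi z 1 * leviDeriv z (crossVec z) 2 - levi z 2 * leviDeriv z (crossVec z) 1
      = -(2 * (z 0 * z 1 * z 2) * normTwoSq z) := by
    rw [hN]
    simp [levi, leviDeriv, crossVec]
    linear_combination (2 * z 1 * z 2 * conj (z 0)) * hz
  have d2 : levi z 0 * leviDeriv z (crossVec z) 2 - levi z 2 * leviDeriv z (crossVec z) 0
      = 2 * (z 0 * z 1 * z 2) * normTwoSq z := by
    rw [hN]
    simp [levi, leviDeriv, crossVec]
    linear_combination (-2 * z 0 * z 2 * conj (z 1)) * hz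
  have d3 : ‖2 * (z 0 * z 1 * z 2) * (normTwoSq z : ℂ)‖ ^ 2
      = 4 * (rho z 0 * rho z 1 * rho z 2) * normTwoSq z ^ 2 := by
    simp [mul_pow, rho, abs_of_nonneg (normTwoSq_nonneg z)]
    norm_num
  rw [d0, d1, d2, norm_neg, d3] at h
  refine Eq.trans ?_ (h.trans ?_)
  · simp only [pairing, massDual]
  · congr 1
    have hM' := (sum_mass_pos hm).ne'
    simp only [pairMass, Matrix.cons_val_zero, Matrix.cons_val_one, Matrix.cons_val]
    field_simp
    simp only [Fin.sum_univ_three]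
    ring

/-- Pulled back by squaring, the Fubini-Study form of the mass metric annihilates `z`, as the
standard one does. So on tangent vectors the two are proportional, and comparing them on `crossVec
z` by the Gram determinant gives the factor `λ`. -/
theorem massForm_eq_curvForm {m : Fin 3 → ℝ} (hm : ∀ i, 0 < m i) {z u v : Fin 3 → ℂ}
    (hz0 : z ≠ 0) (hz : ∑ j, z j ^ 2 = 0) (hu : ∑ j, z j * u j = 0) (hv : ∑ j, z j * v j = 0) :
    (pairing (massDual m (leviDeriv z u)) (leviDeriv z v) * massNormSq m (levi z)
      - pairing (massDual m (leviDeriv z u)) (levi z)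
        * pairing (massDual m (levi z)) (leviDeriv z v)).im / massNormSq m (levi z) ^ 2
      = curvForm m z u v := by
  have hgram := gram_leviDeriv hm hz
  have hnn := pairing_crossVec_crossVec hz
  have hn := (massNormSq_levi_pos hm hz0).ne'
  have hN := (normTwoSq_pos hz0).ne'
  have hNC : (normTwoSq z : ℂ) ≠ 0 := by exact_mod_cast hN
  rw [eq_span_of_sum_mul hz0 hz hu, eq_span_of_sum_mul hz0 hz hv]
  generalize pairing z u / (normTwoSq z : ℂ) = a
  generalize pairing z v / (normTwoSq z : ℂ) = a'
  generalize pairing (crossVec z) u / (normTwoSq z : ℂ) ^ 2 = b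
  generalize pairing (crossVec z) v / (normTwoSq z : ℂ) ^ 2 = b'
  rw [← pairing_massDual_self] at *
  have e1 : pairing (massDual m (leviDeriv z (a • z + b • crossVec z)))
        (leviDeriv z (a' • z + b' • crossVec z)) * pairing (massDual m (levi z)) (levi z)
      - pairing (massDual m (leviDeriv z (a • z + b • crossVec z))) (levi z)
        * pairing (massDual m (levi z)) (leviDeriv z (a' • z + b' • crossVec z))
      = (4 * (m 0 * m 1 * m 2) / (∑ i, m i) * (rho z 0 * rho z 1 * rho z 2) * normTwoSq z ^ 2 : ℝ)
        * (conj b * b') := by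
    rw [← hgram]
    simp only [leviDeriv_add, leviDeriv_smul, leviDeriv_self, massDual_add, massDual_smul,
      pairing_add_left, pairing_add_right, pairing_smul_left, pairing_smul_right]
    ring
  have e2 : fubiniStudy z (a • z + b • crossVec z) (a' • z + b' • crossVec z)
      = normTwoSq z * (conj b * b').im := by
    rw [← Complex.im_ofReal_mul]
    simp only [fubiniStudy, pairing_add_left, pairing_add_right, pairing_smul_left,
      pairing_smul_right, pairing_self_crossVec, pairing_crossVec_self, hnn, pairing_self]
    congr 1
    field_simp
    ring
  rw [e1, Complex.im_ofReal_mul, curvForm, e2, lam]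
  have hM' := (sum_mass_pos hm).ne'
  field_simp

/-! ### The derivative of the map -/

/-- The derivative of `Z_ij = η_ij / (2 conj z_ij)`. -/
def zVecDeriv (z η V ζ : Fin 3 → ℂ) : Fin 3 → ℂ := fun j =>
  ζ j / (2 * conj (z j)) - η j * conj (V j) / (2 * conj (z j) ^ 2)

/-- The derivative of `|X|` with `X_ij = z_ij²`. -/
def normDeriv (m : Fin 3 → ℝ) (z V : Fin 3 → ℂ) : ℝ :=
  (pairing (massDual m (levi z)) (leviDeriv z V)).re / √(massNormSq m (levi z))

/-- The derivative of the relative positions. -/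
def physQDeriv (m : Fin 3 → ℝ) (x u : Reg) : Fin 3 → ℂ :=
  let n := √(massNormSq m (levi x.2.2.1))
  let n' := normDeriv m x.2.2.1 u.2.2.1
  ((u.1 / n - x.1 * n' / n ^ 2 : ℝ) : ℂ) • levi x.2.2.1
    + ((x.1 / n : ℝ) : ℂ) • leviDeriv x.2.2.1 u.2.2.1

/-- The derivative of the relative momenta. -/
def physPDeriv (m : Fin 3 → ℝ) (μ : ℝ) (x u : Reg) : Fin 3 → ℂ :=
  let n := √(massNormSq m (levi x.2.2.1))
  let n' := normDeriv m x.2.2.1 u.2.2.1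
  (((u.2.1 / n - x.2.1 * n' / n ^ 2 : ℝ) : ℂ) + ((-(μ * n' / (n ^ 2 * x.1))
      - μ * u.1 / (n * x.1 ^ 2) : ℝ) : ℂ) * Complex.I) • massDual m (levi x.2.2.1)
    + (((x.2.1 / n : ℝ) : ℂ) + ((μ / (n * x.1) : ℝ) : ℂ) * Complex.I) •
      massDual m (leviDeriv x.2.2.1 u.2.2.1)
    + ((n' / x.1 - n * u.1 / x.1 ^ 2 : ℝ) : ℂ) • zVec x.2.2.1 x.2.2.2
    + ((n / x.1 : ℝ) : ℂ) • zVecDeriv x.2.2.1 x.2.2.2 u.2.2.1 u.2.2.2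

theorem hasDerivAt_levi {A : ℝ → Fin 3 → ℂ} {A' : Fin 3 → ℂ} {s : ℝ} (hA : HasDerivAt A A' s) :
    HasDerivAt (fun s => levi (A s)) (leviDeriv (A s) A') s := by
  refine hasDerivAt_pi.2 fun j => ?_
  convert! (hasDerivAt_pi.1 hA j).pow 2 using 1
  simp [leviDeriv]

theorem hasDerivAt_massDual (m : Fin 3 → ℝ) {A : ℝ → Fin 3 → ℂ} {A' : Fin 3 → ℂ} {s : ℝ}
    (hA : HasDerivAt A A' s) : HasDerivAt (fun s => massDual m (A s)) (massDual m A') s :=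
  hasDerivAt_pi.2 fun j => (hasDerivAt_pi.1 hA j).const_mul _

theorem hasDerivAt_zVec {A B : ℝ → Fin 3 → ℂ} {A' B' : Fin 3 → ℂ} {s : ℝ}
    (hA : HasDerivAt A A' s) (hB : HasDerivAt B B' s) (h0 : ∀ j, A s j ≠ 0) :
    HasDerivAt (fun s => zVec (A s) (B s)) (zVecDeriv (A s) (B s) A' B') s := by
  refine hasDerivAt_pi.2 fun j => ?_
  have hj : conj (A s j) ≠ 0 := by simpa using h0 j
  convert! (hasDerivAt_pi.1 hB j).div ((hasDerivAt_conj (hasDerivAt_pi.1 hA j)).const_mul 2)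
    (by simpa using h0 j) using 1
  simp only [zVecDeriv]
  field_simp

theorem hasDerivAt_massNormSq (m : Fin 3 → ℝ) {A : ℝ → Fin 3 → ℂ} {A' : Fin 3 → ℂ} {s : ℝ}
    (hA : HasDerivAt A A' s) : HasDerivAt (fun s => massNormSq m (A s))
      (2 * (pairing (massDual m (A s)) A').re) s := by
  have h1 := hasDerivAt_pairing (hasDerivAt_massDual m hA) hA
  have h2 := Complex.reCLM.hasFDerivAt.comp_hasDerivAt s h1
  convert! h2 using 1
  · funext s
    simp [pairing_massDual_self]
  · rw [← conj_pairing_massDual]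
    simp
    ring

theorem hasDerivAt_sqrt_massNormSq {m : Fin 3 → ℝ} (hm : ∀ i, 0 < m i) {A : ℝ → Fin 3 → ℂ}
    {A' : Fin 3 → ℂ} {s : ℝ} (hA : HasDerivAt A A' s) (h0 : A s ≠ 0) :
    HasDerivAt (fun s => √(massNormSq m (levi (A s)))) (normDeriv m (A s) A') s := by
  convert! (hasDerivAt_massNormSq m (hasDerivAt_levi hA)).sqrt (massNormSq_levi_pos hm h0).ne'
    using 1
  simp only [normDeriv]
  field_simp

theorem hasDerivAt_ofReal {f : ℝ → ℝ} {f' s : ℝ} (hf : HasDerivAt f f' s) :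
    HasDerivAt (fun s => (f s : ℂ)) (f' : ℂ) s := hf.ofReal_comp

theorem hasDerivAt_physQ {m : Fin 3 → ℝ} (hm : ∀ i, 0 < m i) {x : ℝ → Reg} {u : Reg} {s : ℝ}
    (hx : HasDerivAt x u s) (h0 : x s ∈ RegDomain) :
    HasDerivAt (fun s => physQ m (x s)) (physQDeriv m (x s) u) s := by
  obtain ⟨h1, h2, h3, h4⟩ := hasDerivAt_reg hx
  have hn := hasDerivAt_sqrt_massNormSq hm h3 h0.2
  have hn0 := (sqrt_massNormSq_pos hm h0).ne'
  convert! (hasDerivAt_ofReal (h1.div hn hn0)).smul (hasDerivAt_levi h3) using 1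
  simp only [physQDeriv, Pi.div_apply]
  rw [add_comm]
  congr 3
  field_simp

theorem hasDerivAt_physP {m : Fin 3 → ℝ} (hm : ∀ i, 0 < m i) (μ : ℝ) {x : ℝ → Reg} {u : Reg}
    {s : ℝ} (hx : HasDerivAt x u s) (h0 : x s ∈ RegDomain) (hz : ∀ j, (x s).2.2.1 j ≠ 0) :
    HasDerivAt (fun s => physP m μ (x s)) (physPDeriv m μ (x s) u) s := by
  obtain ⟨h1, h2, h3, h4⟩ := hasDerivAt_reg hx
  have hn := hasDerivAt_sqrt_massNormSq hm h3 h0.2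
  have hn0 := (sqrt_massNormSq_pos hm h0).ne'
  have hr0 := h0.1.ne'
  have hd := (((hasDerivAt_ofReal (h2.div hn hn0)).add ((hasDerivAt_ofReal
    ((hasDerivAt_const s μ).div (hn.mul h1) (mul_ne_zero hn0 hr0))).mul_const Complex.I)).smul
    (hasDerivAt_massDual m (hasDerivAt_levi h3))).add
    ((hasDerivAt_ofReal (hn.div h1 hr0)).smul (hasDerivAt_zVec h3 h4 hz))
  have hev : (fun s => physP m μ (x s)) =ᶠ[𝓝 s] _ :=
    (hx.continuousAt.eventually_mem (isOpen_regDomain.mem_nhds h0)).mono fun t ht =>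
      physP_eq m μ ht.1.ne' (sqrt_massNormSq_pos hm ht).ne'
  refine HasDerivAt.congr_of_eventuallyEq ?_ hev
  convert! hd using 1
  simp only [physPDeriv, Pi.div_apply, Pi.mul_apply, Pi.add_apply]
  have e1 : u.2.1 / √(massNormSq m (levi (x s).2.2.1)) - (x s).2.1 * normDeriv m (x s).2.2.1 u.2.2.1
      / √(massNormSq m (levi (x s).2.2.1)) ^ 2 = (u.2.1 * √(massNormSq m (levi (x s).2.2.1))
      - (x s).2.1 * normDeriv m (x s).2.2.1 u.2.2.1) / √(massNormSq m (levi (x s).2.2.1)) ^ 2 := by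
    field_simp
  have e2 : -(μ * normDeriv m (x s).2.2.1 u.2.2.1 / (√(massNormSq m (levi (x s).2.2.1)) ^ 2
      * (x s).1)) - μ * u.1 / (√(massNormSq m (levi (x s).2.2.1)) * (x s).1 ^ 2)
      = (0 * (√(massNormSq m (levi (x s).2.2.1)) * (x s).1) - μ *
        (normDeriv m (x s).2.2.1 u.2.2.1 * (x s).1 + √(massNormSq m (levi (x s).2.2.1)) * u.1))
        / (√(massNormSq m (levi (x s).2.2.1)) * (x s).1) ^ 2 := by
    field_simp
    ring
  have e3 : normDeriv m (x s).2.2.1 u.2.2.1 / (x s).1 - √(massNormSq m (levi (x s).2.2.1)) * u.1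
      / (x s).1 ^ 2 = (normDeriv m (x s).2.2.1 u.2.2.1 * (x s).1
        - √(massNormSq m (levi (x s).2.2.1)) * u.1) / (x s).1 ^ 2 := by
    field_simp
  rw [e1, e2, e3]
  abel

theorem hasDerivAt_posOf (m : Fin 3 → ℝ) {A : ℝ → Fin 3 → ℂ} {A' : Fin 3 → ℂ} {s : ℝ}
    (hA : HasDerivAt A A' s) : HasDerivAt (fun s => posOf m (A s)) (posOf m A') s := by
  have h := hasDerivAt_pi.1 hA
  refine hasDerivAt_pi.2 fun i => ?_
  fin_cases i
  · exact (((h 0).const_mul _).sub ((h 1).const_mul _)).div_const _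
  · exact (((h 2).const_mul _).sub ((h 0).const_mul _)).div_const _
  · exact (((h 1).const_mul _).sub ((h 2).const_mul _)).div_const _

theorem hasDerivAt_momOf {A : ℝ → Fin 3 → ℂ} {A' : Fin 3 → ℂ} {s : ℝ}
    (hA : HasDerivAt A A' s) : HasDerivAt (fun s => momOf (A s)) (momOf A') s := by
  have h := hasDerivAt_pi.1 hA
  refine hasDerivAt_pi.2 fun i => ?_
  fin_cases i
  · exact (h 0).sub (h 1)
  · exact (h 2).sub (h 0)
  · exact (h 1).sub (h 2)

theorem hasDerivAt_line {E : Type*} [NormedAddCommGroup E] [NormedSpace ℝ E] (x u : E) :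
    HasDerivAt (fun t : ℝ => x + t • u) u 0 := by
  simpa using ((hasDerivAt_id (0 : ℝ)).smul_const u).const_add x

theorem fderiv_physMap {m : Fin 3 → ℝ} (hm : ∀ i, 0 < m i) (μ : ℝ) {x : Reg}
    (hx : x ∈ RegDomain) (hz : ∀ j, x.2.2.1 j ≠ 0) (u : Reg) :
    fderiv ℝ (physMap m μ) x u = (posOf m (physQDeriv m x u), momOf (physPDeriv m μ x u)) := by
  have hl := hasDerivAt_line x u
  have h0 : x + (0 : ℝ) • u = x := by simp
  have h1 := hasDerivAt_physQ hm hl (by rwa [h0])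
  have h2 := hasDerivAt_physP hm μ hl (by rwa [h0]) (by rwa [h0])
  have h3 := (hasDerivAt_posOf m h1).prodMk (hasDerivAt_momOf h2)
  rw [h0] at h3
  have h4 : HasFDerivAt (physMap m μ) (fderiv ℝ (physMap m μ) x) (x + (0 : ℝ) • u) := by
    rw [h0]
    exact ((contDiffAt_physMap hm μ hx hz).differentiableAt (by simp)).hasFDerivAt
  have h5 : HasDerivAt (fun t : ℝ => physMap m μ (x + t • u)) (fderiv ℝ (physMap m μ) x u) 0 :=
    HasFDerivAt.comp_hasDerivAt (l := physMap m μ) (0 : ℝ) h4 hl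
  exact h5.unique h3

/-! ### The map is symplectic -/

/-- `Z` is the cotangent lift of the squaring map: the tautological one-form is preserved. -/
theorem pairing_zVec_leviDeriv {z : Fin 3 → ℂ} (hz : ∀ j, z j ≠ 0) (η V : Fin 3 → ℂ) :
    pairing (zVec z η) (leviDeriv z V) = pairing η V := by
  simp only [pairing, zVec, leviDeriv]
  refine Finset.sum_congr rfl fun j _ => ?_
  have := hz j
  simp
  field_simp
  rw [map_ofNat]

theorem pairing_zVecDeriv_levi {z : Fin 3 → ℂ} (hz : ∀ j, z j ≠ 0) (η V ζ : Fin 3 → ℂ) :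
    pairing (zVecDeriv z η V ζ) (levi z) = (pairing ζ z - pairing η V) / 2 := by
  simp only [pairing, zVecDeriv, levi, ← Finset.sum_sub_distrib, Finset.sum_div]
  refine Finset.sum_congr rfl fun j _ => ?_
  have := hz j
  simp
  rw [map_ofNat]
  field_simp

/-- The extra sum is symmetric in `V` and `U`, so it cancels in the two-form. -/
theorem pairing_zVecDeriv_leviDeriv {z : Fin 3 → ℂ} (hz : ∀ j, z j ≠ 0)
    (η V ζ U : Fin 3 → ℂ) : pairing (zVecDeriv z η V ζ) (leviDeriv z U)
      = pairing ζ U - ∑ j, conj (η j) * V j * U j / z j := by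
  simp only [pairing, zVecDeriv, leviDeriv, ← Finset.sum_sub_distrib]
  refine Finset.sum_congr rfl fun j _ => ?_
  have := hz j
  simp
  rw [map_ofNat]
  field_simp

theorem sum_physQDeriv (m : Fin 3 → ℝ) {x u : Reg} (hx : x ∈ RegLevel) (hu : u ∈ RegTangent x) :
    ∑ j, physQDeriv m x u j = 0 := by
  have h1 : ∑ j, levi x.2.2.1 j = 0 := hx.2.2
  have h2 : ∑ j, leviDeriv x.2.2.1 u.2.2.1 j = 0 := by
    have := hu.2
    simp only [leviDeriv, mul_assoc, ← Finset.mul_sum, this, mul_zero]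
  simp only [physQDeriv, Pi.add_apply, Pi.smul_apply, smul_eq_mul, Finset.sum_add_distrib,
    ← Finset.mul_sum, h1, h2, mul_zero, add_zero]

/-- In relative coordinates, the radial pair and the cotangent lift of squaring give the canonical
form, and the momentum shift gives `-2μ` times the Fubini-Study form of the mass metric. All other
mixed terms cancel by tangency. -/
theorem bodyForm_physMap {m : Fin 3 → ℝ} (hm : ∀ i, 0 < m i) (μ : ℝ) {x : Reg}
    (hx : x ∈ RegFree) {u v : Reg} (hu : u ∈ RegTangent x) (hv : v ∈ RegTangent x) :
    bodyForm (fderiv ℝ (physMap m μ) x u) (fderiv ℝ (physMap m μ) x v) = regForm m μ x u v := by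
  have hn := sqrt_massNormSq_pos hm hx.1.1
  have hr := hx.1.1.1.ne'
  have hsq : massNormSq m (levi x.2.2.1) = √(massNormSq m (levi x.2.2.1)) ^ 2 :=
    (Real.sq_sqrt (massNormSq_nonneg hm _)).symm
  have hcurv := massForm_eq_curvForm hm hx.1.1.2 hx.1.2.2 hu.2 hv.2
  rw [fderiv_physMap hm μ hx.1.1 hx.2, fderiv_physMap hm μ hx.1.1 hx.2, bodyForm,
    pairing_momOf_posOf hm _ (sum_physQDeriv m hx.1 hu),
    pairing_momOf_posOf hm _ (sum_physQDeriv m hx.1 hv), regForm_eq, mul_assoc (2 * μ)]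
  change _ = _ - 2 * μ * curvForm m _ _ _
  rw [← hcurv]
  have half (w : ℂ) : (-w - w) / 2 = -w := by ring
  -- Tangency to `⟨η, z⟩ = 0` eliminates these pairings.
  have eu : pairing u.2.2.2 x.2.2.1 = -pairing x.2.2.2 u.2.2.1 :=
    eq_neg_of_add_eq_zero_left hu.1
  have ev : pairing v.2.2.2 x.2.2.1 = -pairing x.2.2.2 v.2.2.1 :=
    eq_neg_of_add_eq_zero_left hv.1
  have hsym : ∑ j, conj (x.2.2.2 j) * v.2.2.1 j * u.2.2.1 j / x.2.2.1 j
      = ∑ j, conj (x.2.2.2 j) * u.2.2.1 j * v.2.2.1 j / x.2.2.1 j :=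
    Finset.sum_congr rfl fun j _ => by ring
  have hnu : (pairing (massDual m (levi x.2.2.1)) (leviDeriv x.2.2.1 u.2.2.1)).re
      = √(massNormSq m (levi x.2.2.1)) * normDeriv m x.2.2.1 u.2.2.1 := by
    rw [normDeriv]
    field_simp
  have hnv : (pairing (massDual m (levi x.2.2.1)) (leviDeriv x.2.2.1 v.2.2.1)).re
      = √(massNormSq m (levi x.2.2.1)) * normDeriv m x.2.2.1 v.2.2.1 := by
    rw [normDeriv]
    field_simp
  simp only [physPDeriv, physQDeriv, pairing_add_left, pairing_add_right, pairing_smul_left,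
    pairing_smul_right, pairing_zVec_levi, hx.1.2.1, pairing_zVec_leviDeriv hx.2,
    pairing_zVecDeriv_levi hx.2, pairing_zVecDeriv_leviDeriv hx.2, eu, ev, hsym, half,
    pairing_massDual_self, canonForm]
  rw [← conj_pairing_massDual m (levi x.2.2.1) (leviDeriv x.2.2.1 u.2.2.1),
    ← conj_pairing_massDual m (levi x.2.2.1) (leviDeriv x.2.2.1 v.2.2.1),
    ← conj_pairing_massDual m (leviDeriv x.2.2.1 u.2.2.1) (leviDeriv x.2.2.1 v.2.2.1)]
  generalize √(massNormSq m (levi x.2.2.1)) = n at *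
  rw [hsq]
  generalize pairing (massDual m (levi x.2.2.1)) (leviDeriv x.2.2.1 u.2.2.1) = au at *
  generalize pairing (massDual m (levi x.2.2.1)) (leviDeriv x.2.2.1 v.2.2.1) = av at *
  generalize pairing (massDual m (leviDeriv x.2.2.1 u.2.2.1)) (leviDeriv x.2.2.1 v.2.2.1) = g at *
  generalize ∑ j, conj (x.2.2.2 j) * u.2.2.1 j * v.2.2.1 j / x.2.2.1 j = sy at *
  generalize pairing x.2.2.2 u.2.2.1 = pu at *
  generalize pairing x.2.2.2 v.2.2.1 = pv at *
  generalize pairing u.2.2.2 v.2.2.1 = puv at *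
  generalize pairing v.2.2.2 u.2.2.1 = pvu at *
  generalize normDeriv m x.2.2.1 u.2.2.1 = nu at *
  generalize normDeriv m x.2.2.1 v.2.2.1 = nv at *
  -- The real part of `⟨X*, dX⟩` is `|X| d|X|`; after substituting it, a rational identity in real
  -- variables remains.
  obtain ⟨aur, aui⟩ := au
  obtain ⟨avr, avi⟩ := av
  simp only at hnu hnv
  subst hnu hnv
  have hn0 := hn.ne'
  simp only [map_add, map_mul, Complex.conj_ofReal, Complex.conj_I,
    Complex.add_re, Complex.add_im, Complex.sub_re, Complex.sub_im, Complex.mul_re, Complex.mul_im,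
    Complex.ofReal_re, Complex.ofReal_im, Complex.conj_re, Complex.conj_im, Complex.I_re,
    Complex.I_im, Complex.neg_re, Complex.neg_im]
  field_simp
  ring

end PlanarThreeBody
end

noncomputable section
namespace PlanarThreeBody

/-! ### The Newtonian vector field -/

/-- The covector `d(-∑ mᵢmⱼ/|Qᵢⱼ|)` in relative coordinates. -/
def forceVec (m : Fin 3 → ℝ) (Q : Fin 3 → ℂ) : Fin 3 → ℂ := fun j =>
  ((pairMass m j / ‖Q j‖ ^ 3 : ℝ) : ℂ) * Q j

/-- The Newtonian vector field with explicit forces. -/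
def newtonField (m : Fin 3 → ℝ) (y : Body) : Body :=
  (fun i => y.2 i / (m i : ℂ), -momOf (forceVec m (relPos y.1)))

theorem hasDerivAt_relPos {q : ℝ → Fin 3 → ℂ} {q' : Fin 3 → ℂ} {s : ℝ} (hq : HasDerivAt q q' s) :
    HasDerivAt (fun s => relPos (q s)) (relPos q') s := by
  have h := hasDerivAt_pi.1 hq
  refine hasDerivAt_pi.2 fun j => ?_
  fin_cases j
  · exact (h 0).sub (h 1)
  · exact (h 2).sub (h 0)
  · exact (h 1).sub (h 2)

theorem contDiff_relPos_apply (j : Fin 3) : ContDiff ℝ ∞ fun q : Fin 3 → ℂ => relPos q j := by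
  fin_cases j
  · exact (contDiff_apply ℝ ℂ 0).sub (contDiff_apply ℝ ℂ 1)
  · exact (contDiff_apply ℝ ℂ 2).sub (contDiff_apply ℝ ℂ 0)
  · exact (contDiff_apply ℝ ℂ 1).sub (contDiff_apply ℝ ℂ 2)

theorem continuous_relPos : Continuous relPos :=
  continuous_pi fun j => (contDiff_relPos_apply j).continuous

theorem contDiffAt_norm_relPos {y : Body} (hy : Function.Injective y.1) (j : Fin 3) :
    ContDiffAt ℝ ∞ (fun y : Body => ‖relPos y.1 j‖) y :=
  ContDiffAt.norm ℝ (((contDiff_relPos_apply j).comp contDiff_fst).contDiffAt)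
    (relPos_ne_zero_iff.1 hy j)

theorem contDiffAt_bodyH {m : Fin 3 → ℝ} {y : Body} (hy : Function.Injective y.1) :
    ContDiffAt ℝ ∞ (bodyH m) y := by
  refine ContDiffAt.sub (ContDiffAt.sum fun i _ => ?_) (ContDiffAt.sum fun j _ => ?_)
  · exact ((((contDiff_apply ℝ ℂ i).comp contDiff_snd).norm_sq ℝ).div_const _).contDiffAt
  · exact contDiffAt_const.div (contDiffAt_norm_relPos hy j)
      (norm_ne_zero_iff.2 (relPos_ne_zero_iff.1 hy j))

theorem hasDerivAt_norm_sq {f : ℝ → ℂ} {f' : ℂ} {s : ℝ} (hf : HasDerivAt f f' s) :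
    HasDerivAt (fun s => ‖f s‖ ^ 2) (2 * (conj (f s) * f').re) s := by
  convert! hf.norm_sq using 1
  rw [Complex.inner]
  ring_nf

theorem hasDerivAt_norm_inv {f : ℝ → ℂ} {f' : ℂ} {s : ℝ} (hf : HasDerivAt f f' s)
    (h0 : f s ≠ 0) : HasDerivAt (fun s => ‖f s‖⁻¹) (-(conj (f s) * f').re / ‖f s‖ ^ 3) s := by
  have hn : ‖f s‖ ≠ 0 := norm_ne_zero_iff.2 h0
  have h1 := ((hasDerivAt_norm_sq hf).sqrt (pow_ne_zero 2 hn)).inv (by simpa using hn)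
  simp only [Real.sqrt_sq (norm_nonneg _)] at h1
  convert! h1 using 1
  field_simp

theorem fderiv_bodyH {m : Fin 3 → ℝ} {y : Body} (hy : Function.Injective y.1)
    (v : Body) : fderiv ℝ (bodyH m) y v = (pairing v.2 (fun i => y.2 i / (m i : ℂ))).re
      + (pairing (momOf (forceVec m (relPos y.1))) v.1).re := by
  have hl := hasDerivAt_line y v
  have h0 : y + (0 : ℝ) • v = y := by simp
  have h4 : HasFDerivAt (bodyH m) (fderiv ℝ (bodyH m) y) (y + (0 : ℝ) • v) := by
    rw [h0]
    exact ((contDiffAt_bodyH hy).differentiableAt (by simp)).hasFDerivAt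
  have h5 : HasDerivAt (fun t : ℝ => bodyH m (y + t • v)) (fderiv ℝ (bodyH m) y v) 0 :=
    HasFDerivAt.comp_hasDerivAt (l := bodyH m) (0 : ℝ) h4 hl
  have h1 : HasDerivAt (fun t : ℝ => (y + t • v).1) v.1 0 := hl.fst
  have h2 : HasDerivAt (fun t : ℝ => (y + t • v).2) v.2 0 := hl.snd
  have h3 := hasDerivAt_relPos h1
  have h6 : HasDerivAt (fun t : ℝ => bodyH m (y + t • v)) _ 0 :=
    (HasDerivAt.fun_sum (u := Finset.univ) fun i _ =>
      (hasDerivAt_norm_sq ((hasDerivAt_pi.1 h2) i)).div_const (2 * m i)).sub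
    (HasDerivAt.fun_sum (u := Finset.univ) fun j _ =>
      (hasDerivAt_norm_inv ((hasDerivAt_pi.1 h3) j) (by
        rw [h0]; exact relPos_ne_zero_iff.1 hy j)).const_mul (pairMass m j))
  rw [h5.unique h6, h0, pairing_momOf, sub_eq_add_neg, ← Finset.sum_neg_distrib, pairing, pairing,
    Complex.re_sum, Complex.re_sum]
  congr 1 <;> refine Finset.sum_congr rfl fun j _ => ?_
  · rw [← mul_div_assoc, Complex.div_ofReal_re]
    simp
    ring
  · simp only [forceVec, map_mul, Complex.conj_ofReal, mul_assoc, Complex.re_ofReal_mul]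
    ring

theorem bodyField_eq {m : Fin 3 → ℝ} {y : Body} (hy : Function.Injective y.1) :
    bodyField m y = newtonField m y := by
  have hd : HasFDerivAt (bodyH m) (fderiv ℝ (bodyH m) y) (y.1, y.2) :=
    ((contDiffAt_bodyH hy).differentiableAt (by simp)).hasFDerivAt
  have h1 : HasFDerivAt (fun q => bodyH m (q, y.2)) _ y.1 :=
    hd.comp (g := bodyH m) y.1 (hasFDerivAt_prodMk_left (𝕜 := ℝ) y.1 y.2)
  have h2 : HasFDerivAt (fun p => bodyH m (y.1, p)) _ y.2 :=
    hd.comp (g := bodyH m) y.2 (hasFDerivAt_prodMk_right (𝕜 := ℝ) y.1 y.2)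
  refine Prod.ext ?_ ?_
  · refine eq_of_re_pairing_right fun V => ?_
    simp only [bodyField, re_pairing_complexGrad, h2.fderiv, newtonField]
    simp only [ContinuousLinearMap.comp_apply, ContinuousLinearMap.inr_apply, fderiv_bodyH hy]
    rw [pairing_re_comm]
    simp [pairing]
  · have e : (bodyField m y).2 = -complexGrad (fun q => bodyH m (q, y.2)) y.1 := rfl
    rw [e, newtonField, neg_inj]
    refine eq_of_re_pairing_right fun V => ?_
    rw [re_pairing_complexGrad, h1.fderiv]
    simp only [ContinuousLinearMap.comp_apply, ContinuousLinearMap.inl_apply, fderiv_bodyH hy]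
    simp [pairing]

theorem bodyForm_bodyField {m : Fin 3 → ℝ} {y : Body} (hy : Function.Injective y.1) (v : Body) :
    bodyForm (bodyField m y) v = fderiv ℝ (bodyH m) y v := by
  rw [bodyField_eq hy, fderiv_bodyH hy, bodyForm]
  simp only [newtonField, pairing_neg_left, Complex.neg_re, sub_neg_eq_add]

theorem continuousAt_newtonField (m : Fin 3 → ℝ) {y : Body} (hy : Function.Injective y.1) :
    ContinuousAt (newtonField m) y := by
  have h1 (j : Fin 3) : ContinuousAt (fun y : Body => forceVec m (relPos y.1) j) y := by
    have h2 : ContinuousAt (fun y : Body => relPos y.1 j) y :=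
      ((contDiff_relPos_apply j).continuous.comp continuous_fst).continuousAt
    exact (Complex.continuous_ofReal.continuousAt.comp (continuousAt_const.div (h2.norm.pow 3)
      (pow_ne_zero 3 (norm_ne_zero_iff.2 (relPos_ne_zero_iff.1 hy j))))).mul h2
  refine ContinuousAt.prodMk (continuousAt_pi.2 fun i => ?_) (continuousAt_pi.2 fun i => ?_)
  · exact (((continuous_apply i).comp continuous_snd).div_const _).continuousAt
  · refine ContinuousAt.neg ?_
    fin_cases i
    · exact (h1 0).sub (h1 1)
    · exact (h1 2).sub (h1 0)
    · exact (h1 1).sub (h1 2)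

theorem relPos_rotate (u a : ℂ) (q : Fin 3 → ℂ) :
    relPos (fun i => u * q i + a) = u • relPos q := by
  funext j
  fin_cases j <;> simp [relPos] <;> ring

theorem injective_rotate {u : ℂ} (hu : ‖u‖ = 1) (a : ℂ) {q : Fin 3 → ℂ}
    (hq : Function.Injective q) : Function.Injective (fun i => u * q i + a) := by
  have hu0 : u ≠ 0 := by rintro rfl; simp at hu
  intro i j hij
  simpa [hu0, hq.eq_iff] using hij

theorem newtonField_rotate (m : Fin 3 → ℝ) {u : ℂ} (hu : ‖u‖ = 1) (a : ℂ) (y : Body) :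
    newtonField m (fun i => u * y.1 i + a, fun i => u * y.2 i) = u • newtonField m y := by
  refine Prod.ext ?_ ?_
  · funext i
    simp [newtonField, mul_div_assoc]
  · funext i
    simp only [newtonField, relPos_rotate, Prod.smul_snd, Pi.smul_apply, Pi.neg_apply, smul_eq_mul]
    have h : forceVec m (u • relPos y.1) = u • forceVec m (relPos y.1) := by
      funext j
      simp only [forceVec, Pi.smul_apply, smul_eq_mul, norm_mul, hu, one_mul]
      ring
    rw [h]
    fin_cases i <;> simp [momOf] <;> ring

theorem bodyH_rotate (m : Fin 3 → ℝ) {u : ℂ} (hu : ‖u‖ = 1) (a : ℂ) (y : Body) :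
    bodyH m (fun i => u * y.1 i + a, fun i => u * y.2 i) = bodyH m y := by
  simp [bodyH, relPos_rotate, hu]

theorem rotate_mem_bodyLevel {μ : ℝ} {u : ℂ} (hu : ‖u‖ = 1) (a : ℂ) {y : Body}
    (hy : y ∈ BodyLevel μ) :
    ((fun i => u * y.1 i + a, fun i => u * y.2 i) : Body) ∈ BodyLevel μ := by
  refine ⟨injective_rotate hu a hy.1, by simp [← Finset.mul_sum, hy.2.1], ?_⟩
  have e (i : Fin 3) : conj (u * y.1 i + a) * (u * y.2 i)
      = conj (y.1 i) * y.2 i + conj a * u * y.2 i := by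
    have : conj u * u = 1 := by rw [Complex.conj_mul', hu]; simp
    rw [map_add, map_mul]
    linear_combination (conj (y.1 i) * y.2 i) * this
  simp only [e, Complex.add_im, Finset.sum_add_distrib, hy.2.2, ← Complex.im_sum,
    ← Finset.mul_sum, hy.2.1, mul_zero, Complex.zero_im, add_zero]

theorem sum_newtonField_snd (m : Fin 3 → ℝ) (y : Body) : ∑ i, (newtonField m y).2 i = 0 := by
  simp [newtonField, sum_momOf]

theorem sum_mass_mul_newtonField_fst {m : Fin 3 → ℝ} (hm : ∀ i, 0 < m i) {y : Body}
    (hy : ∑ i, y.2 i = 0) : ∑ i, (m i : ℂ) * (newtonField m y).1 i = 0 := by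
  rw [← hy]
  refine Finset.sum_congr rfl fun i _ => ?_
  have : (m i : ℂ) ≠ 0 := by exact_mod_cast (hm i).ne'
  simp only [newtonField]
  field_simp

/-- The angular momentum is a first integral. -/
theorem im_pairing_newtonField (m : Fin 3 → ℝ) (y : Body) :
    (pairing (newtonField m y).2 y.1 + pairing y.2 (newtonField m y).1).im = 0 := by
  simp only [newtonField, pairing_neg_left, pairing_momOf]
  rw [Complex.add_im, Complex.neg_im, pairing, pairing, Complex.im_sum, Complex.im_sum,
    Finset.sum_eq_zero, Finset.sum_eq_zero, neg_zero, add_zero]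
  · intro i _
    rw [← mul_div_assoc, Complex.conj_mul', ← Complex.ofReal_pow, ← Complex.ofReal_div,
      Complex.ofReal_im]
  · intro j _
    rw [forceVec, map_mul, mul_assoc, Complex.conj_mul', Complex.conj_ofReal,
      ← Complex.ofReal_pow, ← Complex.ofReal_mul, Complex.ofReal_im]

end PlanarThreeBody
end

noncomputable section
namespace PlanarThreeBody

/-! ### Lifts of states of the three bodies -/

/-- A relative covector with given momenta of the bodies. -/
def relMom (p : Fin 3 → ℂ) : Fin 3 → ℂ := ![0, -p 0, p 1]

theorem momOf_relMom {p : Fin 3 → ℂ} (hp : ∑ i, p i = 0) : momOf (relMom p) = p := by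
  rw [Fin.sum_univ_three] at hp
  funext i
  fin_cases i
  · simp [momOf, relMom]
  · simp [momOf, relMom]
  · simp only [momOf, relMom]
    simp
    linear_combination -hp

/-- The lift with `levi z` as relative positions and `p` as momenta. -/
def lift (m : Fin 3 → ℝ) (μ : ℝ) (p z : Fin 3 → ℂ) : Reg :=
  (√(massNormSq m (levi z)), (pairing (relMom p) (levi z)).re / √(massNormSq m (levi z)), z,
    fun j => 2 * conj (z j) * (relMom p j
      - (((pairing (relMom p) (levi z)).re / massNormSq m (levi z) : ℝ)
        + (μ / massNormSq m (levi z) : ℝ) * Complex.I) * massDual m (levi z) j))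

/-- Stated for arbitrary `p` and nonzero `z`, so that `⟨η, z⟩` can be differentiated along curves of
lifts whose angular momentum is `μ` only to first order. -/
theorem pairing_lift {m : Fin 3 → ℝ} (hm : ∀ i, 0 < m i) (μ : ℝ) (p : Fin 3 → ℂ) {z : Fin 3 → ℂ}
    (hz : z ≠ 0) : pairing (lift m μ p z).2.2.2 z
      = 2 * ((pairing (relMom p) (levi z)).im + μ : ℝ) * Complex.I := by
  have hn : (massNormSq m (levi z) : ℂ) ≠ 0 := by exact_mod_cast (massNormSq_levi_pos hm hz).ne'
  obtain ⟨w, hw⟩ : ∃ w : ℂ, w = ((pairing (relMom p) (levi z)).re / massNormSq m (levi z) : ℝ)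
      + (μ / massNormSq m (levi z) : ℝ) * Complex.I := ⟨_, rfl⟩
  have h : pairing (lift m μ p z).2.2.2 z = 2 * (pairing (relMom p) (levi z)
      - conj w * pairing (massDual m (levi z)) (levi z)) := by
    rw [lift, ← hw, ← pairing_smul_left, ← pairing_sub_left]
    simp only [pairing, Finset.mul_sum]
    refine Finset.sum_congr rfl fun j _ => ?_
    simp only [levi, map_mul, map_sub, Complex.conj_conj, Pi.sub_apply, Pi.smul_apply,
      smul_eq_mul, map_ofNat]
    ring
  rw [h, pairing_massDual_self, hw]
  simp only [map_add, map_mul, Complex.conj_ofReal, Complex.conj_I]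
  push_cast
  field_simp
  linear_combination -(Complex.re_add_im (pairing (relMom p) (levi z)))

theorem lift_mem_regDomain {m : Fin 3 → ℝ} (hm : ∀ i, 0 < m i) (μ : ℝ) (p : Fin 3 → ℂ)
    {z : Fin 3 → ℂ} (hz : z ≠ 0) : lift m μ p z ∈ RegDomain :=
  ⟨Real.sqrt_pos.2 (massNormSq_levi_pos hm hz), hz⟩

theorem lift_mem_regLevel {m : Fin 3 → ℝ} (hm : ∀ i, 0 < m i) {μ : ℝ} {p z : Fin 3 → ℂ}
    (hz : z ≠ 0) (hs : ∑ j, z j ^ 2 = 0) (hp : (pairing (relMom p) (levi z)).im = -μ) :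
    lift m μ p z ∈ RegLevel :=
  ⟨lift_mem_regDomain hm μ p hz, by
    change pairing (lift m μ p z).2.2.2 z = 0
    rw [pairing_lift hm μ p hz, hp]; simp, hs⟩

theorem physQ_lift {m : Fin 3 → ℝ} (hm : ∀ i, 0 < m i) (μ : ℝ) (p : Fin 3 → ℂ) {z : Fin 3 → ℂ}
    (hz : z ≠ 0) : physQ m (lift m μ p z) = levi z := by
  funext j
  simp [physQ, lift, div_self (Real.sqrt_pos.2 (massNormSq_levi_pos hm hz)).ne']

theorem physMap_lift {m : Fin 3 → ℝ} (hm : ∀ i, 0 < m i) (μ : ℝ) {p z : Fin 3 → ℂ}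
    (hp : ∑ i, p i = 0) (hz : ∀ j, z j ≠ 0) :
    physMap m μ (lift m μ p z) = (posOf m (levi z), p) := by
  have hz0 : z ≠ 0 := fun h => hz 0 (by simp [h])
  have hn := (Real.sqrt_pos.2 (massNormSq_levi_pos hm hz0)).ne'
  have hsq : massNormSq m (levi z) = √(massNormSq m (levi z)) ^ 2 :=
    (Real.sq_sqrt (massNormSq_nonneg hm _)).symm
  have hP : physP m μ (lift m μ p z) = relMom p := by
    rw [physP_eq m μ (x := lift m μ p z) hn hn]
    funext j
    have := hz j
    have hn' : (√(massNormSq m (levi z)) : ℂ) ≠ 0 := by exact_mod_cast hn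
    have hc : conj (z j) ≠ 0 := by simpa using this
    simp only [lift, Pi.add_apply, Pi.smul_apply, smul_eq_mul, zVec]
    generalize √(massNormSq m (levi z)) = n at *
    rw [hsq]
    push_cast
    field_simp
    ring
  rw [physMap_eq, physQ_lift hm μ p hz0, hP, momOf_relMom hp]

theorem contDiff_relMom : ContDiff ℝ ∞ relMom := by
  refine contDiff_pi.2 fun j => ?_
  fin_cases j
  · exact contDiff_const
  · exact (contDiff_apply ℝ ℂ 0).neg
  · exact contDiff_apply ℝ ℂ 1

theorem contDiff_pairing {E : Type*} [NormedAddCommGroup E] [NormedSpace ℝ E]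
    {A B : E → Fin 3 → ℂ} (hA : ContDiff ℝ ∞ A) (hB : ContDiff ℝ ∞ B) :
    ContDiff ℝ ∞ fun x => pairing (A x) (B x) :=
  ContDiff.sum fun j _ => (contDiff_conj_comp (contDiff_pi.1 hA j)).mul (contDiff_pi.1 hB j)

theorem contDiffAt_lift {m : Fin 3 → ℝ} (hm : ∀ i, 0 < m i) (μ : ℝ) {p z : Fin 3 → ℂ}
    (hz : z ≠ 0) : ContDiffAt ℝ ∞ (fun y : Body => lift m μ y.1 y.2) (p, z) := by
  have hn := (massNormSq_levi_pos hm hz).ne'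
  have cof : ∀ {f : Body → ℝ}, ContDiffAt ℝ ∞ f (p, z) →
      ContDiffAt ℝ ∞ (fun x => (f x : ℂ)) (p, z) :=
    fun hf => Complex.ofRealCLM.contDiff.contDiffAt.comp (p, z) hf
  have h1 : ContDiff ℝ ∞ fun y : Body => levi y.2 := contDiff_levi.comp contDiff_snd
  have h2 : ContDiff ℝ ∞ fun y : Body => massNormSq m (levi y.2) :=
    (contDiff_massNormSq m).comp h1
  have h3 : ContDiff ℝ ∞ fun y : Body => relMom y.1 := contDiff_relMom.comp contDiff_fst
  have h4 : ContDiff ℝ ∞ fun y : Body => (pairing (relMom y.1) (levi y.2)).re :=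
    Complex.reCLM.contDiff.comp (contDiff_pairing h3 h1)
  have h5 : ContDiffAt ℝ ∞ (fun y : Body => √(massNormSq m (levi y.2))) (p, z) :=
    h2.contDiffAt.sqrt hn
  have h6 (j : Fin 3) : ContDiff ℝ ∞ fun y : Body => y.2 j :=
    (contDiff_apply ℝ ℂ j).comp contDiff_snd
  refine h5.prodMk ((h4.contDiffAt.div h5 (Real.sqrt_ne_zero'.2 (massNormSq_levi_pos hm hz))).prodMk
    (contDiff_snd.contDiffAt.prodMk (contDiffAt_pi.2 fun j => ?_)))
  refine (contDiffAt_const.mul (contDiff_conj_comp (h6 j)).contDiffAt).mul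
    ((contDiff_pi.1 h3 j).contDiffAt.sub (((cof (h4.contDiffAt.div h2.contDiffAt hn)).add
      ((cof (contDiffAt_const.div h2.contDiffAt hn)).mul contDiffAt_const)).mul ?_))
  exact contDiffAt_const.mul (contDiff_pi.1 h1 j).contDiffAt

/-- The constants are the kernel of `momOf`; upstairs this ambiguity is the translation of `η`. -/
theorem exists_eq_add_of_momOf_eq {P P' : Fin 3 → ℂ} (h : momOf P = momOf P') :
    ∃ a : ℂ, ∀ j, P j = P' j + a := by
  have h0 := congrFun h 0
  have h1 := congrFun h 1
  simp only [momOf] at h0 h1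
  simp at h0 h1
  refine ⟨P 0 - P' 0, fun j => ?_⟩
  fin_cases j
  · simp
  · simp
    linear_combination -h0
  · simp
    linear_combination h1

/-- Up to symmetries, every point is the lift of the state that it represents. -/
theorem exists_regAct_eq_lift {m : Fin 3 → ℝ} (hm : ∀ i, 0 < m i) (μ : ℝ) {x : Reg}
    (hx : x ∈ RegFree) : ∃ k : ℝ, ∃ c : ℂ, 0 < k ∧
      regAct k c x = lift m μ (physMap m μ x).2 (fun j => k * x.2.2.1 j) ∧
      levi (fun j => k * x.2.2.1 j) = physQ m x := by
  have hn := sqrt_massNormSq_pos hm hx.1.1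
  have hr := hx.1.1.1
  set n := √(massNormSq m (levi x.2.2.1)) with hn_def
  -- The positive scaling for which the squares `(k z)²` are the actual relative positions `Q = r X
  -- / |X|`.
  set k := √(x.1 / n) with hk_def
  have hk : 0 < k := Real.sqrt_pos.2 (div_pos hr hn)
  have hk2 : k ^ 2 = x.1 / n := Real.sq_sqrt (div_pos hr hn).le
  have hX : levi (fun j => k * x.2.2.1 j) = physQ m x := by
    rw [levi_smul]
    funext j
    rw [physQ, ← hn_def, ← hk2]
    push_cast
    rfl
  have hsum := sum_physQ m hx.1
  -- `relMom` normalizes one component to zero; the discrepancy `a` becomes the translation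
  -- parameter.
  obtain ⟨a, ha⟩ := exists_eq_add_of_momOf_eq
    (momOf_relMom (sum_momOf (physP m μ x)))
  have hnorm : massNormSq m (physQ m x) = x.1 ^ 2 := by
    rw [← hX, massNormSq_levi_smul, ← Real.sq_sqrt (massNormSq_nonneg hm (levi x.2.2.1)),
      ← hn_def, Complex.norm_real, Real.norm_of_nonneg hk.le]
    have : k ^ 4 = (x.1 / n) ^ 2 := by rw [← hk2]; ring
    rw [this]
    field_simp
  have hre : pairing (relMom (momOf (physP m μ x))) (physQ m x)
      = (x.1 * x.2.1 : ℝ) - μ * Complex.I := by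
    rw [← pairing_physP_physQ hm μ hx.1]
    have : relMom (momOf (physP m μ x)) = physP m μ x + fun _ => a := funext ha
    rw [this, pairing_add_left]
    simp [pairing, ← Finset.mul_sum, hsum]
  refine ⟨k, a, hk, ?_, hX⟩
  have e : (physMap m μ x).2 = momOf (physP m μ x) := rfl
  rw [e, lift, hX, hre, hnorm, Real.sqrt_sq hr.le]
  refine Prod.ext rfl (Prod.ext ?_ (Prod.ext rfl (funext fun j => ?_)))
  · simp [regAct]
    field_simp
  · have hz := hx.2 j
    have hc : conj (x.2.2.1 j) ≠ 0 := by simpa using hz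
    have hP := congrFun (physP_eq m μ hr.ne' hn.ne') j
    have hQ : massDual m (physQ m x) j = ((x.1 / n : ℝ) : ℂ) * massDual m (levi x.2.2.1) j := by
      simp only [massDual, physQ, ← hn_def]
      ring
    dsimp only [regAct]
    rw [ha j, hP, hQ]
    have hk2' : (k : ℂ) ^ 2 = x.1 / n := by exact_mod_cast hk2
    have hn' : (n : ℂ) ≠ 0 := by exact_mod_cast hn.ne'
    have hr' : (x.1 : ℂ) ≠ 0 := by exact_mod_cast hr.ne'
    have hk' : (k : ℂ) ≠ 0 := by exact_mod_cast hk.ne'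
    simp only [← hn_def, Pi.add_apply, Pi.smul_apply, smul_eq_mul, zVec]
    simp
    field_simp at hk2' ⊢
    linear_combination -(n * x.2.2.2 j) * hk2'

end PlanarThreeBody
end

noncomputable section
namespace PlanarThreeBody

/-! ### The map of quotients -/

theorem regAct_regAct {k k' : ℂ} (hk : k ≠ 0) (hk' : k' ≠ 0) (c c' : ℂ) (x : Reg) :
    regAct k' c' (regAct k c x) = regAct (k' * k) (c' + c / conj k' ^ 2) x := by
  have h1 : conj k ≠ 0 := by simpa using hk
  have h2 : conj k' ≠ 0 := by simpa using hk'
  refine Prod.ext rfl (Prod.ext rfl (Prod.ext ?_ ?_))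
  · ext j; simp only [regAct]; ring
  · ext j; simp only [regAct, map_mul]; field_simp; ring

theorem regAct_mem_regFree {k : ℂ} (hk : k ≠ 0) (c : ℂ) {x : Reg} (hx : x ∈ RegFree) :
    regAct k c x ∈ RegFree :=
  ⟨regAct_mem_regLevel hk c hx.1, fun j => mul_ne_zero hk (hx.2 j)⟩

theorem exists_levi_eq (Q : Fin 3 → ℂ) : ∃ z, levi z = Q := by
  choose z hz using fun j => IsAlgClosed.exists_pow_nat_eq (Q j) two_pos
  exact ⟨z, funext hz⟩

theorem lift_mem_regFree {m : Fin 3 → ℝ} (hm : ∀ i, 0 < m i) {μ : ℝ} {y : Body}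
    (hy : y ∈ BodyLevel μ) {z : Fin 3 → ℂ} (hz : levi z = relPos y.1) :
    lift m μ y.2 z ∈ RegFree := by
  have hz0 (j : Fin 3) : z j ≠ 0 := fun h => relPos_ne_zero_iff.1 hy.1 j (by simp [← hz, levi, h])
  refine ⟨lift_mem_regLevel hm (fun h => hz0 0 (by simp [h])) ?_ ?_, hz0⟩
  · change ∑ j, levi z j = 0
    rw [hz, sum_relPos]
  · rw [hz, ← pairing_momOf, momOf_relMom hy.2.1, ← hy.2.2, angularMomentum_eq, neg_neg]

theorem bodySetoid_physMap_lift {m : Fin 3 → ℝ} (hm : ∀ i, 0 < m i) {μ : ℝ} {y : Body}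
    (hy : y ∈ BodyLevel μ) {z : Fin 3 → ℂ} (hz : levi z = relPos y.1) :
    bodySetoid (physMap m μ (lift m μ y.2 z)) y := by
  rw [physMap_lift hm μ (z := z) hy.2.1 (lift_mem_regFree hm hy hz).2, hz, posOf_relPos hm]
  exact ⟨1, (∑ i, (m i : ℂ) * y.1 i) / ((∑ i, m i : ℝ) : ℂ), by simp, by simp⟩

/-- A rotation of the bodies by `u = v²` comes from scaling `z` by the unit number `v`; a real
scaling and a translation then put the point in the form of a lift. -/
theorem exists_regAct_eq_lift_of_bodySetoid {m : Fin 3 → ℝ} (hm : ∀ i, 0 < m i) {μ : ℝ} {x : Reg}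
    (hx : x ∈ RegFree) {y : Body} (hxy : bodySetoid (physMap m μ x) y) :
    ∃ k c : ℂ, k ≠ 0 ∧ regAct k c x = lift m μ y.2 (fun j => k * x.2.2.1 j) ∧
      levi (fun j => k * x.2.2.1 j) = relPos y.1 := by
  obtain ⟨u, a, hu, rfl⟩ := hxy
  obtain ⟨v, rfl⟩ := IsAlgClosed.exists_pow_nat_eq u two_pos
  have hv : ‖v‖ = 1 := by
    rw [norm_pow] at hu
    exact (pow_eq_one_iff_of_nonneg (norm_nonneg v) two_ne_zero).1 hu
  have hv0 : v ≠ 0 := by rintro rfl; simp at hv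
  have hx' := regAct_mem_regFree hv0 0 hx
  obtain ⟨k, c, hk, h1, h2⟩ := exists_regAct_eq_lift hm μ hx'
  have hk' : (k : ℂ) ≠ 0 := by exact_mod_cast hk.ne'
  rw [← relPos_physMap hm μ hx'.1] at h2
  rw [physMap_regAct m μ hv0 0 hx.2] at h1 h2
  rw [regAct_regAct hv0 hk'] at h1
  simp only [hv, one_pow, Complex.ofReal_one, div_one] at h1 h2
  have e : (fun j => (k : ℂ) * (regAct v 0 x).2.2.1 j) = fun j => k * v * x.2.2.1 j :=
    funext fun j => (mul_assoc _ _ _).symm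
  rw [e] at h1 h2
  refine ⟨k * v, _, mul_ne_zero hk' hv0, h1, ?_⟩
  rw [h2, relPos_rotate]
  have := relPos_rotate (v ^ 2) 0 (physMap m μ x).1
  rw [← this]
  simp only [add_zero]
  rfl

/-- The common sign of the three square roots is a symmetry, so the eight choices of roots give four
classes. -/
theorem lift_neg (m : Fin 3 → ℝ) (μ : ℝ) (p z : Fin 3 → ℂ) :
    lift m μ p (fun j => -z j) = regAct (-1) 0 (lift m μ p z) := by
  have h : levi (fun j => -z j) = levi z := by funext j; simp [levi]
  rw [lift, h]
  refine Prod.ext rfl (Prod.ext rfl (Prod.ext ?_ ?_)) <;> funext j <;> simp [regAct, lift, div_neg]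

variable {m : Fin 3 → ℝ} {μ : ℝ}

/-- The map of quotients induced by `physMap`. -/
def quotMap (hm : ∀ i, 0 < m i) (μ : ℝ) : RegFreeQuotient → BodyQuotient μ :=
  Quotient.lift (fun x => Quotient.mk _ ⟨physMap m μ x, physMap_mem_bodyLevel hm μ x.2⟩) <| by
    rintro x ⟨_, hx'⟩ ⟨k, c, hk, rfl⟩
    exact Quotient.sound (bodySetoid_physMap_regAct m μ hk c x.2.2)

theorem quotMap_mk_eq_iff (hm : ∀ i, 0 < m i) (x : RegFree) (y : BodyLevel μ) :
    quotMap hm μ (Quotient.mk _ x) = Quotient.mk _ y ↔ bodySetoid (physMap m μ x) y :=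
  Quotient.eq

theorem continuous_quotMap (hm : ∀ i, 0 < m i) (μ : ℝ) : Continuous (quotMap hm μ) := by
  refine Continuous.quotient_lift (continuous_quotient_mk'.comp (Continuous.subtype_mk ?_ _)) _
  exact continuous_iff_continuousAt.2 fun x =>
    (contDiffAt_physMap hm μ x.2.1.1 x.2.2).continuousAt.comp continuousAt_subtype_val

/-- The ratios `z_j / z_0`. -/
def ratio (j : Fin 3) : RegFreeQuotient → ℂ :=
  Quotient.lift (fun x => (x : Reg).2.2.1 j / (x : Reg).2.2.1 0) <| by
    rintro x ⟨_, hx'⟩ ⟨k, c, hk, rfl⟩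
    exact (mul_div_mul_left _ _ hk).symm

theorem continuous_ratio (j : Fin 3) : Continuous (ratio j) :=
  Continuous.quotient_lift (((contDiff_z_apply j).continuous.comp continuous_subtype_val).div
    ((contDiff_z_apply 0).continuous.comp continuous_subtype_val) fun x => x.2.2 0) _

theorem ratio_ne_zero (j : Fin 3) (q : RegFreeQuotient) : ratio j q ≠ 0 := by
  induction q using Quotient.inductionOn with
  | h x => exact div_ne_zero (x.2.2 j) (x.2.2 0)

theorem exists_lift_eq (hm : ∀ i, 0 < m i) {q : RegFreeQuotient} {y : BodyLevel μ}
    (hq : quotMap hm μ q = Quotient.mk _ y) :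
    ∃ (z : Fin 3 → ℂ) (hz : levi z = relPos (y : Body).1),
      q = Quotient.mk _ ⟨lift m μ (y : Body).2 z, lift_mem_regFree hm y.2 hz⟩ := by
  induction q using Quotient.inductionOn with
  | h x =>
    rw [quotMap_mk_eq_iff] at hq
    obtain ⟨k, c, hk, h1, h2⟩ := exists_regAct_eq_lift_of_bodySetoid hm x.2 hq
    exact ⟨_, h2, Quotient.sound ⟨k, c, hk, h1.symm⟩⟩

theorem mk_lift_neg (hm : ∀ i, 0 < m i) {y : BodyLevel μ} {z z' : Fin 3 → ℂ}
    (hz : levi z = relPos (y : Body).1) (hz' : levi z' = relPos (y : Body).1)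
    (h : ∀ j, z' j = -z j) :
    (Quotient.mk _ ⟨lift m μ (y : Body).2 z, lift_mem_regFree hm y.2 hz⟩ : RegFreeQuotient)
      = Quotient.mk _ ⟨lift m μ (y : Body).2 z', lift_mem_regFree hm y.2 hz'⟩ := by
  obtain rfl : z' = fun j => -z j := funext h
  exact Quotient.sound ⟨-1, 0, by simp, lift_neg m μ _ z⟩

/-- Over one base point the ratios `z_j / z_0` are determined up to sign. If no sign flips, the
roots agree up to the common sign, which is a symmetry. -/
theorem eq_of_ratio_sq_ne_neg (hm : ∀ i, 0 < m i) {q q' : RegFreeQuotient}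
    (h : quotMap hm μ q = quotMap hm μ q') (hr : ∀ j, ratio j q ≠ -ratio j q') : q = q' := by
  obtain ⟨y, hy⟩ := Quotient.exists_rep (quotMap hm μ q')
  obtain ⟨z, hz, rfl⟩ := exists_lift_eq hm (h.trans hy.symm)
  obtain ⟨z', hz', rfl⟩ := exists_lift_eq hm hy.symm
  have hzz (j : Fin 3) : z j ^ 2 = z' j ^ 2 := congrFun (hz.trans hz'.symm) j
  have h0 (j : Fin 3) : z j ≠ 0 := (lift_mem_regFree hm y.2 hz).2 j
  have h0' (j : Fin 3) : z' j ≠ 0 := (lift_mem_regFree hm y.2 hz').2 j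
  have hr' (j : Fin 3) : z j / z 0 = z' j / z' 0 := by
    have hsq : (z j / z 0) ^ 2 = (z' j / z' 0) ^ 2 := by rw [div_pow, div_pow, hzz, hzz]
    exact (sq_eq_sq_iff_eq_or_eq_neg.1 hsq).resolve_right (hr j)
  rcases sq_eq_sq_iff_eq_or_eq_neg.1 (hzz 0) with h1 | h1
  · have : z = z' := funext fun j => by
      have := hr' j
      rw [h1, div_left_inj' (h0' 0)] at this
      exact this
    subst this
    rfl
  · refine mk_lift_neg hm hz hz' fun j => ?_
    have := hr' j
    rw [h1, div_neg, ← neg_div, div_left_inj' (h0' 0)] at this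
    exact this.symm

theorem surjective_quotMap (hm : ∀ i, 0 < m i) (μ : ℝ) : Function.Surjective (quotMap hm μ) := by
  intro b
  obtain ⟨y, rfl⟩ := Quotient.exists_rep b
  obtain ⟨z, hz⟩ := exists_levi_eq (relPos (y : Body).1)
  exact ⟨Quotient.mk _ ⟨_, lift_mem_regFree hm y.2 hz⟩,
    (quotMap_mk_eq_iff hm _ y).2 (bodySetoid_physMap_lift hm y.2 hz)⟩

theorem isOpenMap_quotMap (hm : ∀ i, 0 < m i) (μ : ℝ) : IsOpenMap (quotMap hm μ) := by
  intro V hV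
  change IsOpen (Quotient.mk _ ⁻¹' (quotMap hm μ '' V))
  rw [isOpen_iff_mem_nhds]
  rintro y ⟨q, hqV, hq⟩
  obtain ⟨z, hz, rfl⟩ := exists_lift_eq hm hq
  -- A local section through `q`: the root of `Q'_j / Q_j`, a number near `1`, is taken on the
  -- principal branch. Continuity at the single point `y` is enough for openness.
  let Z : BodyLevel μ → Fin 3 → ℂ := fun y' j =>
    z j * (relPos (y' : Body).1 j / relPos (y : Body).1 j) ^ (((2 : ℕ) : ℂ)⁻¹)
  have hy0 := relPos_ne_zero_iff.1 y.2.1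
  have hZ (y' : BodyLevel μ) : levi (Z y') = relPos (y' : Body).1 := by
    funext j
    have hj : z j ^ 2 = relPos (y : Body).1 j := congrFun hz j
    have := hy0 j
    rw [levi, mul_pow, Complex.cpow_nat_inv_pow _ two_ne_zero, hj]
    field_simp
  have hZy : Z y = z := by
    funext j
    simp [Z, div_self (hy0 j)]
  have hcont (j : Fin 3) : ContinuousAt (fun y' : BodyLevel μ =>
      relPos (y' : Body).1 j / relPos (y : Body).1 j) y :=
    (((contDiff_relPos_apply j).continuous.comp
      (continuous_fst.comp continuous_subtype_val)).div_const _).continuousAt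
  have hZc : ContinuousAt Z y := by
    refine continuousAt_pi.2 fun j => continuousAt_const.mul ?_
    refine ContinuousAt.cpow (hcont j) continuousAt_const ?_
    simp [div_self (hy0 j)]
  have hLc : ContinuousAt (fun y' : BodyLevel μ => lift m μ (y' : Body).2 (Z y')) y := by
    have h1 : ContinuousAt (fun y : Body => lift m μ y.1 y.2) ((y : Body).2, Z y) :=
      (contDiffAt_lift hm μ (by
        rw [hZy]; exact (lift_mem_regFree hm y.2 hz).1.1.2)).continuousAt
    have h2 : ContinuousAt (fun y' : BodyLevel μ => (((y' : Body).2, Z y') : Body)) y :=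
      (continuous_snd.comp continuous_subtype_val).continuousAt.prodMk hZc
    generalize Z = W at h1 h2 ⊢
    exact ContinuousAt.comp (g := fun y : Body => lift m μ y.1 y.2)
      (f := fun y' : BodyLevel μ => (((y' : Body).2, W y') : Body)) h1 h2
  let s : BodyLevel μ → RegFree := fun y' => ⟨_, lift_mem_regFree hm y'.2 (hZ y')⟩
  have hsc : ContinuousAt s y := IsInducing.subtypeVal.continuousAt_iff.2 hLc
  have hs : ContinuousAt (fun y' => (Quotient.mk _ (s y') : RegFreeQuotient)) y :=
    ContinuousAt.comp (g := fun x : RegFree => (Quotient.mk _ x : RegFreeQuotient))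
      continuous_quotient_mk'.continuousAt hsc
  have hV' : V ∈ 𝓝 (Quotient.mk _ (s y) : RegFreeQuotient) := by
    refine hV.mem_nhds ?_
    convert! hqV using 3
    simp only [hZy]
  filter_upwards [hs hV'] with y' hy'
  exact ⟨_, hy', (quotMap_mk_eq_iff hm _ y').2 (bodySetoid_physMap_lift hm y'.2 (hZ y'))⟩

theorem isLocalHomeomorph_quotMap (hm : ∀ i, 0 < m i) (μ : ℝ) :
    IsLocalHomeomorph (quotMap hm μ) := by
  rw [isLocalHomeomorph_iff_isOpenEmbedding_restrict]
  intro q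
  -- The half-plane conditions exclude sign flips of the ratios, so that `U` contains at most one
  -- sheet over each point.
  let U : Set RegFreeQuotient := {q' | ∀ j, 0 < (ratio j q' / ratio j q).re}
  have hU : IsOpen U := by
    simp only [U, ofPred_forall]
    exact isOpen_iInter_of_finite fun j => isOpen_lt continuous_const
      (Complex.continuous_re.comp ((continuous_ratio j).div_const _))
  refine ⟨U, hU.mem_nhds fun j => by simp [div_self (ratio_ne_zero j q)],
    IsOpenEmbedding.of_continuous_injective_isOpenMap
      ((continuous_quotMap hm μ).comp continuous_subtype_val) ?_
      ((isOpenMap_quotMap hm μ).domRestrict hU)⟩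
  rintro ⟨q₁, h₁⟩ ⟨q₂, h₂⟩ h
  refine Subtype.ext (eq_of_ratio_sq_ne_neg hm h fun j hj => ?_)
  have := h₁ j
  rw [hj, neg_div, Complex.neg_re] at this
  linarith [h₂ j]

theorem ncard_quotMap_fiber (hm : ∀ i, 0 < m i) (b : BodyQuotient μ) :
    (quotMap hm μ ⁻¹' {b}).ncard = 4 := by
  obtain ⟨y, rfl⟩ := Quotient.exists_rep b
  obtain ⟨z, hz⟩ := exists_levi_eq (relPos (y : Body).1)
  -- The common sign is used to fix the root `z 0`; the other two signs enumerate the fibre.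
  let Z : ℤˣ × ℤˣ → Fin 3 → ℂ := fun e => ![z 0, (e.1 : ℤ) * z 1, (e.2 : ℤ) * z 2]
  have hsq (e : ℤˣ) : ((e : ℤ) : ℂ) ^ 2 = 1 := by
    rcases Int.units_eq_one_or e with rfl | rfl <;> simp
  have hZ (e) : levi (Z e) = relPos (y : Body).1 := by
    rw [← hz]
    funext j
    fin_cases j <;> simp [levi, Z, mul_pow, hsq]
  let g : ℤˣ × ℤˣ → RegFreeQuotient := fun e => Quotient.mk _ ⟨_, lift_mem_regFree hm y.2 (hZ e)⟩
  have h0 (j : Fin 3) : z j ≠ 0 := (lift_mem_regFree hm y.2 hz).2 j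
  have hg : Function.Injective g := by
    intro e e' h
    have h1 : (e.1 : ℤ) * z 1 / z 0 = (e'.1 : ℤ) * z 1 / z 0 := congrArg (ratio 1) h
    have h2 : (e.2 : ℤ) * z 2 / z 0 = (e'.2 : ℤ) * z 2 / z 0 := congrArg (ratio 2) h
    rw [div_left_inj' (h0 0), mul_left_inj' (h0 _), Int.cast_inj, Units.val_inj] at h1 h2
    exact Prod.ext h1 h2
  have hr : quotMap hm μ ⁻¹' {Quotient.mk _ y} = g '' univ := by
    ext q
    rw [image_univ]
    constructor
    · intro hq
      obtain ⟨z', hz', rfl⟩ := exists_lift_eq hm hq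
      have hzz (j : Fin 3) : ∃ u : ℤˣ, z' j = (u : ℤ) * z j := by
        rcases sq_eq_sq_iff_eq_or_eq_neg.1 (congrFun (hz'.trans hz.symm) j) with h | h
        · exact ⟨1, by simpa using h⟩
        · exact ⟨-1, by simpa using h⟩
      choose u hu using hzz
      refine ⟨(u 1 * u 0, u 2 * u 0), ?_⟩
      rcases Int.units_eq_one_or (u 0) with h | h
      · have : Z (u 1 * u 0, u 2 * u 0) = z' := by
          funext j
          fin_cases j <;> simp [Z, hu, h]
        simp only [g, this]
      · refine mk_lift_neg hm (hZ _) hz' fun j => ?_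
        fin_cases j <;> simp [Z, hu, h]
    · rintro ⟨e, rfl⟩
      exact (quotMap_mk_eq_iff hm _ y).2 (bodySetoid_physMap_lift hm y.2 (hZ e))
  rw [hr, ncard_image_of_injective _ hg, ncard_univ, Nat.card_eq_fintype_card]
  decide

end PlanarThreeBody
end

noncomputable section
namespace PlanarThreeBody

/-! ### Comparison of the vector fields -/

theorem hasDerivAt_comp_of_contDiffAt {E F : Type*} [NormedAddCommGroup E] [NormedSpace ℝ E]
    [NormedAddCommGroup F] [NormedSpace ℝ F] {f : E → F} {γ : ℝ → E} {v : E} {s : ℝ}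
    (hf : ContDiffAt ℝ ∞ f (γ s)) (hγ : HasDerivAt γ v s) :
    HasDerivAt (fun t => f (γ t)) (fderiv ℝ f (γ s) v) s :=
  HasFDerivAt.comp_hasDerivAt s ((hf.differentiableAt (by simp)).hasFDerivAt) hγ

theorem hasDerivAt_im {f : ℝ → ℂ} {f' : ℂ} {s : ℝ} (hf : HasDerivAt f f' s) :
    HasDerivAt (fun s => (f s).im) f'.im s :=
  Complex.imCLM.hasFDerivAt.comp_hasDerivAt s hf

theorem eventually_regFree {γ : ℝ → Reg} {t₀ : ℝ} (h0 : γ t₀ ∈ RegFree) (hγ : ContinuousAt γ t₀)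
    (h : ∀ᶠ t in 𝓝 t₀, γ t ∈ RegLevel) : ∀ᶠ t in 𝓝 t₀, γ t ∈ RegFree := by
  have h1 : ∀ᶠ t in 𝓝 t₀, ∀ j, (γ t).2.2.1 j ≠ 0 := eventually_all.2 fun j =>
    ((contDiff_z_apply j).continuous.continuousAt.comp hγ).eventually_ne (h0.2 j)
  filter_upwards [h, h1] with t ht ht1 using ⟨ht, ht1⟩

/-- `H̃ = τ (H ∘ Ψ - h)` is differentiated along a curve in the level set, the only place where it
holds. At zero energy the term with `dτ` disappears. -/
theorem fderiv_regH_of_regFree {m : Fin 3 → ℝ} (hm : ∀ i, 0 < m i) {μ h : ℝ} {x v : Reg}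
    (hx : x ∈ RegFree) (hH : regH m μ h x = 0) (hv : v ∈ RegTangent x) :
    fderiv ℝ (regH m μ h) x v
      = tau x.2.2.1 * fderiv ℝ (bodyH m) (physMap m μ x) (fderiv ℝ (physMap m μ) x v) := by
  obtain ⟨γ, h0, hγ, hl⟩ := exists_curve_regLevel hx.1 hv
  have hfree := eventually_regFree (h0.symm ▸ hx) hγ.continuousAt hl
  have hτ := tau_pos hx.2
  have hE : bodyH m (physMap m μ x) - h = 0 := by
    have := regH_eq_tau_mul hm μ h hx
    rw [hH] at this
    exact (mul_eq_zero.1 this.symm).resolve_left hτ.ne'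
  subst h0
  have h1 := hasDerivAt_comp_of_contDiffAt (contDiffAt_regH hm μ h hx.1.1) hγ
  have h2 := hasDerivAt_comp_of_contDiffAt (contDiffAt_physMap hm μ hx.1.1 hx.2) hγ
  have h3 := hasDerivAt_comp_of_contDiffAt
    (contDiffAt_bodyH (m := m) (physMap_mem_bodyLevel hm μ hx).1) h2
  have h4 := hasDerivAt_comp_of_contDiffAt (contDiffAt_tau hx.1.1.2) (hasDerivAt_reg hγ).2.2.1
  have h5 := h4.mul (h3.sub_const h)
  have h6 := h5.congr_of_eventuallyEq (f₁ := fun t => regH m μ h (γ t)) (by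
    filter_upwards [hfree] with t ht using regH_eq_tau_mul hm μ h ht)
  rw [h1.unique h6, hE]
  simp

/-- `Ψ` is symplectic and `dH̃ = τ Ψ* dH` at zero energy, so `u` and `τ⁻¹ v` have the same
contraction with the degenerate form. Their difference lies in its kernel. -/
theorem eq_regField_of_fderiv_physMap {m : Fin 3 → ℝ} (hm : ∀ i, 0 < m i) {μ h : ℝ} {x u : Reg}
    (hx : x ∈ RegFree) (hH : regH m μ h x = 0) (hu : u ∈ RegTangent x)
    (hd : fderiv ℝ (physMap m μ) x u = newtonField m (physMap m μ x)) :
    ∃ κ c : ℂ, u = (tau x.2.2.1)⁻¹ • regField m μ h x + (0, 0, fun j => κ * x.2.2.1 j,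
      fun j => -conj κ * x.2.2.2 j + c * conj (x.2.2.1 j)) := by
  have hτ := tau_pos hx.2
  have hF := regField_mem_regTangent hm μ h hx.1
  have hy := (physMap_mem_bodyLevel hm μ hx).1
  have hsub : u - (tau x.2.2.1)⁻¹ • regField m μ h x ∈ RegTangent x := by
    constructor
    · have h1 := hu.1
      have h2 := hF.1
      simp only [Prod.snd_sub, Prod.fst_sub, Prod.smul_snd, Prod.smul_fst, pairing_sub_left,
        pairing_sub_right, pairing_real_smul_left, pairing_real_smul_right]
      linear_combination h1 - ((tau x.2.2.1)⁻¹ : ℝ) * h2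
    · have h1 := hu.2
      have h2 := hF.2
      simp only [Prod.snd_sub, Prod.fst_sub, Prod.smul_snd, Prod.smul_fst, Pi.sub_apply,
        Pi.smul_apply, Complex.real_smul, mul_sub, Finset.sum_sub_distrib, h1, zero_sub,
        mul_left_comm, ← Finset.mul_sum, h2, mul_zero, neg_zero]
  have hker : ∀ v ∈ RegTangent x,
      regForm m μ x (u - (tau x.2.2.1)⁻¹ • regField m μ h x) v = 0 := by
    intro v hv
    have h1 := regForm_regField_tangent hm μ h hx.1 hv
    rw [← bodyForm_physMap hm μ hx hF hv, fderiv_regH_of_regFree hm hx hH hv] at h1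
    rw [← bodyForm_physMap hm μ hx hsub hv, map_sub, map_smul, hd, ← bodyField_eq hy]
    have h2 := bodyForm_bodyField (m := m) hy (fderiv ℝ (physMap m μ) x v)
    rw [← h2] at h1
    simp only [bodyForm] at h1 ⊢
    simp only [Prod.snd_sub, Prod.fst_sub, Prod.smul_snd, Prod.smul_fst, pairing_sub_left,
        pairing_sub_right, pairing_real_smul_left, pairing_real_smul_right, Complex.sub_re,
        Complex.re_ofReal_mul]
    field_simp
    linear_combination -h1
  obtain ⟨κ, c, hκ⟩ := (regForm_kernel m μ hx.1 _).1 ⟨hsub, hker⟩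
  exact ⟨κ, c, by rw [← hκ]; abel⟩

theorem hasDerivAt_relMom {p : ℝ → Fin 3 → ℂ} {p' : Fin 3 → ℂ} {s : ℝ} (hp : HasDerivAt p p' s) :
    HasDerivAt (fun s => relMom (p s)) (relMom p') s := by
  have h := hasDerivAt_pi.1 hp
  refine hasDerivAt_pi.2 fun j => ?_
  fin_cases j
  · exact hasDerivAt_const s 0
  · exact (h 0).neg
  · exact h 1

theorem hasDerivAt_lift {m : Fin 3 → ℝ} (hm : ∀ i, 0 < m i) (μ : ℝ) {p z : ℝ → Fin 3 → ℂ}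
    {p' z' : Fin 3 → ℂ} {s : ℝ} (hp : HasDerivAt p p' s) (hz : HasDerivAt z z' s)
    (hz0 : z s ≠ 0) : HasDerivAt (fun s => lift m μ (p s) (z s))
      (fderiv ℝ (fun y : Body => lift m μ y.1 y.2) (p s, z s) (p', z')) s := by
  exact hasDerivAt_comp_of_contDiffAt (f := fun y : Body => lift m μ y.1 y.2)
    (γ := fun s => (p s, z s)) (contDiffAt_lift hm μ hz0) (hp.prodMk hz)

/-- The derivative of a curve of lifts is tangent, if the angular momentum is constant to first
order. -/
theorem deriv_lift_mem_regTangent {m : Fin 3 → ℝ} (hm : ∀ i, 0 < m i) (μ : ℝ)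
    {p z : ℝ → Fin 3 → ℂ} {p' z' : Fin 3 → ℂ} {L' : Reg} {s : ℝ} (hp : HasDerivAt p p' s)
    (hz : HasDerivAt z z' s) (hz0 : z s ≠ 0)
    (hL : HasDerivAt (fun s => lift m μ (p s) (z s)) L' s) (h0 : ∑ j, z s j * z' j = 0)
    (h1 : (pairing (relMom p') (levi (z s)) + pairing (relMom (p s)) (leviDeriv (z s) z')).im = 0) :
    L' ∈ RegTangent (lift m μ (p s) (z s)) := by
  have hL' := hasDerivAt_reg hL
  have hz1 : z' = L'.2.2.1 := hz.unique hL'.2.2.1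
  refine ⟨?_, by rw [← hz1]; exact h0⟩
  have h2 := hasDerivAt_pairing hL'.2.2.2 hL'.2.2.1
  have h3 := hasDerivAt_pairing (hasDerivAt_relMom hp) (hasDerivAt_levi hz)
  have h4 := ((((hasDerivAt_im h3).add_const μ).ofReal_comp).const_mul (2 : ℂ)).mul_const Complex.I
  refine h2.unique ?_
  rw [h1] at h4
  have h5 := h4.congr_of_eventuallyEq
    (f₁ := fun s => pairing (lift m μ (p s) (z s)).2.2.2 (lift m μ (p s) (z s)).2.2.1) (by
      filter_upwards [hz.continuousAt.eventually_ne hz0] with t ht using pairing_lift hm μ _ ht)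
  simpa using h5

theorem regAct_mem_regTangent {k : ℂ} (hk : k ≠ 0) (c : ℂ) {x u : Reg} (hu : u ∈ RegTangent x) :
    regAct k c u ∈ RegTangent (regAct k c x) := by
  have h2 : ∑ j, u.2.2.1 j * x.2.2.1 j = 0 := by simpa only [mul_comm] using hu.2
  constructor
  · rw [pairing_regAct hk, pairing_regAct hk, h2, hu.2, mul_zero, add_zero, add_zero]
    exact hu.1
  · have e (j : Fin 3) : k * x.2.2.1 j * (k * u.2.2.1 j) = k ^ 2 * (x.2.2.1 j * u.2.2.1 j) := by
      ring
    simp only [regAct, e, ← Finset.mul_sum, hu.2, mul_zero]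

theorem posOf_relPos_of_sum {m : Fin 3 → ℝ} (hm : ∀ i, 0 < m i) {q : Fin 3 → ℂ}
    (hq : ∑ i, (m i : ℂ) * q i = 0) : posOf m (relPos q) = q := by
  rw [posOf_relPos hm, hq]
  simp

theorem regAct_inv {k : ℂ} (hk : k ≠ 0) (c : ℂ) (x : Reg) :
    regAct k⁻¹ (-(c * conj k ^ 2)) (regAct k c x) = x := by
  have hk' : conj k ≠ 0 := by simpa using hk
  rw [regAct_regAct hk (inv_ne_zero hk), inv_mul_cancel₀ hk, map_inv₀]
  have : -(c * conj k ^ 2) + c / (conj k)⁻¹ ^ 2 = 0 := by field_simp; ring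
  rw [this]
  simp [regAct]

/-- A first-order motion of the bodies is lifted at an equivalent point of the form `lift m μ p w`,
and the velocity is carried back by the inverse symmetry. Only first-order conservation of angular
momentum is needed for tangency. -/
theorem exists_fderiv_physMap_eq {m : Fin 3 → ℝ} (hm : ∀ i, 0 < m i) (μ : ℝ) {x : Reg}
    (hx : x ∈ RegFree) : ∃ u ∈ RegTangent x,
      fderiv ℝ (physMap m μ) x u = newtonField m (physMap m μ x) := by
  obtain ⟨k, c, hk, h1, h2⟩ := exists_regAct_eq_lift hm μ hx
  have hk' : (k : ℂ) ≠ 0 := by exact_mod_cast hk.ne'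
  have hki : ((k : ℂ)⁻¹) ≠ 0 := inv_ne_zero hk'
  rw [← relPos_physMap hm μ hx.1] at h2
  have hy := physMap_mem_bodyLevel hm μ hx
  have hx₁ := regAct_inv hk' c x
  rw [h1] at hx₁
  set w : Fin 3 → ℂ := fun j => k * x.2.2.1 j with hw
  set y := physMap m μ x with hy_def
  have hw0 (j : Fin 3) : w j ≠ 0 := mul_ne_zero hk' (hx.2 j)
  have hw0' : w ≠ 0 := fun h => hw0 0 (by simp [h])
  obtain ⟨y', hy'⟩ : ∃ y', y' = newtonField m y := ⟨_, rfl⟩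
  -- Solves `2 w ζ = Q'`, so that `w² = Q` persists to first order.
  let ζ : Fin 3 → ℂ := fun j => relPos y'.1 j / (2 * w j)
  have hζ : leviDeriv w ζ = relPos y'.1 := by
    funext j
    have := hw0 j
    simp only [leviDeriv, ζ]
    field_simp
  have hp := hasDerivAt_line y.2 y'.2
  have hZ := hasDerivAt_line w ζ
  have e0 : y.2 + (0 : ℝ) • y'.2 = y.2 := by simp
  have e1 : w + (0 : ℝ) • ζ = w := by simp
  have hsum' : ∑ i, (m i : ℂ) * y'.1 i = 0 := hy' ▸ sum_mass_mul_newtonField_fst hm hy.2.1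
  have hsum2 : ∑ i, y'.2 i = 0 := hy' ▸ sum_newtonField_snd m y
  have hL := hasDerivAt_lift hm μ hp hZ (by rwa [e1])
  have hT := deriv_lift_mem_regTangent hm μ hp hZ (by rwa [e1]) hL (by
    have : ∑ j, leviDeriv w ζ j = 0 := by rw [hζ, sum_relPos]
    rw [e1]
    simpa [leviDeriv, mul_assoc, ← Finset.mul_sum] using this) (by
    rw [e0, e1, h2, hζ, ← pairing_momOf, ← pairing_momOf, momOf_relMom hsum2,
      momOf_relMom hy.2.1, hy']
    exact im_pairing_newtonField m y)
  generalize fderiv ℝ (fun y : Body => lift m μ y.1 y.2)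
    (y.2 + (0 : ℝ) • y'.2, w + (0 : ℝ) • ζ) (y'.2, ζ) = L' at hL hT
  rw [e0, e1] at hT
  obtain ⟨c', hc'⟩ : ∃ c', c' = -(c * conj (k : ℂ) ^ 2) := ⟨_, rfl⟩
  rw [← hc'] at hx₁
  have hT' := regAct_mem_regTangent hki c' hT
  rw [hx₁] at hT'
  refine ⟨_, hT', ?_⟩
  have hγ : HasDerivAt (fun t : ℝ => regAct (k : ℂ)⁻¹ c' (lift m μ (y.2 + t • y'.2) (w + t • ζ)))
      (regAct (k : ℂ)⁻¹ c' L') 0 := (regActL (k : ℂ)⁻¹ c').hasFDerivAt.comp_hasDerivAt 0 hL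
  have hγ0 : regAct (k : ℂ)⁻¹ c' (lift m μ (y.2 + (0 : ℝ) • y'.2) (w + (0 : ℝ) • ζ)) = x := by
    rw [e0, e1, hx₁]
  have h3 := hasDerivAt_comp_of_contDiffAt (f := physMap m μ) (by
    rw [hγ0]; exact contDiffAt_physMap hm μ hx.1.1 hx.2) hγ
  rw [hγ0] at h3
  have h4 := (hasDerivAt_posOf m (hasDerivAt_levi hZ)).prodMk hp
  rw [e1, hζ, posOf_relPos_of_sum hm hsum'] at h4
  rw [← hy']
  refine h3.unique (h4.congr_of_eventuallyEq ?_)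
  have h5 : ∀ᶠ t : ℝ in 𝓝 0, ∀ j, (w + t • ζ) j ≠ 0 := eventually_all.2 fun j =>
    (hasDerivAt_pi.1 hZ j).continuousAt.eventually_ne (by rw [e1]; exact hw0 j)
  filter_upwards [h5] with t ht
  rw [physMap_regAct m μ hki c' ht, physMap_lift hm μ _ ht]
  -- The scaling factor is a positive real number and therefore induces no rotation.
  · have : (k : ℂ)⁻¹ ^ 2 / ((‖(k : ℂ)⁻¹‖ ^ 2 : ℝ) : ℂ) = 1 := by
      rw [norm_inv, Complex.norm_real, Real.norm_of_nonneg hk.le]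
      push_cast
      exact div_self (pow_ne_zero 2 hki)
    rw [this, one_smul]
  · simp [Finset.sum_add_distrib, ← Finset.mul_sum, hsum2, hy.2.1]

/-- The angular velocity of the frame in which the regularized flow is a three-body motion. -/
def spin (m : Fin 3 → ℝ) (μ h : ℝ) (x : Reg) : ℝ :=
  (pairing (massDual m (levi x.2.2.1)) (leviDeriv x.2.2.1 (regField m μ h x).2.2.1)).im
    / massNormSq m (levi x.2.2.1) - tau x.2.2.1 * μ / x.1 ^ 2

/-- The scaling `e^{tκ}` rotates the bodies by `e^{t(κ - conj κ)}`, while translations of `η` act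
trivially. -/
theorem fderiv_physMap_orbit {m : Fin 3 → ℝ} (hm : ∀ i, 0 < m i) (μ : ℝ) {x : Reg}
    (hx : x ∈ RegFree) (κ c : ℂ) :
    fderiv ℝ (physMap m μ) x (0, 0, fun j => κ * x.2.2.1 j,
      fun j => -conj κ * x.2.2.2 j + c * conj (x.2.2.1 j)) = (κ - conj κ) • physMap m μ x := by
  have h0 : regAct (Complex.exp ((0 : ℝ) * κ)) ((0 : ℝ) * (c / 2)) x = x := by simp [regAct]
  have h1 := hasDerivAt_comp_of_contDiffAt (f := physMap m μ) (by
    rw [h0]; exact contDiffAt_physMap hm μ hx.1.1 hx.2) (hasDerivAt_regAct_orbit κ c x)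
  rw [h0] at h1
  have h2 := hasDerivAt_cexp_smul κ
  have h3 := (h2.div (hasDerivAt_conj h2) (by simp)).smul_const (physMap m μ x)
  refine h1.unique ((h3.congr_of_eventuallyEq (Eventually.of_forall fun t => ?_)).congr_deriv ?_)
  · have he := Complex.exp_ne_zero (t * κ)
    have he' : conj (Complex.exp (t * κ)) ≠ 0 := by simp
    simp only [Pi.div_apply]
    rw [physMap_regAct m μ he _ hx.2, Complex.ofReal_pow, ← Complex.conj_mul']
    congr 1
    field_simp
  · simp

/-- A lift of the Newtonian field equals `τ⁻¹ v` up to a symmetry direction, whose image is an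
infinitesimal rotation. It remains to identify the angular velocity by a formula that stays regular
at collisions. -/
theorem fderiv_physMap_regField {m : Fin 3 → ℝ} (hm : ∀ i, 0 < m i) {μ h : ℝ} {x : Reg}
    (hx : x ∈ RegFree) (hH : regH m μ h x = 0) :
    fderiv ℝ (physMap m μ) x (regField m μ h x) = tau x.2.2.1 • newtonField m (physMap m μ x)
      + ((spin m μ h x : ℂ) * Complex.I) • physMap m μ x := by
  obtain ⟨u, hu, hd⟩ := exists_fderiv_physMap_eq hm μ hx
  obtain ⟨κ, c, rfl⟩ := eq_regField_of_fderiv_physMap hm hx hH hu hd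
  have hτ := (tau_pos hx.2).ne'
  have hF := regField_mem_regTangent hm μ h hx.1
  have hy := physMap_mem_bodyLevel hm μ hx
  rw [map_add, fderiv_physMap_orbit hm μ hx, map_smul] at hd
  have key : fderiv ℝ (physMap m μ) x (regField m μ h x)
      = tau x.2.2.1 • newtonField m (physMap m μ x)
        + ((-(2 * tau x.2.2.1 * κ.im) : ℝ) * Complex.I) • physMap m μ x := by
    rw [← hd, smul_add, smul_inv_smul₀ hτ, add_assoc, ← Complex.coe_smul (tau x.2.2.1), smul_smul,
      ← add_smul]
    have : (tau x.2.2.1 : ℂ) * (κ - conj κ) + (-(2 * tau x.2.2.1 * κ.im) : ℝ) * Complex.I = 0 := by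
      rw [Complex.sub_conj]
      push_cast
      ring
    rw [this, zero_smul, add_zero]
  generalize -(2 * tau x.2.2.1 * κ.im) = a at key
  rw [key]
  congr 4
  have hn := massNormSq_levi_pos hm hx.1.1.2
  have hr := hx.1.1.1.ne'
  have hsum := sum_physQ m hx.1
  -- The imaginary part of the pairing with the mass-weighted positions isolates the angular
  -- velocity: the positions contribute `r²`, the Newtonian velocity contributes `μ`.
  have h1 := congrArg (fun y : Body =>
    (pairing (momOf (massDual m (physQ m x))) y.1).im) key
  have h2 : (fderiv ℝ (physMap m μ) x (regField m μ h x)).1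
      = posOf m (physQDeriv m x (regField m μ h x)) := by
    rw [fderiv_physMap hm μ hx.1.1 hx.2]
  have h3 : pairing (momOf (massDual m (physQ m x))) (physMap m μ x).1
      = ((x.1 / √(massNormSq m (levi x.2.2.1))) ^ 2 * massNormSq m (levi x.2.2.1) : ℝ) := by
    rw [physMap_eq, pairing_momOf_posOf hm _ hsum, physQ_eq, massDual_smul, pairing_smul_left,
      pairing_smul_right, pairing_massDual_self, Complex.conj_ofReal]
    push_cast
    ring
  have h4 : (pairing (momOf (massDual m (physQ m x))) (newtonField m (physMap m μ x)).1).im = μ := by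
    refine Eq.trans ?_ hy.2.2
    rw [pairing, Complex.im_sum]
    refine Finset.sum_congr rfl fun i _ => ?_
    have : (m i : ℂ) ≠ 0 := by exact_mod_cast (hm i).ne'
    rw [momOf_massDual, map_mul, Complex.conj_ofReal, newtonField, physMap_eq]
    congr 1
    field_simp
  have h5 : pairing (massDual m (physQ m x)) (physQDeriv m x (regField m μ h x))
      = ((x.1 / √(massNormSq m (levi x.2.2.1)) : ℝ) : ℂ) * (((regField m μ h x).1
          / √(massNormSq m (levi x.2.2.1)) - x.1 * normDeriv m x.2.2.1 (regField m μ h x).2.2.1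
            / √(massNormSq m (levi x.2.2.1)) ^ 2 : ℝ) * (massNormSq m (levi x.2.2.1) : ℝ))
        + ((x.1 / √(massNormSq m (levi x.2.2.1))) ^ 2 : ℝ) *
          pairing (massDual m (levi x.2.2.1)) (leviDeriv x.2.2.1 (regField m μ h x).2.2.1) := by
    rw [physQ_eq, massDual_smul, physQDeriv, pairing_smul_left, pairing_add_right,
      pairing_smul_right, pairing_smul_right, pairing_massDual_self, Complex.conj_ofReal]
    push_cast
    ring
  simp only [Prod.fst_add, Prod.smul_fst, pairing_add_right, pairing_smul_right,
    pairing_real_smul_right, h2, pairing_momOf_posOf hm _ (sum_physQDeriv m hx.1 hF), h3, h5,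
    Complex.add_im, Complex.im_ofReal_mul, h4] at h1
  rw [div_pow, Real.sq_sqrt hn.le] at h1
  simp only [Complex.mul_im, Complex.ofReal_re, Complex.ofReal_im, Complex.mul_re, Complex.I_re,
    Complex.I_im, mul_zero, add_zero, zero_add, mul_one, sub_zero] at h1
  rw [spin]
  field_simp at h1 ⊢
  linear_combination -h1

end PlanarThreeBody
end

noncomputable section
namespace PlanarThreeBody

/-! ### From regularized solutions to three-body motions -/

/-! ### Unit complex numbers acting on states -/

section rotate

variable {m : Fin 3 → ℝ} {μ : ℝ} {u : ℂ} (hu : ‖u‖ = 1) (y : Body)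
include hu

theorem smul_mem_bodyLevel {y : Body} (hy : y ∈ BodyLevel μ) : u • y ∈ BodyLevel μ := by
  have := rotate_mem_bodyLevel hu 0 hy
  simp only [add_zero] at this
  exact this

theorem bodyH_smul : bodyH m (u • y) = bodyH m y := by
  have := bodyH_rotate m hu 0 y
  simp only [add_zero] at this
  exact this

theorem newtonField_smul : newtonField m (u • y) = u • newtonField m y := by
  have := newtonField_rotate m hu 0 y
  simp only [add_zero] at this
  exact this

theorem bodySetoid_smul : bodySetoid y (u • y) :=
  ⟨u, 0, hu, by simp only [add_zero]; rfl⟩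

end rotate

theorem relPos_smul (u : ℂ) (q : Fin 3 → ℂ) : relPos (u • q) = u • relPos q := by
  have := relPos_rotate u 0 q
  simp only [add_zero] at this
  exact this

section

variable {m : Fin 3 → ℝ} (hm : ∀ i, 0 < m i) {μ h : ℝ} {x : ℝ → Reg} {J : Set ℝ}
  (hx : IsRegSolution m μ h x J) (hl : ∀ s ∈ J, x s ∈ RegLevel ∧ regH m μ h (x s) = 0)
include hm hx hl

/-- Collisions are isolated. -/
theorem eventually_ne_collision {s : ℝ} (hs : s ∈ J) : ∀ᶠ s' in 𝓝[≠] s, ∀ j, (x s').2.2.1 j ≠ 0 := by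
  refine eventually_all.2 fun j => ?_
  have hd := hasDerivAt_pi.1 (hasDerivAt_reg (hx.hasDerivAt hs)).2.2.1 j
  by_cases hj : (x s).2.2.1 j = 0
  · exact hd.eventually_ne (regField_transversal hm μ h (hl s hs).1 (hl s hs).2 hj)
  · exact (hd.continuousAt.eventually_ne hj).filter_mono nhdsWithin_le_nhds

/-- `τ` is nonnegative and vanishes only at collisions, which are isolated. If `t` took equal values
at two parameters it would be constant between them, contradicting `τ > 0` at a collision-free
parameter. -/
theorem strictMonoOn_time {t : ℝ → ℝ} (ht : ∀ s ∈ J, HasDerivAt t (tau (x s).2.2.1) s) :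
    StrictMonoOn t J := by
  have hmono : MonotoneOn t J := by
    refine monotoneOn_of_deriv_nonneg hx.2.1.convex
      (fun s hs => (ht s hs).continuousAt.continuousWithinAt)
      (fun s hs => (ht s (interior_subset hs)).differentiableAt.differentiableWithinAt)
      fun s hs => ?_
    rw [(ht s (interior_subset hs)).deriv]
    exact tau_nonneg _
  intro a ha b hb hab
  refine lt_of_le_of_ne (hmono ha hb hab.le) fun heq => ?_
  have hIcc : Icc a b ⊆ J := hx.2.1.out ha hb
  have hconst : ∀ s ∈ Ioo a b, t s = t a := fun s hs =>
    le_antisymm (heq ▸ hmono (hIcc ⟨hs.1.le, hs.2.le⟩) hb hs.2.le)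
      (hmono ha (hIcc ⟨hs.1.le, hs.2.le⟩) hs.1.le)
  have hmid : (a + b) / 2 ∈ Ioo a b := ⟨by linarith, by linarith⟩
  have h1 : ∀ᶠ s in 𝓝[≠] ((a + b) / 2), s ∈ Ioo a b :=
    mem_nhdsWithin_of_mem_nhds (isOpen_Ioo.mem_nhds hmid)
  obtain ⟨s, hs, hs'⟩ := (h1.and (eventually_ne_collision hm hx hl
    (hIcc ⟨hmid.1.le, hmid.2.le⟩))).exists
  have h2 : HasDerivAt t 0 s := (hasDerivAt_const s (t a)).congr_of_eventuallyEq (by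
    filter_upwards [isOpen_Ioo.mem_nhds hs] with r hr using hconst r hr)
  exact (tau_pos hs').ne' ((ht s (hIcc ⟨hs.1.le, hs.2.le⟩)).unique h2)

end

/-- Continuity at collision points is included; it lets the rotating frame be continued through
them. -/
theorem continuousAt_spin {m : Fin 3 → ℝ} (hm : ∀ i, 0 < m i) (μ h : ℝ) {x : Reg}
    (hx : x ∈ RegDomain) : ContinuousAt (spin m μ h) x := by
  have hz : ContinuousAt (fun x : Reg => x.2.2.1) x :=
    (continuous_fst.comp (continuous_snd.comp continuous_snd)).continuousAt
  have hF := (contDiffAt_regField hm μ h hx).continuousAt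
  have hV (j : Fin 3) : ContinuousAt (fun x => (regField m μ h x).2.2.1 j) x :=
    (contDiff_z_apply j).continuous.continuousAt.comp hF
  have hzj (j : Fin 3) : ContinuousAt (fun x : Reg => x.2.2.1 j) x :=
    (contDiff_z_apply j).continuous.continuousAt
  have hn : ContinuousAt (fun x : Reg => massNormSq m (levi x.2.2.1)) x :=
    ContinuousAt.comp (g := fun z => massNormSq m (levi z))
      (contDiff_massNormSq_levi m).continuous.continuousAt hz
  have ht : ContinuousAt (fun x : Reg => tau x.2.2.1) x :=
    ContinuousAt.comp (g := tau) (contDiffAt_tau hx.2).continuousAt hz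
  have hp : ContinuousAt (fun x : Reg => pairing (massDual m (levi x.2.2.1))
      (leviDeriv x.2.2.1 (regField m μ h x).2.2.1)) x := by
    refine tendsto_finsetSum _ fun j _ => ?_
    exact (Complex.continuous_conj.continuousAt.comp (continuousAt_const.mul ((hzj j).pow 2))).mul
      ((continuousAt_const.mul (hzj j)).mul (hV j))
  exact ((Complex.continuous_im.continuousAt.comp hp).div hn
    (massNormSq_levi_pos hm hx.2).ne').sub ((ht.mul continuousAt_const).div
      (continuousAt_fst.pow 2) (pow_ne_zero 2 hx.1.ne'))

theorem hasDerivAt_rotate_physMap {m : Fin 3 → ℝ} (hm : ∀ i, 0 < m i) {μ h : ℝ} {x : ℝ → Reg}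
    {u : ℝ → ℂ} {s : ℝ} (hx : x s ∈ RegFree) (hH : regH m μ h (x s) = 0)
    (hd : HasDerivAt x (regField m μ h (x s)) s) (hu : ‖u s‖ = 1)
    (hu' : HasDerivAt u (-(spin m μ h (x s) * Complex.I) * u s) s) :
    HasDerivAt (fun s => u s • physMap m μ (x s))
      (tau (x s).2.2.1 • newtonField m (u s • physMap m μ (x s))) s := by
  have h1 := hasDerivAt_comp_of_contDiffAt (contDiffAt_physMap hm μ hx.1.1 hx.2) hd
  rw [fderiv_physMap_regField hm hx hH] at h1
  convert! hu'.smul h1 using 1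
  rw [newtonField_smul hu, smul_add, smul_smul, neg_mul, neg_smul, mul_comm (u s), add_assoc,
    add_neg_cancel, add_zero, smul_comm]

theorem exists_bodyMotion {m : Fin 3 → ℝ} (hm : ∀ i, 0 < m i) {μ h : ℝ} {x : ℝ → Reg} {J : Set ℝ}
    (hx : IsRegSolution m μ h x J) (hl : ∀ s ∈ J, x s ∈ RegLevel ∧ regH m μ h (x s) = 0) :
    ∃ (t : ℝ → ℝ) (w : ℝ → Body), (∀ s ∈ J, HasDerivAt t (tau (x s).2.2.1) s) ∧
      StrictMonoOn t J ∧ ContinuousOn (fun T => (w T).1) (t '' J) ∧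
      ∀ s ∈ J, (∀ j, relPos (w (t s)).1 j = 0 ↔ (x s).2.2.1 j = 0) ∧
        ((∀ j, (x s).2.2.1 j ≠ 0) →
          w (t s) ∈ BodyLevel μ ∧ bodyH m (w (t s)) = h ∧
          bodySetoid (physMap m μ (x s)) (w (t s)) ∧
          HasDerivAt w (bodyField m (w (t s))) (t s)) := by
  rcases J.eq_empty_or_nonempty with rfl | ⟨s₀, hs₀⟩
  · exact ⟨0, 0, by simp, by simp [StrictMonoOn], by simp, by simp⟩
  have hτc : ContinuousOn (fun s => tau (x s).2.2.1) J := fun s hs =>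
    (hasDerivAt_comp_of_contDiffAt (contDiffAt_tau (hx.2.2.2 s hs).2)
      (hasDerivAt_reg (hx.hasDerivAt hs)).2.2.1).continuousAt.continuousWithinAt
  have hspin : ContinuousOn (fun s => spin m μ h (x s)) J := fun s hs =>
    (ContinuousAt.comp (g := spin m μ h) (continuousAt_spin hm μ h (hx.2.2.2 s hs))
      (hx.hasDerivAt hs).continuousAt).continuousWithinAt
  obtain ⟨t, -, ht⟩ := exists_primitive hx.1 hx.2.1 hτc hs₀ 0
  obtain ⟨θ, -, hθ⟩ := exists_primitive hx.1 hx.2.1 hspin hs₀ 0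
  have hmono := strictMonoOn_time hm hx hl ht
  have htc : ContinuousOn t J := fun s hs => (ht s hs).continuousAt.continuousWithinAt
  obtain ⟨g, hg, -, -, hgc, hgd⟩ := exists_inverse_of_strictMonoOn hx.1 hx.2.1 htc hmono
  -- With `θ' = spin`, this frame cancels the infinitesimal rotation in `fderiv_physMap_regField`.
  let u : ℝ → ℂ := fun s => Complex.exp (-(θ s : ℂ) * Complex.I)
  have hu (s : ℝ) : ‖u s‖ = 1 := by
    have := Complex.norm_exp_ofReal_mul_I (-θ s)
    simpa [u] using this
  have hu0 (s : ℝ) : u s ≠ 0 := Complex.exp_ne_zero _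
  have hud : ∀ s ∈ J, HasDerivAt u (-(spin m μ h (x s) * Complex.I) * u s) s := fun s hs => by
    convert! (((hθ s hs).ofReal_comp.neg).mul_const Complex.I).cexp using 1
    simp only [u, Pi.neg_apply]
    ring
  let W : ℝ → Body := fun s => u s • physMap m μ (x s)
  have hWrel : ∀ s ∈ J, relPos (W s).1 = u s • physQ m (x s) := fun s hs => by
    simp only [W, Prod.smul_fst]
    rw [relPos_smul, relPos_physMap hm μ (hl s hs).1]
  -- Positions involve only `r`, `z²` and `|X|`, so they remain differentiable in `s` at a
  -- collision, unlike the momenta. Composition with the continuous inverse `g` keeps them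
  -- continuous in physical time.
  refine ⟨t, fun T => W (g T), ht, hmono, ?_, fun s hs => ?_⟩
  · rintro _ ⟨s, hs, rfl⟩
    refine ContinuousAt.continuousWithinAt ?_
    have h1 : HasDerivAt (fun s => (W s).1) _ s := (hud s hs).smul
      (hasDerivAt_posOf m (hasDerivAt_physQ hm (hx.hasDerivAt hs) (hx.2.2.2 s hs)))
    have h2 := h1.continuousAt
    rw [← hg s hs] at h2
    exact ContinuousAt.comp (g := fun s => (W s).1) (f := g) h2 (hgc s hs)
  · simp only [hg s hs]
    refine ⟨fun j => ?_, fun hj => ?_⟩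
    · have hn := sqrt_massNormSq_pos hm (hx.2.2.2 s hs)
      have hr := (hx.2.2.2 s hs).1
      have : ((x s).1 / √(massNormSq m (levi (x s).2.2.1)) : ℂ) ≠ 0 := by
        exact_mod_cast (div_pos hr hn).ne'
      simp [hWrel s hs, physQ, levi, hu0, this]
    · have hfree : x s ∈ RegFree := ⟨(hl s hs).1, hj⟩
      have hlev := physMap_mem_bodyLevel hm μ hfree
      have hWlev : W s ∈ BodyLevel μ := smul_mem_bodyLevel (hu s) hlev
      refine ⟨hWlev, ?_, bodySetoid_smul (hu s) _, ?_⟩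
      · rw [bodyH_smul (hu s)]
        have h1 := regH_eq_tau_mul hm μ h hfree
        rw [(hl s hs).2] at h1
        linarith [(mul_eq_zero.1 h1.symm).resolve_left (tau_pos hj).ne']
      · have hW : HasDerivAt W (tau (x s).2.2.1 • newtonField m (W s)) s :=
          hasDerivAt_rotate_physMap hm hfree (hl s hs).2 (hx.hasDerivAt hs) (hu s) (hud s hs)
        have hτ := (tau_pos hj).ne'
        have h1 := HasDerivAt.scomp_of_eq (t s) hW (hgd s hs _ hτ (ht s hs)) (hg s hs).symm
        rw [inv_smul_smul₀ hτ, ← bodyField_eq hWlev.1] at h1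
        exact h1

end PlanarThreeBody
end

noncomputable section
namespace PlanarThreeBody

/-! ### Lifts of three-body motions -/

theorem IsBodySolution.hasDerivAt {m : Fin 3 → ℝ} {μ h : ℝ} {w : ℝ → Body} {I : Set ℝ}
    (hw : IsBodySolution m μ h w I) {t : ℝ} (ht : t ∈ I) :
    HasDerivAt w (newtonField m (w t)) t := by
  rw [← bodyField_eq (hw.2.2.2 t ht).1.1]
  exact (hw.2.2.1 t ht).hasDerivAt (hw.1.mem_nhds ht)

theorem continuousOn_newtonField {m : Fin 3 → ℝ} {μ h : ℝ} {w : ℝ → Body} {I : Set ℝ}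
    (hw : IsBodySolution m μ h w I) : ContinuousOn (fun t => newtonField m (w t)) I :=
  fun t ht => (ContinuousAt.comp (g := newtonField m)
    (continuousAt_newtonField m (hw.2.2.2 t ht).1.1) (hw.hasDerivAt ht).continuousAt).continuousWithinAt

/-- Square roots of the relative positions along a motion. -/
theorem exists_sqrt_curve {m : Fin 3 → ℝ} {μ h : ℝ} {w : ℝ → Body} {I : Set ℝ}
    (hw : IsBodySolution m μ h w I) {t₀ : ℝ} (ht₀ : t₀ ∈ I) {z₀ : Fin 3 → ℂ}
    (hz₀ : levi z₀ = relPos (w t₀).1) :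
    ∃ z z' : ℝ → Fin 3 → ℂ, z t₀ = z₀ ∧ ContinuousOn z' I ∧
      ∀ t ∈ I, HasDerivAt z (z' t) t ∧ levi (z t) = relPos (w t).1 ∧
        leviDeriv (z t) (z' t) = relPos (newtonField m (w t)).1 := by
  have hQ : ∀ t ∈ I, HasDerivAt (fun t => relPos (w t).1) (relPos (newtonField m (w t)).1) t :=
    fun t ht => hasDerivAt_relPos (hw.hasDerivAt ht).fst
  have hQ0 : ∀ t ∈ I, ∀ j, relPos (w t).1 j ≠ 0 := fun t ht =>
    relPos_ne_zero_iff.1 (hw.2.2.2 t ht).1.1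
  have hQ'c : ContinuousOn (fun t => relPos (newtonField m (w t)).1) I :=
    continuous_relPos.comp_continuousOn (continuous_fst.comp_continuousOn
      (continuousOn_newtonField hw))
  have hQc : ContinuousOn (fun t => relPos (w t).1) I := fun t ht =>
    (hQ t ht).continuousAt.continuousWithinAt
  -- The logarithmic derivative of a square root of `Q_j`. Solving `Z' = a Z` avoids branch choices,
  -- and `Z² / Q_j` is constant.
  let a : Fin 3 → ℝ → ℂ := fun j t => relPos (newtonField m (w t)).1 j / (2 * relPos (w t).1 j)
  have ha (j : Fin 3) : ContinuousOn (a j) I :=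
    (continuousOn_pi.1 hQ'c j).div (continuousOn_const.mul (continuousOn_pi.1 hQc j))
      fun t ht => mul_ne_zero two_ne_zero (hQ0 t ht j)
  choose Z hZZ using fun j => exists_linear_hom hw.1 hw.2.1 (ha j) ht₀ (z₀ j)
  have hZ₀ (j : Fin 3) : Z j t₀ = z₀ j := (hZZ j).1
  have hZ (j : Fin 3) : ∀ t ∈ I, HasDerivAt (Z j) (a j t * Z j t) t := (hZZ j).2.1
  have hsq : ∀ t ∈ I, ∀ j, Z j t ^ 2 = relPos (w t).1 j := fun t ht j => by
    have h1 : ∀ s ∈ I, HasDerivAt (fun s => Z j s ^ 2 / relPos (w s).1 j) 0 s := fun s hs => by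
      have := hQ0 s hs j
      convert! ((hZ j s hs).pow 2).div (hasDerivAt_pi.1 (hQ s hs) j) this using 1
      simp only [a]
      field_simp
      simp
      right
      ring
    have h2 := const_of_hasDerivAt_zero hw.1 hw.2.1 h1 ht ht₀
    have h3 : Z j t₀ ^ 2 = relPos (w t₀).1 j := by rw [hZ₀]; exact congrFun hz₀ j
    simp only [h3, div_self (hQ0 t₀ ht₀ j)] at h2
    exact (div_eq_one_iff_eq (hQ0 t ht j)).1 h2
  refine ⟨fun t j => Z j t, fun t j => a j t * Z j t, funext hZ₀, continuousOn_pi.2 fun j =>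
    (ha j).mul fun t ht => (hZ j t ht).continuousAt.continuousWithinAt, fun t ht =>
    ⟨hasDerivAt_pi.2 fun j => hZ j t ht, funext fun j => hsq t ht j, funext fun j => ?_⟩⟩
  have h0 := hQ0 t ht j
  have h1 := hsq t ht j
  simp only [leviDeriv, a]
  field_simp
  linear_combination (relPos (newtonField m (w t)).1 j) * h1

/-- Recovers the coefficients of an infinitesimal symmetry from the vector by continuous formulas;
this makes them continuous along a curve. -/
theorem sum_eq_of_pairing_orbit {z η : Fin 3 → ℂ} (hz : z ≠ 0) (κ c : ℂ) {V E : Fin 3 → ℂ}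
    (hV : V = fun j => κ * z j) (hE : E = fun j => -conj κ * η j + c * conj (z j)) :
    κ = pairing z V / normTwoSq z ∧
      c = pairing (conjVec z) (E + conj (pairing z V / normTwoSq z) • η) / normTwoSq z := by
  have hn : (normTwoSq z : ℂ) ≠ 0 := by exact_mod_cast (normTwoSq_pos hz).ne'
  have h1 : κ = pairing z V / normTwoSq z := by
    have : V = κ • z := hV
    rw [this, pairing_smul_right, pairing_self, mul_div_cancel_right₀ _ hn]
  refine ⟨h1, ?_⟩
  have : E + conj κ • η = c • conjVec z := by
    rw [hE]
    funext j
    simp [conjVec]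
  rw [← h1, this, pairing_smul_right, pairing_self, normTwoSq_conjVec, mul_div_cancel_right₀ _ hn]

/-- A motion has a lift whose velocity differs from the regularized field by an infinitesimal
symmetry. -/
theorem exists_lift_curve {m : Fin 3 → ℝ} (hm : ∀ i, 0 < m i) {μ h : ℝ} {w : ℝ → Body} {I : Set ℝ}
    (hw : IsBodySolution m μ h w I) {t₀ : ℝ} (ht₀ : t₀ ∈ I) {z₀ : Fin 3 → ℂ}
    (hz₀ : levi z₀ = relPos (w t₀).1) :
    ∃ L L' : ℝ → Reg, L t₀ = lift m μ (w t₀).2 z₀ ∧ ContinuousOn L' I ∧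
      ∀ t ∈ I, L t ∈ RegFree ∧ regH m μ h (L t) = 0 ∧ bodySetoid (physMap m μ (L t)) (w t) ∧
        HasDerivAt L (L' t) t ∧
        ∃ κ c : ℂ, L' t = (tau (L t).2.2.1)⁻¹ • regField m μ h (L t)
          + (0, 0, fun j => κ * (L t).2.2.1 j,
            fun j => -conj κ * (L t).2.2.2 j + c * conj ((L t).2.2.1 j)) := by
  obtain ⟨z, z', hzt₀, hz'c, hz⟩ := exists_sqrt_curve hw ht₀ hz₀
  let L : ℝ → Reg := fun t => lift m μ (w t).2 (z t)
  let L' : ℝ → Reg := fun t => fderiv ℝ (fun y : Body => lift m μ y.1 y.2) ((w t).2, z t)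
    ((newtonField m (w t)).2, z' t)
  have hfree : ∀ t ∈ I, L t ∈ RegFree := fun t ht =>
    lift_mem_regFree hm (hw.2.2.2 t ht).1 (hz t ht).2.1
  have hset : ∀ t ∈ I, bodySetoid (physMap m μ (L t)) (w t) := fun t ht =>
    bodySetoid_physMap_lift hm (hw.2.2.2 t ht).1 (hz t ht).2.1
  have hz0 : ∀ t ∈ I, z t ≠ 0 := fun t ht => (hfree t ht).1.1.2
  have hp : ∀ t ∈ I, HasDerivAt (fun t => (w t).2) (newtonField m (w t)).2 t := fun t ht =>
    (hw.hasDerivAt ht).snd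
  have hLd : ∀ t ∈ I, HasDerivAt L (L' t) t := fun t ht =>
    hasDerivAt_lift hm μ (hp t ht) (hz t ht).1 (hz0 t ht)
  have hzc : ContinuousOn z I := fun t ht => (hz t ht).1.continuousAt.continuousWithinAt
  have hpc : ContinuousOn (fun t => (w t).2) I := fun t ht =>
    (hp t ht).continuousAt.continuousWithinAt
  have hLc : ContinuousOn L I := fun t ht => (hLd t ht).continuousAt.continuousWithinAt
  have hL'c : ContinuousOn L' I := by
    have h1 : ContinuousOn (fun t => fderiv ℝ (fun y : Body => lift m μ y.1 y.2)
        ((w t).2, z t)) I := fun t ht =>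
      ContinuousAt.comp_continuousWithinAt
        (g := fun y : Body => fderiv ℝ (fun y : Body => lift m μ y.1 y.2) y)
        (f := fun t => ((w t).2, z t))
        (((contDiffAt_lift hm μ (hz0 t ht)).fderiv_right (m := 0) (by simp)).continuousAt)
        ((hpc t ht).prodMk (hzc t ht))
    exact h1.clm_apply ((continuous_snd.comp_continuousOn (continuousOn_newtonField hw)).prodMk
      hz'c)
  have hH : ∀ t ∈ I, regH m μ h (L t) = 0 := fun t ht => by
    obtain ⟨u, a, hu, hy⟩ := hset t ht
    have h1 := bodyH_rotate m hu a (physMap m μ (L t))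
    rw [← hy, (hw.2.2.2 t ht).2] at h1
    rw [regH_eq_tau_mul hm μ h (hfree t ht), ← h1, sub_self, mul_zero]
  have hex : ∀ t ∈ I, ∃ κ c : ℂ, L' t = (tau (L t).2.2.1)⁻¹ • regField m μ h (L t)
      + (0, 0, fun j => κ * (L t).2.2.1 j,
        fun j => -conj κ * (L t).2.2.2 j + c * conj ((L t).2.2.1 j)) := fun t ht => by
    have hlev := (hw.2.2.2 t ht).1
    have e1 : ∀ s ∈ I, physMap m μ (L s) = (posOf m (relPos (w s).1), (w s).2) := fun s hs => by
      rw [physMap_lift hm μ (z := z s) (hw.2.2.2 s hs).1.2.1 (hfree s hs).2, (hz s hs).2.1]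
    have hT1 : ∑ j, z t j * z' t j = 0 := by
      have h1 : ∑ j, leviDeriv (z t) (z' t) j = 0 := by rw [(hz t ht).2.2, sum_relPos]
      simpa [leviDeriv, mul_assoc, ← Finset.mul_sum] using h1
    have hT2 : (pairing (relMom (newtonField m (w t)).2) (levi (z t))
        + pairing (relMom (w t).2) (leviDeriv (z t) (z' t))).im = 0 := by
      rw [(hz t ht).2.1, (hz t ht).2.2, ← pairing_momOf, ← pairing_momOf,
        momOf_relMom (sum_newtonField_snd m _), momOf_relMom hlev.2.1]
      exact im_pairing_newtonField m (w t)
    have hT : L' t ∈ RegTangent (L t) := deriv_lift_mem_regTangent (p := fun t => (w t).2)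
      (z := z) (L' := L' t) (s := t) hm μ (hp t ht) (hz t ht).1 (hz0 t ht) (hLd t ht) hT1 hT2
    clear_value L' L
    refine eq_regField_of_fderiv_physMap hm (hfree t ht) (hH t ht) hT ?_
    · have h1 := hasDerivAt_comp_of_contDiffAt
        (contDiffAt_physMap hm μ (hfree t ht).1.1 (hfree t ht).2) (hLd t ht)
      have h2 := (hasDerivAt_posOf m (hasDerivAt_relPos (hw.hasDerivAt ht).fst)).prodMk (hp t ht)
      have h3 := h1.unique (h2.congr_of_eventuallyEq (by
        filter_upwards [hw.1.mem_nhds ht] with s hs using e1 s hs))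
      rw [h3, posOf_relPos_of_sum hm (sum_mass_mul_newtonField_fst hm hlev.2.1)]
      obtain ⟨u, a, hu, hy⟩ := hset t ht
      -- `physMap` centres the configuration, while `w` may have its center of mass elsewhere. The
      -- Newtonian field does not see this translation.
      have hu1 : (physMap m μ (L t)) = ((fun i => 1 * (w t).1 i
          + -((∑ i, (m i : ℂ) * (w t).1 i) / ((∑ i, m i : ℝ) : ℂ))), fun i => 1 * (w t).2 i) := by
        rw [e1 t ht, posOf_relPos hm]
        simp [sub_eq_add_neg]
      rw [hu1, newtonField_rotate m (by simp), one_smul]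
  exact ⟨L, L', by simp only [L, hzt₀], hL'c, fun t ht =>
    ⟨hfree t ht, hH t ht, hset t ht, hLd t ht, hex t ht⟩⟩

theorem continuousOn_comp_of_continuousAt {E F : Type*} [TopologicalSpace E] [TopologicalSpace F]
    {g : E → F} {f : ℝ → E} {I : Set ℝ} (hf : ContinuousOn f I)
    (hg : ∀ t ∈ I, ContinuousAt g (f t)) : ContinuousOn (fun t => g (f t)) I :=
  fun t ht => (hg t ht).comp_continuousWithinAt (hf t ht)

/-- The infinitesimal symmetries can be chosen continuously. -/
theorem exists_continuous_gauge {m : Fin 3 → ℝ} (hm : ∀ i, 0 < m i) {μ h : ℝ} {L L' : ℝ → Reg}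
    {I : Set ℝ} (hLc : ContinuousOn L I) (hL'c : ContinuousOn L' I)
    (hfree : ∀ t ∈ I, L t ∈ RegFree)
    (hex : ∀ t ∈ I, ∃ κ c : ℂ, L' t = (tau (L t).2.2.1)⁻¹ • regField m μ h (L t)
      + (0, 0, fun j => κ * (L t).2.2.1 j,
        fun j => -conj κ * (L t).2.2.2 j + c * conj ((L t).2.2.1 j))) :
    ∃ κ c : ℝ → ℂ, ContinuousOn κ I ∧ ContinuousOn c I ∧
      ∀ t ∈ I, L' t = (tau (L t).2.2.1)⁻¹ • regField m μ h (L t)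
        + (0, 0, fun j => κ t * (L t).2.2.1 j,
          fun j => -conj (κ t) * (L t).2.2.2 j + c t * conj ((L t).2.2.1 j)) := by
  have hz0 : ∀ t ∈ I, (L t).2.2.1 ≠ 0 := fun t ht => (hfree t ht).1.1.2
  have hzc {f : ℝ → Reg} (hf : ContinuousOn f I) : ContinuousOn (fun t => (f t).2.2.1) I :=
    continuous_fst.comp_continuousOn (continuous_snd.comp_continuousOn
      (continuous_snd.comp_continuousOn hf))
  have hηc {f : ℝ → Reg} (hf : ContinuousOn f I) : ContinuousOn (fun t => (f t).2.2.2) I :=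
    continuous_snd.comp_continuousOn (continuous_snd.comp_continuousOn
      (continuous_snd.comp_continuousOn hf))
  let D : ℝ → Reg := fun t => L' t - (tau (L t).2.2.1)⁻¹ • regField m μ h (L t)
  have hDc : ContinuousOn D I := by
    refine hL'c.sub (ContinuousOn.fun_smul ?_ ?_)
    · exact (continuousOn_comp_of_continuousAt (g := tau) (hzc hLc) fun t ht =>
        (contDiffAt_tau (hz0 t ht)).continuousAt).inv₀ fun t ht => (tau_pos (hfree t ht).2).ne'
    · exact continuousOn_comp_of_continuousAt hLc fun t ht =>
        (contDiffAt_regField hm μ h (hfree t ht).1.1).continuousAt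
  have hzz {f : ℝ → Fin 3 → ℂ} {g : ℝ → Fin 3 → ℂ} (hf : ContinuousOn f I)
      (hg : ContinuousOn g I) : ContinuousOn (fun t => pairing (f t) (g t)) I :=
    continuousOn_finsetSum _ fun j _ => (Complex.continuous_conj.comp_continuousOn
      (continuousOn_pi.1 hf j)).mul (continuousOn_pi.1 hg j)
  have hnc : ContinuousOn (fun t => (normTwoSq (L t).2.2.1 : ℂ)) I :=
    Complex.continuous_ofReal.comp_continuousOn
      (contDiff_normTwoSq.continuous.comp_continuousOn (hzc hLc))
  have hn0 : ∀ t ∈ I, (normTwoSq (L t).2.2.1 : ℂ) ≠ 0 := fun t ht => by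
    exact_mod_cast (normTwoSq_pos (hz0 t ht)).ne'
  let κ : ℝ → ℂ := fun t => pairing (L t).2.2.1 (D t).2.2.1 / normTwoSq (L t).2.2.1
  let c : ℝ → ℂ := fun t => pairing (conjVec (L t).2.2.1)
    ((D t).2.2.2 + conj (κ t) • (L t).2.2.2) / normTwoSq (L t).2.2.1
  have hκc : ContinuousOn κ I := (hzz (hzc hLc) (hzc hDc)).div hnc hn0
  have hcc : ContinuousOn c I := by
    refine (hzz (continuousOn_pi.2 fun j => Complex.continuous_conj.comp_continuousOn
      (continuousOn_pi.1 (hzc hLc) j)) ((hηc hDc).add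
        ((Complex.continuous_conj.comp_continuousOn hκc).smul (hηc hLc)))).div hnc hn0
  refine ⟨κ, c, hκc, hcc, fun t ht => ?_⟩
  obtain ⟨κ₀, c₀, h1⟩ := hex t ht
  have h2 : D t = (0, 0, fun j => κ₀ * (L t).2.2.1 j,
      fun j => -conj κ₀ * (L t).2.2.2 j + c₀ * conj ((L t).2.2.1 j)) := by
    simp only [D, h1, add_sub_cancel_left]
  obtain ⟨h3, h4⟩ := sum_eq_of_pairing_orbit (η := (L t).2.2.2) (V := (D t).2.2.1)
    (E := (D t).2.2.2) (hz0 t ht) κ₀ c₀ (by rw [h2]) (by rw [h2])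
  have e3 : κ t = κ₀ := h3.symm
  have e4 : c t = c₀ := h4.symm
  rw [e3, e4, ← h1]

end PlanarThreeBody
end

/-! ### Gauge change and time change for lifted motions -/

noncomputable section
namespace PlanarThreeBody

/-- After a change of gauge, a motion lifts to a solution up to the parametrization. -/
theorem exists_lift_gauged {m : Fin 3 → ℝ} (hm : ∀ i, 0 < m i) {μ h : ℝ} {w : ℝ → Body} {I : Set ℝ}
    (hw : IsBodySolution m μ h w I) {t₀ : ℝ} (ht₀ : t₀ ∈ I) {x₀ : Reg} (hx₀ : x₀ ∈ RegFree)
    (h0 : bodySetoid (physMap m μ x₀) (w t₀)) :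
    ∃ X : ℝ → Reg, X t₀ = x₀ ∧ ∀ t ∈ I, X t ∈ RegFree ∧ regH m μ h (X t) = 0 ∧
      bodySetoid (physMap m μ (X t)) (w t) ∧
      HasDerivAt X ((tau (X t).2.2.1)⁻¹ • regField m μ h (X t)) t := by
  obtain ⟨k₀, c₀, hk₀, h1, h2⟩ := exists_regAct_eq_lift_of_bodySetoid hm hx₀ h0
  obtain ⟨L, L', hLt₀, hL'c, hL⟩ := exists_lift_curve hm hw ht₀ h2
  have hLc : ContinuousOn L I := fun t ht => (hL t ht).2.2.2.1.continuousAt.continuousWithinAt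
  obtain ⟨κ, c, hκ, hc, hκc⟩ := exists_continuous_gauge hm hLc hL'c (fun t ht => (hL t ht).1)
    fun t ht => (hL t ht).2.2.2.2
  have hτ : ContinuousOn (fun t => tau (L t).2.2.1) I :=
    continuousOn_comp_of_continuousAt (g := fun x : Reg => tau x.2.2.1) hLc fun t ht =>
      ContinuousAt.comp (g := tau) (contDiffAt_tau (hL t ht).1.1.1.2).continuousAt
        (continuous_fst.comp (continuous_snd.comp continuous_snd)).continuousAt
  have hα : ContinuousOn (fun t => magCoeff μ (L t)) I :=
    (continuousOn_magCoeff μ).comp hLc fun t ht => (hL t ht).1.1.1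
  -- `k' = -κ k` cancels the scaling part of the velocity; the initial value undoes `k₀`, so that
  -- the curve starts at `x₀`.
  obtain ⟨k, hkt₀, hk, hk0⟩ := exists_linear_hom hw.1 hw.2.1 hκ.neg ht₀ k₀⁻¹
  have hk0 := hk0 (inv_ne_zero hk₀)
  have hck (t : ℝ) : conj (k t) ≠ 0 := by simpa using hk0 t
  have hkc : ContinuousOn (fun t => conj (k t)) I := fun t ht =>
    (Complex.continuous_conj.continuousAt.comp (hk t ht).continuousAt).continuousWithinAt
  have ha : ContinuousOn (fun t => -((magCoeff μ (L t) : ℂ) * Complex.I) / (tau (L t).2.2.1 : ℂ)) I :=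
    (((Complex.continuous_ofReal.comp_continuousOn hα).mul continuousOn_const).neg).div
      (Complex.continuous_ofReal.comp_continuousOn hτ) fun t ht => by
        exact_mod_cast (tau_pos (hL t ht).1.2).ne'
  have hb : ContinuousOn (fun t => -c t / (2 * conj (k t) ^ 2)) I :=
    hc.neg.div (continuousOn_const.mul (hkc.pow 2)) fun t _ =>
      mul_ne_zero two_ne_zero (pow_ne_zero 2 (hck t))
  -- The linear term compensates the equivariance defect of the field, scaled by `1 / τ`. The
  -- inhomogeneous term removes the translation part of the velocity.
  obtain ⟨d, hdt₀, hd⟩ := exists_linear hw.1 hw.2.1 ha hb ht₀ (-(c₀ * conj k₀ ^ 2))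
  refine ⟨fun t => regAct (k t) (d t) (L t), ?_, fun t ht => ?_⟩
  · simp only [hkt₀, hdt₀, hLt₀, ← h1, regAct_inv hk₀]
  obtain ⟨hfree, hH, hset, hLd, -⟩ := hL t ht
  have hτ0 := (tau_pos hfree.2).ne'
  have e : tau (regAct (k t) (d t) (L t)).2.2.1 = tau (L t).2.2.1 := tau_smul (hk0 t) _
  refine ⟨regAct_mem_regFree (hk0 t) _ hfree, ?_, ?_, ?_⟩
  · rw [regH_regAct _ _ _ (hk0 t), hH]
  · exact bodySetoid.trans (bodySetoid.symm
      (bodySetoid_physMap_regAct m μ (hk0 t) (d t) hfree.2)) hset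
  · refine (hasDerivAt_regAct (hk t ht) (hk0 t) (hd t ht) hLd).congr_deriv ?_
    rw [e, regField_regAct hm μ h (hk0 t) _ hfree.1.1, hκc t ht, regAct_add, regAct_smul, smul_add,
      add_assoc]
    congr 1
    have hk1 := hk0 t
    have hk2 := hck t
    have hτ1 : (tau (L t).2.2.1 : ℂ) ≠ 0 := by exact_mod_cast hτ0
    refine Prod.ext ?_ (Prod.ext ?_ (Prod.ext (funext fun j => ?_) (funext fun j => ?_)))
    · simp [regAct]
    · simp [regAct]
    · simp [regAct]
      ring
    · simp [regAct]
      field_simp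
      ring

/-- Collision-free three-body motions lift to solutions of the regularized equations. -/
theorem exists_lift_motion {m : Fin 3 → ℝ} (hm : ∀ i, 0 < m i) {μ h : ℝ} {w : ℝ → Body} {I : Set ℝ}
    (hw : IsBodySolution m μ h w I) {t₀ : ℝ} (ht₀ : t₀ ∈ I) {x₀ : Reg} (hx₀ : x₀ ∈ RegFree)
    (h0 : bodySetoid (physMap m μ x₀) (w t₀)) :
    ∃ (J : Set ℝ) (x : ℝ → Reg) (t : ℝ → ℝ), IsRegSolution m μ h x J ∧ 0 ∈ J ∧ x 0 = x₀ ∧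
      t 0 = t₀ ∧ BijOn t J I ∧
      ∀ s ∈ J, x s ∈ RegFree ∧ regH m μ h (x s) = 0 ∧ HasDerivAt t (tau (x s).2.2.1) s ∧
        bodySetoid (physMap m μ (x s)) (w (t s)) := by
  obtain ⟨X, hX0, hX⟩ := exists_lift_gauged hm hw ht₀ hx₀ h0
  have hXc : ContinuousOn X I := fun t ht => (hX t ht).2.2.2.continuousAt.continuousWithinAt
  have hτ : ContinuousOn (fun t => (tau (X t).2.2.1)⁻¹) I :=
    (continuousOn_comp_of_continuousAt (g := fun x : Reg => tau x.2.2.1) hXc fun t ht =>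
      ContinuousAt.comp (g := tau) (contDiffAt_tau (hX t ht).1.1.1.2).continuousAt
        (continuous_fst.comp (continuous_snd.comp continuous_snd)).continuousAt).inv₀
      fun t ht => (tau_pos (hX t ht).1.2).ne'
  have hpos : ∀ t ∈ I, 0 < tau (X t).2.2.1 := fun t ht => tau_pos (hX t ht).1.2
  -- The regularized time as a primitive of `1 / τ`; inverting it gives the parametrization by `s`.
  obtain ⟨σ, hσ0, hσ⟩ := exists_primitive hw.1 hw.2.1 hτ ht₀ 0
  have hσc : ContinuousOn σ I := fun t ht => (hσ t ht).continuousAt.continuousWithinAt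
  have hmono : StrictMonoOn σ I := by
    refine strictMonoOn_of_deriv_pos hw.2.1.convex hσc fun t ht => ?_
    rw [(hσ t (interior_subset ht)).deriv]
    exact inv_pos.2 (hpos t (interior_subset ht))
  obtain ⟨g, hg, ho, hoc, hgc, hgd⟩ := exists_inverse_of_strictMonoOn hw.1 hw.2.1 hσc hmono
  have hg0 : g 0 = t₀ := by rw [← hσ0, hg t₀ ht₀]
  have hgd' : ∀ t ∈ I, HasDerivAt g (tau (X t).2.2.1) (σ t) := fun t ht => by
    simpa using hgd t ht _ (inv_pos.2 (hpos t ht)).ne' (hσ t ht)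
  refine ⟨σ '' I, fun s => X (g s), g, isRegSolution_of_hasDerivAt ho hoc ?_,
    ⟨t₀, ht₀, hσ0⟩, by simp only [hg0, hX0], hg0, ?_, ?_⟩
  · rintro _ ⟨t, ht, rfl⟩
    simp only [hg t ht]
    refine ⟨?_, (hX t ht).1.1.1⟩
    have h1 := HasDerivAt.scomp_of_eq (σ t) (hX t ht).2.2.2 (hgd' t ht) (hg t ht).symm
    rwa [smul_inv_smul₀ (hpos t ht).ne'] at h1
  · refine ⟨?_, ?_, fun t ht => ⟨σ t, ⟨t, ht, rfl⟩, hg t ht⟩⟩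
    · rintro _ ⟨t, ht, rfl⟩
      rwa [hg t ht]
    · rintro _ ⟨t, ht, rfl⟩ _ ⟨t', ht', rfl⟩ hh
      rw [hg t ht, hg t' ht'] at hh
      rw [hh]
  · rintro _ ⟨t, ht, rfl⟩
    simp only [hg t ht]
    exact ⟨(hX t ht).1, (hX t ht).2.1, hgd' t ht, (hX t ht).2.2.1⟩

end PlanarThreeBody
end

noncomputable section
namespace PlanarThreeBody

/-! ### Estimates near a binary collision -/

/-- The negative of the Newtonian potential, in terms of relative positions. -/
def selfPotential (m : Fin 3 → ℝ) (Q : Fin 3 → ℂ) : ℝ := ∑ j, pairMass m j / ‖Q j‖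

/-- The time-scaling factor in terms of relative positions. -/
def tauRel (Q : Fin 3 → ℂ) : ℝ := ‖Q 0‖ * ‖Q 1‖ * ‖Q 2‖ / (∑ j, ‖Q j‖) ^ 3

/-- The body that is not part of a given pair. -/
def thirdBody : Fin 3 → Fin 3 := ![2, 1, 0]

/-- The first body of a given pair. -/
def firstBody : Fin 3 → Fin 3 := ![0, 2, 1]

/-- The second body of a given pair. -/
def secondBody : Fin 3 → Fin 3 := ![1, 0, 2]

/-- Zero total momentum eliminates one momentum of the pair. The large momentum then appears only
against the small relative vector. -/
theorem pairing_eq_of_pair {p : Fin 3 → ℂ} (hp : ∑ i, p i = 0) (q : Fin 3 → ℂ) (j : Fin 3) :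
    pairing p q = conj (p (firstBody j)) * relPos q j
      + conj (p (thirdBody j)) * (q (thirdBody j) - q (secondBody j)) := by
  have h : conj (p 0) + conj (p 1) + conj (p 2) = 0 := by
    rw [← map_add, ← map_add, ← Fin.sum_univ_three, hp, map_zero]
  fin_cases j <;>
    simp only [pairing, Fin.sum_univ_three, firstBody, secondBody, thirdBody, relPos] <;> simp
  · linear_combination q 1 * h
  · linear_combination q 0 * h
  · linear_combination q 2 * h

/-- The force on the body outside the colliding pair involves only the two distances that stay
positive. -/
theorem tendsto_momOf_forceVec (m : Fin 3 → ℝ) {l : Filter ℝ} {Q : ℝ → Fin 3 → ℂ}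
    {Q₀ : Fin 3 → ℂ} (hQ : Tendsto Q l (𝓝 Q₀)) {j : Fin 3} (hj : ∀ i, i ≠ j → Q₀ i ≠ 0) :
    Tendsto (fun t => momOf (forceVec m (Q t)) (thirdBody j)) l
      (𝓝 (momOf (forceVec m Q₀) (thirdBody j))) := by
  have h1 (i : Fin 3) (hi : i ≠ j) :
      Tendsto (fun t => forceVec m (Q t) i) l (𝓝 (forceVec m Q₀ i)) := by
    have h2 := (tendsto_pi_nhds.1 hQ) i
    exact ((Complex.continuous_ofReal.tendsto _).comp (tendsto_const_nhds.div (h2.norm.pow 3)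
      (pow_ne_zero 3 (norm_ne_zero_iff.2 (hj i hi))))).mul h2
  fin_cases j
  · exact (h1 1 (by decide)).sub (h1 2 (by decide))
  · exact (h1 2 (by decide)).sub (h1 0 (by decide))
  · exact (h1 0 (by decide)).sub (h1 1 (by decide))

theorem sum_kinetic {m : Fin 3 → ℝ} {h : ℝ} {y : Body} (hy : bodyH m y = h) :
    ∑ i, ‖y.2 i‖ ^ 2 / (2 * m i) = h + selfPotential m (relPos y.1) := by
  rw [← hy, bodyH, selfPotential, sub_add_cancel]

/-- The Lagrange-Jacobi identity. -/
theorem hasDerivAt_virial {m : Fin 3 → ℝ} {μ h : ℝ} {w : ℝ → Body} {I : Set ℝ}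
    (hw : IsBodySolution m μ h w I) {t : ℝ} (ht : t ∈ I) :
    HasDerivAt (fun t => (pairing (w t).2 (w t).1).re)
      (2 * h + selfPotential m (relPos (w t).1)) t := by
  have hd := hw.hasDerivAt ht
  have h1 := hasDerivAt_pairing hd.snd hd.fst
  have h2 : HasDerivAt (fun t => (pairing (w t).2 (w t).1).re) _ t :=
    Complex.reCLM.hasFDerivAt.comp_hasDerivAt t h1
  refine h2.congr_deriv ?_
  have h3 := sum_kinetic (hw.2.2.2 t ht).2
  have h4 : (pairing (momOf (forceVec m (relPos (w t).1))) (w t).1).re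
      = selfPotential m (relPos (w t).1) := by
    rw [pairing_momOf, pairing, Complex.re_sum, selfPotential]
    refine Finset.sum_congr rfl fun j _ => ?_
    have hj := norm_ne_zero_iff.2 (relPos_ne_zero_iff.1 (hw.2.2.2 t ht).1.1 j)
    rw [forceVec, map_mul, mul_assoc, Complex.conj_mul', Complex.conj_ofReal,
      ← Complex.ofReal_pow, ← Complex.ofReal_mul, Complex.ofReal_re]
    field_simp
  have h5 : (pairing (w t).2 (newtonField m (w t)).1).re = 2 * ∑ i, ‖(w t).2 i‖ ^ 2 / (2 * m i) := by
    rw [pairing, Complex.re_sum, Finset.mul_sum]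
    refine Finset.sum_congr rfl fun i _ => ?_
    rw [newtonField, ← mul_div_assoc, Complex.conj_mul', ← Complex.ofReal_pow,
      ← Complex.ofReal_div, Complex.ofReal_re]
    field_simp
  rw [Complex.reCLM_apply, Complex.add_re, h5, h3]
  simp only [newtonField, pairing_neg_left, Complex.neg_re, h4]
  ring

theorem tendsto_relPos {w : ℝ → Body} {q : Fin 3 → ℂ} {l : Filter ℝ}
    (hq : Tendsto (fun t => (w t).1) l (𝓝 q)) :
    Tendsto (fun t => relPos (w t).1) l (𝓝 (relPos q)) :=
  (continuous_relPos.tendsto q).comp hq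

section

variable {m : Fin 3 → ℝ} (hm : ∀ i, 0 < m i) {μ h a T : ℝ} {w : ℝ → Body} {q : Fin 3 → ℂ}
  {j : Fin 3} (haT : a < T) (hw : IsBodySolution m μ h w (Ioo a T))
  (hq : Tendsto (fun t => (w t).1) (𝓝[<] T) (𝓝 q)) (hj : relPos q j = 0)
  (hj' : ∀ i, i ≠ j → relPos q i ≠ 0)
include hq hj hj' in
-- The potential blows up at most like the inverse distance of the colliding pair, so even one power
-- of that distance less than the given two would keep the product bounded.
theorem tendsto_selfPotential_mul : Tendsto (fun t => selfPotential m (relPos (w t).1)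
    * ‖relPos (w t).1 j‖ ^ 2) (𝓝[<] T) (𝓝 0) := by
  have hQ := tendsto_pi_nhds.1 (tendsto_relPos hq)
  have hQj : Tendsto (fun t => ‖relPos (w t).1 j‖) (𝓝[<] T) (𝓝 0) := by
    simpa [hj] using (hQ j).norm
  have h1 : Tendsto (fun t => ∑ i, pairMass m i / ‖relPos (w t).1 i‖ * ‖relPos (w t).1 j‖ ^ 2)
      (𝓝[<] T) (𝓝 (∑ _i : Fin 3, 0)) := by
    refine tendsto_finsetSum _ fun i _ => ?_
    by_cases hi : i = j
    · subst hi
      have h2 := hQj.const_mul (pairMass m i)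
      rw [mul_zero] at h2
      refine h2.congr fun t => ?_
      by_cases h0 : ‖relPos (w t).1 i‖ = 0
      · simp [h0]
      · field_simp
    · have h2 := (tendsto_const_nhds (x := pairMass m i)).div (hQ i).norm
        (norm_ne_zero_iff.2 (hj' i hi))
      simpa using h2.mul (hQj.pow 2)
  simpa [selfPotential, Finset.sum_mul] using h1

include haT hw hq

include hj' in
-- The force on the third body is bounded near the collision, and the remaining time is finite.
theorem third_momentum_bounded :
    ∃ M, ∀ᶠ t in 𝓝[<] T, ‖(w t).2 (thirdBody j)‖ ≤ M := by
  have h1 := ((tendsto_momOf_forceVec m (tendsto_relPos hq) hj').norm).eventually_le_const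
    (lt_add_one _)
  obtain ⟨t₁, ht₁, h2⟩ := (mem_nhdsLT_iff_exists_Ioo_subset' haT).1
    (h1.and (Ioo_mem_nhdsLT haT : ∀ᶠ t in 𝓝[<] T, t ∈ Ioo a T))
  set C := ‖momOf (forceVec m (relPos q)) (thirdBody j)‖ + 1
  obtain ⟨t₂, ht₂⟩ : ∃ t₂, t₂ ∈ Ioo t₁ T := nonempty_Ioo.2 ht₁
  refine ⟨‖(w t₂).2 (thirdBody j)‖ + C * (T - t₂), ?_⟩
  filter_upwards [Ioo_mem_nhdsLT ht₂.2] with t ht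
  have hsub : Ico t₂ T ⊆ Ioo t₁ T := fun s hs => ⟨ht₂.1.trans_le hs.1, hs.2⟩
  have h3 := (convex_Ico t₂ T).norm_image_sub_le_of_norm_hasDerivWithin_le
    (f := fun t => (w t).2 (thirdBody j)) (f' := fun t => (newtonField m (w t)).2 (thirdBody j))
    (C := C) (x := t₂) (y := t)
    (fun s hs => (hasDerivAt_pi.1 (hw.hasDerivAt (h2 (hsub hs)).2).snd _).hasDerivWithinAt)
    (fun s hs => by
      have := (h2 (hsub hs)).1
      simpa [newtonField] using this) ⟨le_rfl, ht₂.2⟩ ⟨ht.1.le, ht.2⟩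
  have h4 := norm_sub_norm_le ((w t).2 (thirdBody j)) ((w t₂).2 (thirdBody j))
  rw [Real.norm_of_nonneg (sub_nonneg.2 ht.1.le)] at h3
  have hC : 0 ≤ C := by positivity
  nlinarith [ht.2]

include hj hj' hm in
-- By energy conservation `|p|²` is at most a constant times `h + U`, and `U |Q_j|² → 0`, so the
-- product of the colliding body's momentum with `Q_j` tends to zero. The third body contributes a
-- bounded term.
theorem virial_bounded : ∃ M, ∀ᶠ t in 𝓝[<] T, |(pairing (w t).2 (w t).1).re| ≤ M := by
  obtain ⟨M, hM⟩ := third_momentum_bounded haT hw hq hj'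
  have hQ := tendsto_pi_nhds.1 (tendsto_relPos hq)
  have hqi := tendsto_pi_nhds.1 hq
  have hQj : Tendsto (fun t => ‖relPos (w t).1 j‖) (𝓝[<] T) (𝓝 0) := by
    simpa [hj] using (hQ j).norm
  have h1 := ((hQj.pow 2).const_mul h).add (tendsto_selfPotential_mul (m := m) hq hj hj')
  have h2 := (h1.const_mul (2 * m (firstBody j)))
  simp only [ne_eq, OfNat.ofNat_ne_zero, not_false_eq_true, zero_pow, mul_zero, add_zero] at h2
  have h3 := h2.eventually_le_const zero_lt_one
  have h4 := (((hqi (thirdBody j)).sub (hqi (secondBody j))).norm).eventually_le_const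
    (lt_add_one _)
  set D := ‖q (thirdBody j) - q (secondBody j)‖ + 1
  refine ⟨1 + M * D, ?_⟩
  filter_upwards [hM, h3, h4, Ioo_mem_nhdsLT haT] with t hM h3 h4 ht
  have hlev := hw.2.2.2 t ht
  refine (Complex.abs_re_le_norm _).trans ?_
  rw [pairing_eq_of_pair hlev.1.2.1 _ j]
  refine (norm_add_le _ _).trans (add_le_add ?_ ?_)
  · rw [norm_mul, RCLike.norm_conj]
    have h5 : ‖(w t).2 (firstBody j)‖ ^ 2 ≤ 2 * m (firstBody j)
        * (h + selfPotential m (relPos (w t).1)) := by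
      rw [← sum_kinetic hlev.2]
      have := Finset.single_le_sum (f := fun i => ‖(w t).2 i‖ ^ 2 / (2 * m i))
        (fun i _ => div_nonneg (sq_nonneg _) (by linarith [hm i]))
        (Finset.mem_univ (firstBody j))
      have h6 := mul_le_mul_of_nonneg_left this
        (show 0 ≤ 2 * m (firstBody j) by linarith [hm (firstBody j)])
      have h7 := (hm (firstBody j)).ne'
      calc _ = 2 * m (firstBody j) * (‖(w t).2 (firstBody j)‖ ^ 2 / (2 * m (firstBody j))) := by
            field_simp
        _ ≤ _ := h6
    have h6 : (‖(w t).2 (firstBody j)‖ * ‖relPos (w t).1 j‖) ^ 2 ≤ 1 := by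
      have := mul_le_mul_of_nonneg_right h5 (sq_nonneg ‖relPos (w t).1 j‖)
      rw [mul_pow]
      linarith
    exact (sq_le_one_iff₀ (by positivity)).1 h6
  · rw [norm_mul, RCLike.norm_conj]
    exact mul_le_mul hM h4 (norm_nonneg _) ((norm_nonneg _).trans hM)

include hj' hm in
-- Of the three distances in the numerator of `τ` only `|Q_j|` tends to zero, and `1 / |Q_j|` is
-- dominated by the potential.
theorem inv_tauRel_le : ∃ C, 0 < C ∧ ∀ᶠ t in 𝓝[<] T,
    (tauRel (relPos (w t).1))⁻¹ ≤ C * selfPotential m (relPos (w t).1) := by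
  have hQ := tendsto_pi_nhds.1 (tendsto_relPos hq)
  have h1 : Tendsto (fun t => (∑ i, ‖relPos (w t).1 i‖) ^ 3
      / ∏ i ∈ Finset.univ.erase j, ‖relPos (w t).1 i‖) (𝓝[<] T) (𝓝 ((∑ i, ‖relPos q i‖) ^ 3
        / ∏ i ∈ Finset.univ.erase j, ‖relPos q i‖)) := by
    refine ((tendsto_finsetSum _ fun i _ => (hQ i).norm).pow 3).div
      (tendsto_finsetProd _ fun i _ => (hQ i).norm) ?_
    exact Finset.prod_ne_zero_iff.2 fun i hi =>
      norm_ne_zero_iff.2 (hj' i (Finset.ne_of_mem_erase hi))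
  have h2 := h1.eventually_le_const (lt_add_one _)
  set C := (∑ i, ‖relPos q i‖) ^ 3 / ∏ i ∈ Finset.univ.erase j, ‖relPos q i‖ + 1
  have hC : 0 < C := by positivity
  have hpm := pairMass_pos hm j
  refine ⟨C / pairMass m j, by positivity, ?_⟩
  filter_upwards [h2, Ioo_mem_nhdsLT haT] with t h2 ht
  have h0 (i : Fin 3) : 0 < ‖relPos (w t).1 i‖ :=
    norm_pos_iff.2 (relPos_ne_zero_iff.1 (hw.2.2.2 t ht).1.1 i)
  have h3 : pairMass m j / ‖relPos (w t).1 j‖ ≤ selfPotential m (relPos (w t).1) :=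
    Finset.single_le_sum (f := fun i => pairMass m i / ‖relPos (w t).1 i‖)
      (fun i _ => (div_pos (pairMass_pos hm i) (h0 i)).le) (Finset.mem_univ j)
  have h4 : (tauRel (relPos (w t).1))⁻¹ = (∑ i, ‖relPos (w t).1 i‖) ^ 3
      / (∏ i ∈ Finset.univ.erase j, ‖relPos (w t).1 i‖) * ‖relPos (w t).1 j‖⁻¹ := by
    rw [tauRel, inv_div, ← Fin.prod_univ_three (fun i => ‖relPos (w t).1 i‖),
      ← Finset.prod_erase_mul _ _ (Finset.mem_univ j), div_mul_eq_div_div]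
    rfl
  rw [h4]
  calc _ ≤ C * ‖relPos (w t).1 j‖⁻¹ := mul_le_mul_of_nonneg_right h2 (inv_pos.2 (h0 j)).le
    _ = C / pairMass m j * (pairMass m j / ‖relPos (w t).1 j‖) := by
      have := (h0 j).ne'
      field_simp
    _ ≤ _ := mul_le_mul_of_nonneg_left h3 (by positivity)

include hj hj' hm in
/-- The regularized time up to the collision is finite. -/
theorem exists_time_bound : ∃ B B' : ℝ → ℝ, ∃ M, ∀ᶠ t in 𝓝[<] T,
    HasDerivAt B (B' t) t ∧ (tauRel (relPos (w t).1))⁻¹ ≤ B' t ∧ B t ≤ M := by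
  obtain ⟨M, hM⟩ := virial_bounded hm haT hw hq hj hj'
  obtain ⟨C, hC, h1⟩ := inv_tauRel_le hm haT hw hq hj'
  -- By the Lagrange-Jacobi identity the first term has derivative `2h + U`; adding `2 |h| t` makes
  -- the total derivative at least `C U`, which dominates `1 / τ`.
  refine ⟨fun t => C * ((pairing (w t).2 (w t).1).re + 2 * |h| * t),
    fun t => C * (2 * h + selfPotential m (relPos (w t).1) + 2 * |h|), C * (M + 2 * |h| * T), ?_⟩
  filter_upwards [hM, h1, Ioo_mem_nhdsLT haT] with t hM h1 ht
  refine ⟨?_, ?_, ?_⟩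
  · simpa using ((hasDerivAt_virial hw ht).add ((hasDerivAt_id t).const_mul (2 * |h|))).const_mul C
  · refine h1.trans (mul_le_mul_of_nonneg_left ?_ hC.le)
    linarith [neg_abs_le h]
  · refine mul_le_mul_of_nonneg_left (add_le_add ((le_abs_self _).trans hM) ?_) hC.le
    exact mul_le_mul_of_nonneg_left ht.2.le (by positivity)

end

end PlanarThreeBody
end

noncomputable section
namespace PlanarThreeBody

/-! ### Compact sets of lifts -/

theorem norm_sq_le_normTwoSq (z : Fin 3 → ℂ) (j : Fin 3) : ‖z j‖ ^ 2 ≤ normTwoSq z :=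
  Finset.single_le_sum (f := fun j => ‖z j‖ ^ 2) (fun _ _ => sq_nonneg _) (Finset.mem_univ j)

theorem isCompact_normTwoSq (s₁ s₂ : ℝ) :
    IsCompact {z : Fin 3 → ℂ | normTwoSq z ∈ Icc s₁ s₂} := by
  refine (isCompact_closedBall (0 : Fin 3 → ℂ) (√s₂)).of_isClosed_subset
    (isClosed_Icc.preimage contDiff_normTwoSq.continuous) fun z hz => ?_
  rw [mem_closedBall_zero_iff]
  refine (pi_norm_le_iff_of_nonneg (Real.sqrt_nonneg _)).2 fun j => ?_
  exact Real.le_sqrt_of_sq_le ((norm_sq_le_normTwoSq z j).trans hz.2)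

/-- Points of the zero level with bounded size, bounded radial momentum and normalized `η` lie in a
compact set. -/
theorem exists_compact_of_bounds {m : Fin 3 → ℝ} (hm : ∀ i, 0 < m i) (μ h : ℝ) {r₁ r₂ s₁ s₂ M : ℝ}
    (hr : 0 < r₁) (hs : 0 < s₁) : ∃ K : Set Reg, IsCompact K ∧ K ⊆ RegDomain ∧
      ∀ x ∈ RegLevel, regH m μ h x = 0 → pairing (conjVec x.2.2.1) x.2.2.2 = 0 →
        x.1 ∈ Icc r₁ r₂ → x.2.1 ∈ Icc (-M) M → normTwoSq x.2.2.1 ∈ Icc s₁ s₂ → x ∈ K := by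
  have hz0 {z : Fin 3 → ℂ} (hz : normTwoSq z ∈ Icc s₁ s₂) : z ≠ 0 := by
    rintro rfl
    simp [normTwoSq] at hz
    linarith
  have hK₀ := (isCompact_Icc (a := r₁) (b := r₂)).prod (isCompact_normTwoSq s₁ s₂)
  -- With `a = 0` one has `‖η‖² = |b|² ‖z‖⁴`, and zero energy gives `K |b|² ≤ W / r + |h| τ`. The
  -- resulting bound on `‖η‖²` is continuous on a compact set of `(r, z)`.
  have hc : ContinuousOn (fun y : ℝ × (Fin 3 → ℂ) => (shapeW m y.2 / y.1 + |h| * tau y.2)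
      / shapeCoeff m (y.1, 0, y.2, 0) * normTwoSq y.2 ^ 2) (Icc r₁ r₂ ×ˢ
        {z : Fin 3 → ℂ | normTwoSq z ∈ Icc s₁ s₂}) := by
    rintro ⟨r, z⟩ ⟨hr', hz'⟩
    have hr0 : r ≠ 0 := (hr.trans_le hr'.1).ne'
    have hz := hz0 hz'
    have hz2 : ContinuousAt (fun y : ℝ × (Fin 3 → ℂ) => y.2) (r, z) := continuousAt_snd
    have h1 : ContinuousAt (fun y : ℝ × (Fin 3 → ℂ) => shapeW m y.2) (r, z) :=
      ContinuousAt.comp (g := shapeW m) (contDiffAt_shapeW hm hz).continuousAt hz2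
    have h2 : ContinuousAt (fun y : ℝ × (Fin 3 → ℂ) => tau y.2) (r, z) :=
      ContinuousAt.comp (g := tau) (contDiffAt_tau hz).continuousAt hz2
    have h3 : ContinuousAt (fun y : ℝ × (Fin 3 → ℂ) => normTwoSq y.2) (r, z) :=
      ContinuousAt.comp (g := normTwoSq) contDiff_normTwoSq.continuous.continuousAt hz2
    have h4 : ContinuousAt (fun y : ℝ × (Fin 3 → ℂ) => massNormSq m (levi y.2)) (r, z) :=
      ContinuousAt.comp (g := fun z => massNormSq m (levi z))
        (contDiff_massNormSq_levi m).continuous.continuousAt hz2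
    have hpos := shapeCoeff_pos (x := (r, 0, z, 0)) hm ⟨hr.trans_le hr'.1, hz⟩
    have h5 : ContinuousAt (fun y : ℝ × (Fin 3 → ℂ) => shapeCoeff m (y.1, 0, y.2, 0)) (r, z) := by
      refine (continuousAt_const.mul (h4.pow 2)).div
        ((continuousAt_const.mul (continuousAt_fst.pow 2)).mul h3) ?_
      have h6 := mul_pos (mul_pos (hm 0) (hm 1)) (hm 2)
      exact mul_ne_zero (mul_ne_zero (mul_ne_zero (by norm_num) h6.ne') (pow_ne_zero 2 hr0))
        (normTwoSq_pos hz).ne'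
    exact ((((h1.div continuousAt_fst hr0).add (continuousAt_const.mul h2)).div h5
      hpos.ne').mul (h3.pow 2)).continuousWithinAt
  obtain ⟨E, hE⟩ := hK₀.bddAbove_image hc
  refine ⟨Icc r₁ r₂ ×ˢ Icc (-M) M ×ˢ {z | normTwoSq z ∈ Icc s₁ s₂} ×ˢ {η | normTwoSq η ∈ Icc 0 E},
    isCompact_Icc.prod (isCompact_Icc.prod ((isCompact_normTwoSq _ _).prod
      (isCompact_normTwoSq _ _))), fun x hx => ⟨hr.trans_le hx.1.1, hz0 hx.2.2.1⟩, ?_⟩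
  rintro ⟨r, p, z, η⟩ hx hH hη hr' hp hz
  refine ⟨hr', hp, hz, normTwoSq_nonneg _, ?_⟩
  simp only at hη hr' hz
  refine le_trans ?_ (hE (mem_image_of_mem _ (show (r, z) ∈ _ from ⟨hr', hz⟩)))
  have hz' := hz0 hz
  have hr0 := hr.trans_le hr'.1
  have hspan := eq_span_of_pairing hz' hx.2.2 hx.2.1
  simp only [hη, zero_div] at hspan
  set b := pairing (crossVec z) η / (normTwoSq z : ℂ) ^ 2
  have hpos := shapeCoeff_pos (x := (r, p, z, 0)) hm ⟨hr0, hz'⟩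
  rw [hspan, regH_span hm μ h r p hz' hx.2.2] at hH
  have hnorm : normTwoSq η = ‖b‖ ^ 2 * normTwoSq z ^ 2 := by
    have h1 : (normTwoSq η : ℂ) = ((‖b‖ ^ 2 * normTwoSq z ^ 2 : ℝ) : ℂ) := by
      rw [← pairing_self, hspan, zero_smul, zero_add, pairing_smul_left, pairing_smul_right,
        pairing_crossVec_crossVec hx.2.2, ← mul_assoc, Complex.conj_mul']
      push_cast
      rfl
    exact_mod_cast h1
  simp only
  rw [hnorm]
  refine mul_le_mul_of_nonneg_right ?_ (sq_nonneg _)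
  have hpos' : 0 < shapeCoeff m (r, 0, z, 0) := hpos
  rw [le_div_iff₀ hpos']
  have hτ := tau_nonneg z
  have h1 : 0 ≤ tau z * p ^ 2 / 2 := by positivity
  have h2 : 0 ≤ tau z * μ ^ 2 / (2 * r ^ 2) := by positivity
  have h3 : h * tau z ≤ |h| * tau z := mul_le_mul_of_nonneg_right (le_abs_self h) hτ
  have h4 : shapeCoeff m (r, p, z, 0) = shapeCoeff m (r, 0, z, 0) := rfl
  rw [h4] at hH
  linarith

/-- Lifts with normalized `η`. -/
theorem exists_normalized_lift {m : Fin 3 → ℝ} (hm : ∀ i, 0 < m i) {μ h : ℝ} {y : Body}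
    (hy : y ∈ BodyLevel μ) (hH : bodyH m y = h) : ∃ x ∈ RegFree, regH m μ h x = 0 ∧
      bodySetoid (physMap m μ x) y ∧ pairing (conjVec x.2.2.1) x.2.2.2 = 0 ∧
      x.1 = √(massNormSq m (relPos y.1)) ∧
      x.2.1 = (pairing y.2 y.1).re / √(massNormSq m (relPos y.1)) ∧
      normTwoSq x.2.2.1 = ∑ j, ‖relPos y.1 j‖ := by
  obtain ⟨z, hz⟩ := exists_levi_eq (relPos y.1)
  have hfree := lift_mem_regFree hm hy hz
  have hset := bodySetoid_physMap_lift hm hy hz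
  have hn : (normTwoSq z : ℂ) ≠ 0 := by exact_mod_cast (normTwoSq_pos hfree.1.1.2).ne'
  -- The translation that removes the component of `η` along `conj z`, which the Hamiltonian does
  -- not control.
  set c : ℂ := -(pairing (conjVec z) (lift m μ y.2 z).2.2.2) / (2 * normTwoSq z)
  have h1 : (1 : ℂ) ≠ 0 := one_ne_zero
  have e1 : (regAct 1 c (lift m μ y.2 z)).2.2.1 = z := by simp [regAct, lift]
  have e2 : (regAct 1 c (lift m μ y.2 z)).2.2.2 = (lift m μ y.2 z).2.2.2 + (2 * c) • conjVec z := by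
    funext j
    simp [regAct, conjVec, lift]
  refine ⟨regAct 1 c (lift m μ y.2 z), regAct_mem_regFree h1 c hfree, ?_,
    bodySetoid.trans (bodySetoid.symm (bodySetoid_physMap_regAct m μ h1 c hfree.2)) hset, ?_, ?_,
    ?_, ?_⟩
  · obtain ⟨u, a, hu, hyu⟩ := hset
    have h2 := bodyH_rotate m hu a (physMap m μ (lift m μ y.2 z))
    rw [← hyu, hH] at h2
    rw [regH_regAct _ _ _ h1, regH_eq_tau_mul hm μ h hfree, ← h2, sub_self, mul_zero]
  · rw [e1, e2, pairing_add_right, pairing_smul_right, pairing_self, normTwoSq_conjVec]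
    simp only [c]
    field_simp
    ring
  · rw [← hz]
    rfl
  · rw [← momOf_relMom hy.2.1, pairing_momOf, ← hz, momOf_relMom hy.2.1]
    rfl
  · rw [e1, ← hz]
    simp [normTwoSq, levi]

theorem tau_eq_tauRel {m : Fin 3 → ℝ} (hm : ∀ i, 0 < m i) {μ : ℝ} {x : Reg} (hx : x ∈ RegFree)
    {y : Body} (hxy : bodySetoid (physMap m μ x) y) : tau x.2.2.1 = tauRel (relPos y.1) := by
  obtain ⟨k, c, hk, -, h2⟩ := exists_regAct_eq_lift_of_bodySetoid hm hx hxy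
  rw [← tau_smul hk, ← h2]
  simp [tau, tauRel, rho, levi, normTwoSq]

theorem norm_relPos_eq {m : Fin 3 → ℝ} (hm : ∀ i, 0 < m i) {μ : ℝ} {x : Reg} (hx : x ∈ RegFree)
    {y : Body} (hxy : bodySetoid (physMap m μ x) y) (j : Fin 3) :
    ‖physQ m x j‖ = ‖relPos y.1 j‖ := by
  obtain ⟨u, a, hu, rfl⟩ := hxy
  rw [relPos_rotate, relPos_physMap hm μ hx.1, Pi.smul_apply, norm_smul, hu, one_mul]

end PlanarThreeBody
end

noncomputable section
namespace PlanarThreeBody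

/-! ### Motions that end in a binary collision -/

theorem exists_pair_of_binary {q : Fin 3 → ℂ} (hq1 : ¬ Function.Injective q)
    (hq2 : ¬ (q 0 = q 1 ∧ q 1 = q 2)) : ∃ j, relPos q j = 0 ∧ ∀ i, i ≠ j → relPos q i ≠ 0 := by
  rw [relPos_ne_zero_iff] at hq1
  push Not at hq1
  obtain ⟨j, hj⟩ := hq1
  refine ⟨j, hj, fun i hi hi0 => hq2 ?_⟩
  fin_cases j <;> fin_cases i <;> simp [relPos, sub_eq_zero] at hj hi0 hi ⊢ <;> simp_all

theorem IsRegSolution.mono {m : Fin 3 → ℝ} {μ h : ℝ} {x : ℝ → Reg} {J J' : Set ℝ}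
    (hx : IsRegSolution m μ h x J) (hJ' : J' ⊆ J) (ho : IsOpen J') (hc : J'.OrdConnected) :
    IsRegSolution m μ h x J' :=
  isRegSolution_of_hasDerivAt ho hc fun s hs => ⟨hx.hasDerivAt (hJ' hs), hx.2.2.2 s (hJ' hs)⟩

section

variable {m : Fin 3 → ℝ} (hm : ∀ i, 0 < m i) {μ h a T : ℝ} {w : ℝ → Body} {q : Fin 3 → ℂ}
  {j : Fin 3} (haT : a < T) (hw : IsBodySolution m μ h w (Ioo a T))
  (hq : Tendsto (fun t => (w t).1) (𝓝[<] T) (𝓝 q)) (hj : relPos q j = 0)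
  (hj' : ∀ i, i ≠ j → relPos q i ≠ 0)
include hm haT hw hq hj hj'

/-- Normalized lifts of the states just before the collision stay in a compact set. -/
theorem exists_compact_lifts : ∃ K : Set Reg, IsCompact K ∧ K ⊆ RegDomain ∧
    ∀ᶠ t in 𝓝[<] T, ∃ x ∈ K, x ∈ RegFree ∧ regH m μ h x = 0 ∧
      bodySetoid (physMap m μ x) (w t) := by
  obtain ⟨i, hi⟩ : ∃ i : Fin 3, i ≠ j := ⟨j + 1, by fin_cases j <;> decide⟩
  have hQ := tendsto_relPos hq
  have hne : relPos q ≠ 0 := fun h0 => hj' i hi (congrFun h0 i)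
  have h1 : Tendsto (fun t => √(massNormSq m (relPos (w t).1))) (𝓝[<] T)
      (𝓝 (√(massNormSq m (relPos q)))) :=
    ((Real.continuous_sqrt.comp (contDiff_massNormSq m).continuous).tendsto _).comp hQ
  have hr := Real.sqrt_pos.2 (massNormSq_pos hm hne)
  have h2 : Tendsto (fun t => ∑ j, ‖relPos (w t).1 j‖) (𝓝[<] T) (𝓝 (∑ j, ‖relPos q j‖)) :=
    tendsto_finsetSum _ fun j _ => (tendsto_pi_nhds.1 hQ j).norm
  have hs : 0 < ∑ j, ‖relPos q j‖ :=
    Finset.sum_pos' (fun _ _ => norm_nonneg _) ⟨i, Finset.mem_univ i, norm_pos_iff.2 (hj' i hi)⟩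
  obtain ⟨M, hM⟩ := virial_bounded hm haT hw hq hj hj'
  set r := √(massNormSq m (relPos q))
  set σ := ∑ j, ‖relPos q j‖
  obtain ⟨K, hK, hKd, hKx⟩ := exists_compact_of_bounds hm μ h (r₁ := r / 2) (r₂ := 2 * r)
    (s₁ := σ / 2) (s₂ := 2 * σ) (M := M / (r / 2)) (by positivity) (by positivity)
  refine ⟨K, hK, hKd, ?_⟩
  filter_upwards [h1.eventually (Icc_mem_nhds (by linarith : r / 2 < r) (by linarith : r < 2 * r)),
    h2.eventually (Icc_mem_nhds (by linarith : σ / 2 < σ) (by linarith : σ < 2 * σ)), hM,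
    Ioo_mem_nhdsLT haT] with t h1 h2 hM ht
  obtain ⟨x, hx, hH, hset, hη, e1, e2, e3⟩ :=
    exists_normalized_lift hm (hw.2.2.2 t ht).1 (hw.2.2.2 t ht).2
  refine ⟨x, hKx x hx.1 hH hη (e1 ▸ h1) ?_ (e3 ▸ h2), hx, hH, hset⟩
  rw [e2, mem_Icc, ← abs_le, abs_div, abs_of_nonneg (Real.sqrt_nonneg _)]
  have hM0 : 0 ≤ M := (abs_nonneg _).trans hM
  exact div_le_div₀ hM0 hM (by positivity) h1.1

/-- A lift of the motion is started in the compact set so late that the remaining regularized time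
is less than the uniform existence time `ε`. It coincides with the solution `y` from the same point,
and `y` continues past the end `σ` of the lifted motion. -/
theorem exists_collision_lift_of_pair :
    ∃ (J : Set ℝ) (x : ℝ → Reg) (t : ℝ → ℝ), IsRegSolution m μ h x J ∧ 0 ∈ J ∧ t 0 = T ∧
      (∃ j, (x 0).2.2.1 j = 0) ∧
      ∀ s ∈ J, x s ∈ RegLevel ∧ regH m μ h (x s) = 0 ∧ HasDerivAt t (tau (x s).2.2.1) s ∧
        (s < 0 → x s ∈ RegFree ∧ t s ∈ Ioo a T ∧
          bodySetoid (physMap m μ (x s)) (w (t s))) := by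
  obtain ⟨K, hK, hKd, hKl⟩ := exists_compact_lifts hm haT hw hq hj hj'
  obtain ⟨ε, hε, hsol⟩ := exists_regSolution hm μ h hK hKd
  obtain ⟨B, B', M, hB⟩ := exists_time_bound hm haT hw hq hj hj'
  obtain ⟨t₁, ht₁, hsub⟩ := (mem_nhdsLT_iff_exists_Ioo_subset' haT).1
    ((hB.and hKl).and (Ioo_mem_nhdsLT haT : ∀ᶠ t in 𝓝[<] T, t ∈ Ioo a T))
  have hBd : BddAbove (B '' Ioo t₁ T) := ⟨M, by
    rintro _ ⟨t, ht, rfl⟩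
    exact (hsub ht).1.1.2.2⟩
  have hBne : (B '' Ioo t₁ T).Nonempty := (nonempty_Ioo.2 ht₁).image B
  set S := sSup (B '' Ioo t₁ T)
  -- `B` grows at least as fast as the regularized time, so from `t₂` on less than `ε` of it is
  -- left.
  obtain ⟨_, ⟨t₂, ht₂, rfl⟩, hS⟩ := exists_lt_of_lt_csSup hBne (show S - ε < S by linarith)
  obtain ⟨x₂, hx₂K, hx₂, hH₂, hset₂⟩ := (hsub ht₂).1.2
  obtain ⟨J₇, x₇, t₇, hx₇, h0, hx₇0, ht₇0, hbij, h7⟩ :=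
    exists_lift_motion hm hw (hsub ht₂).2 hx₂ hset₂
  obtain ⟨y, hy, hy0⟩ := hsol x₂ hx₂K
  have hy0' : y 0 ∈ RegLevel := hy0.symm ▸ hx₂.1
  have hmono : StrictMonoOn t₇ J₇ :=
    strictMonoOn_time hm hx₇ (fun s hs => ⟨(h7 s hs).1.1, (h7 s hs).2.1⟩) fun s hs => (h7 s hs).2.2.1
  -- the remaining regularized time
  have hbound : ∀ s ∈ J₇, s ≤ S - B t₂ := by
    intro s hs
    have hSt₂ : B t₂ ≤ S := le_csSup hBd ⟨t₂, ht₂, rfl⟩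
    rcases le_or_gt s 0 with hs0 | hs0
    · linarith
    have hIcc : Icc 0 s ⊆ J₇ := hx₇.2.1.out h0 hs
    have hmem : ∀ r ∈ Icc 0 s, t₇ r ∈ Ioo t₁ T := fun r hr => by
      have h1 := hmono.monotoneOn h0 (hIcc hr) hr.1
      rw [ht₇0] at h1
      exact ⟨ht₂.1.trans_le h1, (hbij.mapsTo (hIcc hr)).2⟩
    have hd : ∀ r ∈ Icc 0 s, HasDerivAt (fun r => B (t₇ r) - r)
        (B' (t₇ r) * tau (x₇ r).2.2.1 - 1) r := fun r hr =>
      ((hsub (hmem r hr)).1.1.1.comp r (h7 r (hIcc hr)).2.2.1).sub (hasDerivAt_id r)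
    -- The derivative is `B' τ - 1`, which is nonnegative because `B' ≥ 1 / τ`.
    have hmon : MonotoneOn (fun r => B (t₇ r) - r) (Icc 0 s) := by
      refine monotoneOn_of_deriv_nonneg (convex_Icc 0 s)
        (fun r hr => (hd r hr).continuousAt.continuousWithinAt)
        (fun r hr => (hd r (interior_subset hr)).differentiableAt.differentiableWithinAt)
        fun r hr => ?_
      have hr' := interior_subset hr
      rw [(hd r hr').deriv]
      have h1 := (hsub (hmem r hr')).1.1.2.1
      have h2 := tau_eq_tauRel hm (h7 r (hIcc hr')).1 (h7 r (hIcc hr')).2.2.2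
      have h3 := tau_pos (h7 r (hIcc hr')).1.2
      rw [← h2] at h1
      have h4 := mul_le_mul_of_nonneg_right h1 h3.le
      rw [inv_mul_cancel₀ h3.ne'] at h4
      linarith
    have h1 := hmon ⟨le_rfl, hs0.le⟩ ⟨hs0.le, le_rfl⟩ hs0.le
    have h2 : B (t₇ s) ≤ S := le_csSup hBd ⟨_, hmem s ⟨hs0.le, le_rfl⟩, rfl⟩
    simp only [ht₇0, sub_zero] at h1
    linarith
  have hJbd : BddAbove J₇ := ⟨_, hbound⟩
  have hJne : J₇.Nonempty := ⟨0, h0⟩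
  set σ := sSup J₇
  have hσε : σ < ε := (csSup_le hJne hbound).trans_lt (by linarith)
  have hσJ : ∀ s ∈ J₇, s < σ := fun s hs => by
    obtain ⟨b, hb, hb'⟩ := (mem_nhdsGE_iff_exists_Ico_subset' (lt_add_one s)).1
      (mem_nhdsWithin_of_mem_nhds (hx₇.1.mem_nhds hs))
    have hb0 : s < b := hb
    have : (s + b) / 2 ∈ J₇ := hb' ⟨by linarith, by linarith⟩
    exact lt_of_lt_of_le (by linarith : s < (s + b) / 2) (le_csSup hJbd this)
  obtain ⟨δ, hδ, hδJ⟩ := Metric.isOpen_iff.1 hx₇.1 0 h0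
  obtain ⟨ε₁, hε₁, hε₁δ, hε₁ε⟩ : ∃ ε₁ > 0, ε₁ < δ ∧ ε₁ < ε :=
    ⟨min δ ε / 2, by positivity, by linarith [min_le_left δ ε, lt_min hδ hε],
      by linarith [min_le_right δ ε, lt_min hδ hε]⟩
  have hσ0 : 0 < σ := hσJ 0 h0
  have hIJ : Ioo (-ε₁) σ ⊆ J₇ := fun s hs => by
    rcases le_or_gt s 0 with hs0 | hs0
    · refine hδJ ?_
      rw [Metric.mem_ball, dist_zero_right, Real.norm_eq_abs, abs_lt]
      exact ⟨by linarith [hs.1], by linarith⟩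
    · obtain ⟨s', hs', hss'⟩ := exists_lt_of_lt_csSup hJne hs.2
      exact hx₇.2.1.out h0 hs' ⟨hs0.le, hss'.le⟩
  have hIy : Ioo (-ε₁) σ ⊆ Ioo (-ε) ε := Ioo_subset_Ioo (by linarith) hσε.le
  have hxy : EqOn x₇ y (Ioo (-ε₁) σ) :=
    (hx₇.mono hIJ isOpen_Ioo ordConnected_Ioo).eqOn hm
      (hy.mono hIy isOpen_Ioo ordConnected_Ioo) ⟨by linarith, hσ0⟩ (hx₇0.trans hy0.symm)
  have hlev : ∀ s ∈ Ioo (-ε) ε, y s ∈ RegLevel ∧ regH m μ h (y s) = 0 := fun s hs => by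
    have := hy.level hm (s₀ := 0) ⟨by linarith, hε⟩ hy0' hs
    rwa [hy0, hH₂] at this
  -- the time tends to the collision time
  have hlim : Tendsto t₇ (𝓝[<] σ) (𝓝 T) := by
    refine tendsto_order.2 ⟨fun b hb => ?_, fun b hb => ?_⟩
    · obtain ⟨b', hb'⟩ := nonempty_Ioo.2 (max_lt hb haT)
      obtain ⟨s', hs', hs'b⟩ := hbij.surjOn (show b' ∈ Ioo a T from
        ⟨(le_max_right b a).trans_lt hb'.1, hb'.2⟩)
      filter_upwards [Ioo_mem_nhdsLT (hσJ s' hs'), Ioo_mem_nhdsLT hσ0] with s hs hs1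
      have h1 := hmono hs' (hIJ ⟨by linarith [hs1.1], hs.2⟩) hs.1
      rw [hs'b] at h1
      exact ((le_max_left b a).trans_lt hb'.1).trans h1
    · filter_upwards [Ioo_mem_nhdsLT hσ0] with s hs
      exact (hbij.mapsTo (hIJ ⟨by linarith [hs.1], hs.2⟩)).2.trans hb
  have hlim' : Tendsto t₇ (𝓝[<] σ) (𝓝[<] T) := by
    refine tendsto_nhdsWithin_iff.2 ⟨hlim, ?_⟩
    filter_upwards [Ioo_mem_nhdsLT hσ0] with s hs
    exact (hbij.mapsTo (hIJ ⟨by linarith [hs.1], hs.2⟩)).2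
  have hσmem : σ ∈ Ioo (-ε) ε := ⟨by linarith, hσε⟩
  -- the collision
  have hcoll : (y σ).2.2.1 j = 0 := by
    have hc : Tendsto (fun s => ‖physQ m (y s) j‖) (𝓝[<] σ) (𝓝 ‖physQ m (y σ) j‖) :=
      ((hasDerivAt_pi.1 (hasDerivAt_physQ hm (hy.hasDerivAt hσmem) (hy.2.2.2 σ hσmem))
        j).continuousAt.norm.tendsto).mono_left nhdsWithin_le_nhds
    have h1 : Tendsto (fun s => ‖relPos (w (t₇ s)).1 j‖) (𝓝[<] σ) (𝓝 0) := by
      have := ((tendsto_pi_nhds.1 (tendsto_relPos hq) j).comp hlim').norm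
      simpa [hj] using this
    have h2 : ‖physQ m (y σ) j‖ = 0 := by
      refine tendsto_nhds_unique hc (h1.congr' ?_)
      filter_upwards [Ioo_mem_nhdsLT (show -ε₁ < σ by linarith)] with s hs
      have h3 := h7 s (hIJ hs)
      rw [← norm_relPos_eq hm h3.1 h3.2.2.2 j, hxy hs]
    rw [norm_physQ hm (hy.2.2.2 σ hσmem)] at h2
    have h3 := div_pos (hy.2.2.2 σ hσmem).1 (sqrt_massNormSq_pos hm (hy.2.2.2 σ hσmem))
    simpa [rho] using (mul_eq_zero.1 h2).resolve_left h3.ne'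
  have hτc : ContinuousOn (fun s => tau (y s).2.2.1) (Ioo (-ε) ε) := fun s hs =>
    (hasDerivAt_comp_of_contDiffAt (contDiffAt_tau (hy.2.2.2 s hs).2)
      (hasDerivAt_reg (hy.hasDerivAt hs)).2.2.1).continuousAt.continuousWithinAt
  obtain ⟨t, htσ, ht⟩ := exists_primitive isOpen_Ioo ordConnected_Ioo hτc hσmem T
  -- Both times have derivative `τ` along the common solution and the same limit `T` at `σ`.
  have heq : ∀ s ∈ Ioo (-ε₁) σ, t s = t₇ s := by
    intro s hs
    have hd : ∀ r ∈ Ioo (-ε₁) σ, HasDerivAt (fun r => t r - t₇ r) 0 r := fun r hr => by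
      have h1 := (ht r (hIy hr)).sub (h7 r (hIJ hr)).2.2.1
      rwa [hxy hr, sub_self] at h1
    have h1 : Tendsto (fun r => t r - t₇ r) (𝓝[<] σ) (𝓝 (T - T)) := by
      refine Tendsto.sub ?_ hlim
      have := (ht σ hσmem).continuousAt.tendsto
      rw [htσ] at this
      exact this.mono_left nhdsWithin_le_nhds
    have h2 : Tendsto (fun _ : ℝ => t s - t₇ s) (𝓝[<] σ) (𝓝 (T - T)) := by
      refine h1.congr' ?_
      filter_upwards [Ioo_mem_nhdsLT (show -ε₁ < σ by linarith)] with r hr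
      exact const_of_hasDerivAt_zero isOpen_Ioo ordConnected_Ioo hd hr hs
    have h3 := tendsto_nhds_unique tendsto_const_nhds h2
    linarith
  -- The parameter is shifted by `σ` so that the collision occurs at `s = 0`.
  have hshift : ∀ s ∈ Ioo (-ε₁ - σ) (ε - σ), s + σ ∈ Ioo (-ε) ε := fun s hs =>
    ⟨by linarith [hs.1], by linarith [hs.2]⟩
  refine ⟨Ioo (-ε₁ - σ) (ε - σ), fun s => y (s + σ), fun s => t (s + σ),
    isRegSolution_of_hasDerivAt isOpen_Ioo ordConnected_Ioo fun s hs =>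
      ⟨(hy.hasDerivAt (hshift s hs)).comp_add_const s σ, hy.2.2.2 _ (hshift s hs)⟩,
    ⟨by linarith, by linarith⟩, by simp only [zero_add, htσ],
    ⟨j, by simpa only [zero_add] using hcoll⟩, fun s hs =>
    ⟨(hlev _ (hshift s hs)).1, (hlev _ (hshift s hs)).2,
      (ht _ (hshift s hs)).comp_add_const s σ, fun hs0 => ?_⟩⟩
  have hmem : s + σ ∈ Ioo (-ε₁) σ := ⟨by linarith [hs.1], by linarith⟩
  have h8 := h7 _ (hIJ hmem)
  beta_reduce
  rw [heq _ hmem, ← hxy hmem]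
  exact ⟨h8.1, hbij.mapsTo (hIJ hmem), h8.2.2.2⟩

end

theorem exists_collision_lift {m : Fin 3 → ℝ} (hm : ∀ i, 0 < m i) {μ h a T : ℝ} {w : ℝ → Body}
    (haT : a < T) (hw : IsBodySolution m μ h w (Ioo a T)) {q : Fin 3 → ℂ}
    (hq : Tendsto (fun t => (w t).1) (𝓝[<] T) (𝓝 q)) (hq1 : ¬ Function.Injective q)
    (hq2 : ¬ (q 0 = q 1 ∧ q 1 = q 2)) :
    ∃ (J : Set ℝ) (x : ℝ → Reg) (t : ℝ → ℝ), IsRegSolution m μ h x J ∧ 0 ∈ J ∧ t 0 = T ∧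
      (∃ j, (x 0).2.2.1 j = 0) ∧
      ∀ s ∈ J, x s ∈ RegLevel ∧ regH m μ h (x s) = 0 ∧ HasDerivAt t (tau (x s).2.2.1) s ∧
        (s < 0 → x s ∈ RegFree ∧ t s ∈ Ioo a T ∧
          bodySetoid (physMap m μ (x s)) (w (t s))) := by
  obtain ⟨j, hj, hj'⟩ := exists_pair_of_binary hq1 hq2
  exact exists_collision_lift_of_pair hm haT hw hq hj hj'

end PlanarThreeBody
end

/-! ### Assembly of the theorem -/

theorem mainTheorem1 (m : Fin 3 → ℝ) (hm : ∀ i, 0 < m i) (μ h : ℝ) :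
    -- the Hamiltonian and the equations are regular on the whole phase space, collisions included
    (ContDiffOn ℝ ∞ (regH m μ h) RegDomain ∧ ContDiffOn ℝ ∞ (regField m μ h) RegDomain ∧
      ∀ u v, ContDiffOn ℝ ∞ (fun x => regForm m μ x u v) RegDomain) ∧
    -- invariance, and conservation of the Hamiltonian on the invariant set
    (∀ x J, IsRegSolution m μ h x J → ∀ s₀ ∈ J, x s₀ ∈ RegLevel →
      ∀ s ∈ J, x s ∈ RegLevel ∧ regH m μ h (x s) = regH m μ h (x s₀)) ∧
    -- on the invariant set, the equations are Hamiltonian for the restricted form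
    (∀ x ∈ RegLevel, regField m μ h x ∈ RegTangent x ∧
      (∀ v ∈ RegTangent x,
        regForm m μ x (regField m μ h x) v = fderiv ℝ (regH m μ h) x v) ∧
      -- and agree, modulo translations of `η`, with those of the form on the full phase space
      ∃ c : ℂ, ∀ v, regForm m μ x
        (regField m μ h x + (0, 0, 0, fun j => c * conj (x.2.2.1 j))) v
          = fderiv ℝ (regH m μ h) x v) ∧
    -- the restricted form is closed, and its kernel is tangent to the group orbits
    (∀ x ∈ RegLevel,
      (∀ u ∈ RegTangent x, ∀ v ∈ RegTangent x, ∀ w ∈ RegTangent x,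
        extDerivTwo (regForm m μ) x u v w = 0) ∧
      ∀ u, (u ∈ RegTangent x ∧ ∀ v ∈ RegTangent x, regForm m μ x u v = 0) ↔
        ∃ κ c : ℂ, u = (0, 0, fun j => κ * x.2.2.1 j,
          fun j => -conj κ * x.2.2.2 j + c * conj (x.2.2.1 j))) ∧
    -- the group acts by symmetries
    (∀ k c : ℂ, k ≠ 0 → ∀ x ∈ RegLevel, regAct k c x ∈ RegLevel ∧
      regH m μ h (regAct k c x) = regH m μ h x ∧
      ∀ u ∈ RegTangent x, ∀ v ∈ RegTangent x,
        regForm m μ (regAct k c x) (regAct k c u) (regAct k c v) = regForm m μ x u v) ∧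
    -- the flow exists locally and passes to the quotient
    (∀ x₀ ∈ RegLevel, ∃ ε > 0, ∃ x, IsRegSolution m μ h x (Ioo (-ε) ε) ∧ x 0 = x₀) ∧
    (∀ x y J, IsRegSolution m μ h x J → IsRegSolution m μ h y J →
      ∀ s₀ ∈ J, x s₀ ∈ RegLevel → regSetoid (x s₀) (y s₀) → ∀ s ∈ J, regSetoid (x s) (y s)) ∧
    -- away from collisions, the quotient lies over the reduced three-body problem
    (∃ Φ : RegFreeQuotient → BodyQuotient μ,
      (∀ x : RegFree, ∃ y : BodyLevel μ, (y : Body) = physMap m μ x ∧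
        Φ (Quotient.mk _ x) = Quotient.mk _ y) ∧
      IsLocalHomeomorph Φ ∧ Function.Surjective Φ ∧ ∀ b, (Φ ⁻¹' {b}).ncard = 4) ∧
    -- symplectically, and compatibly with the Hamiltonians
    (∀ x ∈ RegFree, ContDiffAt ℝ ∞ (physMap m μ) x ∧
      (∀ u ∈ RegTangent x, ∀ v ∈ RegTangent x,
        bodyForm (fderiv ℝ (physMap m μ) x u) (fderiv ℝ (physMap m μ) x v) = regForm m μ x u v) ∧
      regH m μ h x = tau x.2.2.1 * (bodyH m (physMap m μ x) - h)) ∧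
    -- zero-energy solutions cross the collision set transversally
    (∀ x ∈ RegLevel, regH m μ h x = 0 → ∀ j, x.2.2.1 j = 0 → (regField m μ h x).2.2.1 j ≠ 0) ∧
    -- after the time change `dt = τ ds` zero-energy solutions are, modulo rotations and
    -- translations, three-body motions of energy `h`, continued through binary collisions
    (∀ x J, IsRegSolution m μ h x J → (∀ s ∈ J, x s ∈ RegLevel ∧ regH m μ h (x s) = 0) →
      ∃ (t : ℝ → ℝ) (w : ℝ → Body), (∀ s ∈ J, HasDerivAt t (tau (x s).2.2.1) s) ∧
        StrictMonoOn t J ∧ ContinuousOn (fun T => (w T).1) (t '' J) ∧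
        ∀ s ∈ J, (∀ j, relPos (w (t s)).1 j = 0 ↔ (x s).2.2.1 j = 0) ∧
          ((∀ j, (x s).2.2.1 j ≠ 0) →
            w (t s) ∈ BodyLevel μ ∧ bodyH m (w (t s)) = h ∧
            bodySetoid (physMap m μ (x s)) (w (t s)) ∧
            HasDerivAt w (bodyField m (w (t s))) (t s))) ∧
    -- conversely, every collision-free three-body motion of energy `h` lifts, from any initial lift
    (∀ w I, IsBodySolution m μ h w I → ∀ t₀ ∈ I, ∀ x₀ ∈ RegFree,
      bodySetoid (physMap m μ x₀) (w t₀) →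
      ∃ (J : Set ℝ) (x : ℝ → Reg) (t : ℝ → ℝ), IsRegSolution m μ h x J ∧ 0 ∈ J ∧ x 0 = x₀ ∧
        t 0 = t₀ ∧ BijOn t J I ∧
        ∀ s ∈ J, x s ∈ RegFree ∧ regH m μ h (x s) = 0 ∧ HasDerivAt t (tau (x s).2.2.1) s ∧
          bodySetoid (physMap m μ (x s)) (w (t s))) ∧
    -- and every motion that ends in a binary collision lifts to a solution that passes through it
    (∀ w a T, a < T → IsBodySolution m μ h w (Ioo a T) → ∀ q : Fin 3 → ℂ,
      Tendsto (fun t => (w t).1) (𝓝[<] T) (𝓝 q) → ¬ Function.Injective q →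
      ¬ (q 0 = q 1 ∧ q 1 = q 2) →
      ∃ (J : Set ℝ) (x : ℝ → Reg) (t : ℝ → ℝ), IsRegSolution m μ h x J ∧ 0 ∈ J ∧ t 0 = T ∧
        (∃ j, (x 0).2.2.1 j = 0) ∧
        ∀ s ∈ J, x s ∈ RegLevel ∧ regH m μ h (x s) = 0 ∧ HasDerivAt t (tau (x s).2.2.1) s ∧
          (s < 0 → x s ∈ RegFree ∧ t s ∈ Ioo a T ∧
            bodySetoid (physMap m μ (x s)) (w (t s)))) := by
  refine ⟨⟨fun x hx => (contDiffAt_regH hm μ h hx).contDiffWithinAt,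
    fun x hx => (contDiffAt_regField hm μ h hx).contDiffWithinAt,
    fun u v x hx => (contDiffAt_regForm hm μ u v hx).contDiffWithinAt⟩,
    fun x J hx s₀ hs₀ h0 s hs => hx.level hm hs₀ h0 hs, fun x hx =>
    ⟨regField_mem_regTangent hm μ h hx, fun v hv => regForm_regField_tangent hm μ h hx hv, ?_⟩,
    fun x hx => ⟨fun u hu v hv w hw => extDerivTwo_regForm hm μ hx hu hv hw,
      fun u => regForm_kernel m μ hx u⟩,
    fun k c hk x hx => ⟨regAct_mem_regLevel hk c hx, regH_regAct m μ h hk c x,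
      fun u _ v _ => regForm_regAct m μ hk c x u v⟩, fun x₀ hx₀ => ?_,
    fun x y J hx hy s₀ hs₀ _ h0 s hs => hx.regSetoid hm hy hs₀ h0 hs,
    ⟨quotMap hm μ, fun x => ⟨⟨physMap m μ x, physMap_mem_bodyLevel hm μ x.2⟩, rfl, rfl⟩,
      isLocalHomeomorph_quotMap hm μ, surjective_quotMap hm μ, ncard_quotMap_fiber hm⟩,
    fun x hx => ⟨contDiffAt_physMap hm μ hx.1.1 hx.2,
      fun u hu v hv => bodyForm_physMap hm μ hx hu hv, regH_eq_tau_mul hm μ h hx⟩,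
    fun x hx hH j hj => regField_transversal hm μ h hx hH hj,
    fun x J hx hl => exists_bodyMotion hm hx hl,
    fun w I hw t₀ ht₀ x₀ hx₀ h0 => exists_lift_motion hm hw ht₀ hx₀ h0,
    fun w a T haT hw q hq hq1 hq2 => exists_collision_lift hm haT hw hq hq1 hq2⟩
  · obtain ⟨c, hc⟩ := regForm_regField hm μ h hx
    exact ⟨c, fun v => by rw [← hc v]; exact regForm_translation m μ x _ v (c • conjVec x.2.2.1)⟩
  · obtain ⟨ε, hε, hx⟩ := exists_regSolution hm μ h (isCompact_singleton (x := x₀))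
      (singleton_subset_iff.2 hx₀.1)
    exact ⟨ε, hε, hx x₀ rfl⟩
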